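/- **Conventions.** Let $M$ be a smooth manifold and $\mathcal E\to M$ an exact Courant algebroid with pairing $\langle\cdot,\cdot\rangle$ (symmetric, fibrewise nondegenerate), anchor $\pi:\mathcal E\to TM$ and bracket $[\![\cdot,\cdot]\!]$ on $\Gamma(\mathcal E)$: for all sections $e_i$ and functions $f$, $[\![e_1,[\![e_2,e_3]\!]]\!]=[\![[\![e_1,e_2]\!],e_3]\!]+[\![e_2,[\![e_1,e_3]\!]]\!]$, $\pi[\![e_1,e_2]\!]=[\pi e_1,\pi e_2]$, $[\![e_1,fe_2]\!]=f[\![e_1,e_2]\!]+(\pi(e_1)f)e_2$, $\pi(e_1)\langle e_2,e_3\rangle=\langle[\![e_1,e_2]\!],e_3\rangle+\langle e_2,[\![e_1,e_3]\!]\rangle$, $[\![e,e]\!]=\tfrac12\pi^*d\langle e,e\rangle$, and $0\to T^*M\xrightarrow{\pi^*}\mathcal E\xrightarrow{\pi}TM\to0$ is exact. A *strong KT structure* on $\mathcal E$ is a pair $(\mathcal G,\mathcal I)$, where $\mathcal G$ is a generalized metric (a smooth, orthogonal, self-adjoint endomorphism of $\mathcal E$ with $\langle\mathcal Ge,e\rangle>0$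 for $e\ne0$), with $\pm1$-eigenbundles $V_\pm$, and $\mathcal I$ is a smooth complex structure on $V_+$, orthogonal for the pairing, whose $+i$-eigenbundle $L\subset V_+\otimes\mathbb C$ is closed under the complexified bracket. Let $G$ be a connected Lie group with Lie algebra $\mathfrak g$ acting smoothly on $M$, let $\mathfrak a\to\mathfrak g$ be an exact Courant algebra (a real vector space with a bilinear bracket satisfying the Leibniz identity above and a surjective bracket-preserving linear map to $\mathfrak g$ on whose kernel $\mathfrak h$ the bracket vanishes), and let $\Psi:\mathfrak a\to\Gamma(\mathcal E)$ be an extended action: a linear bracket-preserving map that sends $\mathfrak h$ to closed 1-forms, together with a smooth action of $G$ on $\mathcal E$ by Courant algebroid automorphisms covering the action on $M$, such that the infinitesimal actions of $G$ on $M$ and on $\Gamma(\mathcal E)$ are given by $\pi\circ\Psi$ and by $[\![\Psi(\cdot),\cdot]\!]$. Put $K=\Psi(\mathfrak a)\subset\mathcal E$ (pointwise), let $K^\perp$ be its orthogonal complement for the pairing, and $\Delta_b=\pi(K+K^\perp)\subset TM$. Let $P$ be a leaf of $\Delta_b$ (a maximal connected injectively immersed integral submanifold) on which $G$ acts smoothly,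 freely and properly, and over which $K$ is isotropic. The reduced algebroid over the orbit space $P/G$ is $\mathcal E^{red}=\big(K^\perp|_P/K|_P\big)/G$, with projection $p$ from $G$-invariant families in $K^\perp|_P$. Its pairing is induced by that of $K^\perp$, and its smooth sections are the classes of smooth $G$-invariant sections of $K^\perp|_P$. **Theorem.** Suppose the action of $G$ on $\mathcal E$ preserves a strong KT structure $(\mathcal G,\mathcal I)$. 1. There is exactly one bracket on $\Gamma(\mathcal E^{red})$ such that, for all $e_1,e_2\in\Gamma(\mathcal E^{red})$, all smooth $G$-invariant lifts $\tilde e_1,\tilde e_2\in\Gamma(K^\perp|_P)$ of them, every $x\in P$ and all $\mathtt e_1,\mathtt e_2\in\Gamma(\mathcal E)$ that restrict to $\tilde e_1,\tilde e_2$ on a neighbourhood of $x$ in $P$, the vector $[\![\mathtt e_1,\mathtt e_2]\!](x)$ lies in $K^\perp$ and represents $[\![e_1,e_2]\!]$ at the orbit of $x$. 2. With this bracket, $(\mathcal G,\mathcal I)$ reduces to a strong KT structure on $\mathcal E^{red}$, i.e. there is a strong KT structure $(\mathcal G^{red},\mathcal I^{red})$ on $\mathcal E^{red}$ with $V_\pm^{red}=p(V_\pm\cap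 K^\perp)$ and with $+i$-eigenbundle $L^{red}=p\big(L\cap(K^\perp\otimes\mathbb C)\big)$, if and only if $$\mathcal I(K^\perp\cap V_+)=K^\perp\cap V_+\quad\text{over }P.$$ -/

import Mathlib

open Bundle Manifold Filter
open scoped Manifold ContDiff Topology

noncomputable section

/-! ### Generalized metrics and strong KT structures

A `BracketedBundle` records only what the definitions of a generalized metric and of a strong KT
structure refer to: a family of real vector spaces over a base, the (smooth) sections, the pairing
and the bracket.  The same definitions are applied to the given Courant algebroid over `M` and to
the reduced Courant algebroid over `P / G`. -/

/-- A family of vector spaces `V b` with a space `Γ` of smooth sections, a fibrewise bilinear form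
and a bracket on sections. -/
structure BracketedBundle {B : Type*} (V : B → Type*) [∀ b, AddCommGroup (V b)]
    [∀ b, Module ℝ (V b)] (Γ : Type*) where
  /-- the value of a section at a point -/
  ev : Γ → ∀ b, V b
  /-- the fibrewise pairing -/
  pairing : ∀ b, LinearMap.BilinForm ℝ (V b)
  /-- the bracket of sections -/
  bracket : Γ → Γ → Γ

section KT

variable {B : Type*} {V : B → Type*} [∀ b, AddCommGroup (V b)] [∀ b, Module ℝ (V b)]
  {Γ : Type*}

/-- A generalized metric: a smooth orthogonal self-adjoint bundle endomorphism `𝒢` such that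
`⟨𝒢 e, e⟩ > 0` for `e ≠ 0`.  Smooth means that smooth sections are mapped to smooth sections. -/
structure IsGeneralizedMetric (A : BracketedBundle V Γ) (𝒢 : ∀ b, Module.End ℝ (V b)) : Prop where
  smooth : ∀ s : Γ, ∃ t : Γ, ∀ b, A.ev t b = 𝒢 b (A.ev s b)
  orthogonal : ∀ b u v, A.pairing b (𝒢 b u) (𝒢 b v) = A.pairing b u v
  selfAdjoint : ∀ b u v, A.pairing b (𝒢 b u) v = A.pairing b u (𝒢 b v)
  pos : ∀ b u, u ≠ 0 → 0 < A.pairing b (𝒢 b u) u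

/-- The `+1`-eigenspace `V₊` of `𝒢`. -/
abbrev Vplus (𝒢 : ∀ b, Module.End ℝ (V b)) (b : B) : Submodule ℝ (V b) :=
  Module.End.eigenspace (𝒢 b) 1

/-- The `-1`-eigenspace `V₋` of `𝒢`. -/
abbrev Vminus (𝒢 : ∀ b, Module.End ℝ (V b)) (b : B) : Submodule ℝ (V b) :=
  Module.End.eigenspace (𝒢 b) (-1)

/-- The `+i`-eigenspace `L` of `ℐ` in the complexification of `V₊`.  The pair `(u, v)` stands for
the complex vector `u + i v`; the equation `ℐ (u + i v) = i (u + i v)` then reads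
`ℐ u = - v` and `ℐ v = u`. -/
def plusIEigenspace (𝒢 : ∀ b, Module.End ℝ (V b)) (ℐ : ∀ b, Vplus 𝒢 b →ₗ[ℝ] Vplus 𝒢 b) (b : B) :
    Set (V b × V b) :=
  {w | ∃ (h₁ : w.1 ∈ Vplus 𝒢 b) (h₂ : w.2 ∈ Vplus 𝒢 b),
    ℐ b ⟨w.1, h₁⟩ = -⟨w.2, h₂⟩ ∧ ℐ b ⟨w.2, h₂⟩ = ⟨w.1, h₁⟩}

/-- A strong KT structure: a generalized metric with a smooth orthogonal complex structure `ℐ` on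
`V₊` whose `+i`-eigenspace is closed under the (complex bilinear extension of the) bracket:
`[a₁ + i b₁, a₂ + i b₂] = ([a₁, a₂] - [b₁, b₂]) + i ([a₁, b₂] + [b₁, a₂])`. -/
structure IsStrongKT (A : BracketedBundle V Γ) (𝒢 : ∀ b, Module.End ℝ (V b))
    (ℐ : ∀ b, Vplus 𝒢 b →ₗ[ℝ] Vplus 𝒢 b) : Prop where
  metric : IsGeneralizedMetric A 𝒢
  smooth : ∀ (s : Γ) (hs : ∀ b, A.ev s b ∈ Vplus 𝒢 b),
    ∃ t : Γ, ∀ b, A.ev t b = ℐ b ⟨A.ev s b, hs b⟩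
  sq_eq_neg : ∀ b u, ℐ b (ℐ b u) = -u
  orthogonal : ∀ b (u v : Vplus 𝒢 b),
    A.pairing b (ℐ b u : V b) (ℐ b v : V b) = A.pairing b (u : V b) (v : V b)
  integrable : ∀ a₁ b₁ a₂ b₂ : Γ,
    (∀ b, (A.ev a₁ b, A.ev b₁ b) ∈ plusIEigenspace 𝒢 ℐ b) →
    (∀ b, (A.ev a₂ b, A.ev b₂ b) ∈ plusIEigenspace 𝒢 ℐ b) →
    ∀ b, (A.ev (A.bracket a₁ a₂) b - A.ev (A.bracket b₁ b₂) b,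
      A.ev (A.bracket a₁ b₂) b + A.ev (A.bracket b₁ a₂) b) ∈ plusIEigenspace 𝒢 ℐ b

end KT

/-! ### Courant algebroids -/

section Courant

variable {EM : Type*} [NormedAddCommGroup EM] [NormedSpace ℝ EM]
  {M : Type*} [TopologicalSpace M] [ChartedSpace EM M]

/-- The derivative of a function `f` at `x` in the direction `v`. -/
def dirDeriv (f : M → ℝ) (x : M) (v : TangentSpace 𝓘(ℝ, EM) x) : ℝ :=
  mfderiv 𝓘(ℝ, EM) 𝓘(ℝ, ℝ) f x v

variable [IsManifold 𝓘(ℝ, EM) ∞ M]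

/-- A 1-form is closed: `X(ξ(Y)) - Y(ξ(X)) - ξ([X, Y]) = 0` for all smooth vector fields. -/
def IsClosedOneForm (ξ : ∀ x : M, TangentSpace 𝓘(ℝ, EM) x →ₗ[ℝ] ℝ) : Prop :=
  ∀ (X Y : ∀ x : M, TangentSpace 𝓘(ℝ, EM) x),
    ContMDiff 𝓘(ℝ, EM) (𝓘(ℝ, EM).prod 𝓘(ℝ, EM)) ∞
      (fun x => (TotalSpace.mk' EM x (X x) : TangentBundle 𝓘(ℝ, EM) M)) →
    ContMDiff 𝓘(ℝ, EM) (𝓘(ℝ, EM).prod 𝓘(ℝ, EM)) ∞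
      (fun x => (TotalSpace.mk' EM x (Y x) : TangentBundle 𝓘(ℝ, EM) M)) →
    ∀ x, dirDeriv (fun y => ξ y (Y y)) x (X x) - dirDeriv (fun y => ξ y (X y)) x (Y x)
      - ξ x (VectorField.mlieBracket 𝓘(ℝ, EM) X Y x) = 0

variable (EM) (F : Type*) [NormedAddCommGroup F] [NormedSpace ℝ F]
  (E : M → Type*) [TopologicalSpace (TotalSpace F E)] [∀ x, AddCommGroup (E x)]
  [∀ x, Module ℝ (E x)] [∀ x, TopologicalSpace (E x)] [FiberBundle F E] [VectorBundle ℝ F E]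

/-- A Courant algebroid structure on a smooth vector bundle `E` over `M`. -/
structure CourantAlgebroid where
  /-- the fibrewise pairing -/
  pairing : ∀ x, LinearMap.BilinForm ℝ (E x)
  /-- the anchor `π : E → TM` -/
  anchor : ∀ x, E x →ₗ[ℝ] TangentSpace 𝓘(ℝ, EM) x
  /-- the bracket on smooth sections -/
  bracket : Cₛ^∞⟮𝓘(ℝ, EM); F, E⟯ →ₗ[ℝ] Cₛ^∞⟮𝓘(ℝ, EM); F, E⟯ →ₗ[ℝ] Cₛ^∞⟮𝓘(ℝ, EM); F, E⟯
  pairing_smooth : ∀ s t : Cₛ^∞⟮𝓘(ℝ, EM); F, E⟯,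
    ContMDiff 𝓘(ℝ, EM) 𝓘(ℝ, ℝ) ∞ (fun x => pairing x (s x) (t x))
  pairing_symm : ∀ x u v, pairing x u v = pairing x v u
  pairing_nondegenerate : ∀ x u, (∀ v, pairing x u v = 0) → u = 0
  anchor_smooth : ∀ s : Cₛ^∞⟮𝓘(ℝ, EM); F, E⟯,
    ContMDiff 𝓘(ℝ, EM) (𝓘(ℝ, EM).prod 𝓘(ℝ, EM)) ∞
      (fun x => (TotalSpace.mk' EM x (anchor x (s x)) : TangentBundle 𝓘(ℝ, EM) M))
  leibniz : ∀ e₁ e₂ e₃,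
    bracket e₁ (bracket e₂ e₃) = bracket (bracket e₁ e₂) e₃ + bracket e₂ (bracket e₁ e₃)
  anchor_bracket : ∀ e₁ e₂ x, anchor x (bracket e₁ e₂ x) =
    VectorField.mlieBracket 𝓘(ℝ, EM) (fun y => anchor y (e₁ y)) (fun y => anchor y (e₂ y)) x
  /-- `[e₁, f e₂] = f [e₁, e₂] + (π(e₁) f) e₂`, with `e₃ = f e₂`. -/
  bracket_smul : ∀ (f : M → ℝ), ContMDiff 𝓘(ℝ, EM) 𝓘(ℝ, ℝ) ∞ f →
    ∀ e₁ e₂ e₃ : Cₛ^∞⟮𝓘(ℝ, EM); F, E⟯, (∀ x, e₃ x = f x • e₂ x) →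
    ∀ x, bracket e₁ e₃ x = f x • bracket e₁ e₂ x + dirDeriv f x (anchor x (e₁ x)) • e₂ x
  bracket_pairing : ∀ (e₁ e₂ e₃ : Cₛ^∞⟮𝓘(ℝ, EM); F, E⟯) (x : M),
    dirDeriv (fun y => pairing y (e₂ y) (e₃ y)) x (anchor x (e₁ x)) =
      pairing x (bracket e₁ e₂ x) (e₃ x) + pairing x (e₂ x) (bracket e₁ e₃ x)
  /-- `[e, e] = 𝒟⟨e, e⟩`, where `𝒟 f` is the section with `⟨𝒟 f, v⟩ = ½ df(π v)`. -/
  bracket_self : ∀ (e : Cₛ^∞⟮𝓘(ℝ, EM); F, E⟯) (x : M) (v : E x),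
    pairing x (bracket e e x) v =
      (1 / 2 : ℝ) * dirDeriv (fun y => pairing y (e y) (e y)) x (anchor x v)

variable {EM F E}

namespace CourantAlgebroid

variable (C : CourantAlgebroid EM F E)

/-- Exactness of `0 → T*M → E → TM → 0`: `π` is onto (equivalently, its dual `π*` is injective)
and the kernel of `π` is the image of `π*`, where `⟨π* ξ, v⟩ = ξ(π v)`. -/
structure IsExact : Prop where
  surjective : ∀ x, Function.Surjective (C.anchor x)
  ker_eq_range : ∀ x (u : E x), C.anchor x u = 0 ↔
    ∃ ξ : TangentSpace 𝓘(ℝ, EM) x →ₗ[ℝ] ℝ, ∀ v, C.pairing x u v = ξ (C.anchor x v)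

/-- The section `u` of `E` is (the image under `π*` of) a closed 1-form on `M`. -/
def IsClosedForm (u : Cₛ^∞⟮𝓘(ℝ, EM); F, E⟯) : Prop :=
  ∃ ξ : ∀ x : M, TangentSpace 𝓘(ℝ, EM) x →ₗ[ℝ] ℝ,
    (∀ x v, C.pairing x (u x) v = ξ x (C.anchor x v)) ∧ IsClosedOneForm ξ

/-- The pairing and bracket of a Courant algebroid. -/
def toBracketedBundle : BracketedBundle E Cₛ^∞⟮𝓘(ℝ, EM); F, E⟯ where
  ev s x := s x
  pairing := C.pairing
  bracket s t := C.bracket s t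

end CourantAlgebroid

end Courant

/-! ### Courant algebras and extended actions -/

/-- A Courant algebra over the Lie algebra `𝔤`. -/
structure CourantAlgebra (𝔞 : Type*) [AddCommGroup 𝔞] [Module ℝ 𝔞]
    (𝔤 : Type*) [AddCommGroup 𝔤] [Module ℝ 𝔤] [Bracket 𝔤 𝔤] where
  /-- the bracket of the Courant algebra -/
  bracket : 𝔞 →ₗ[ℝ] 𝔞 →ₗ[ℝ] 𝔞
  /-- the projection to the Lie algebra -/
  proj : 𝔞 →ₗ[ℝ] 𝔤
  leibniz : ∀ a b c, bracket a (bracket b c) = bracket (bracket a b) c + bracket b (bracket a c)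
  proj_bracket : ∀ a b, proj (bracket a b) = ⁅proj a, proj b⁆

/-- Exactness of a Courant algebra. -/
structure CourantAlgebra.IsExact {𝔞 : Type*} [AddCommGroup 𝔞] [Module ℝ 𝔞]
    {𝔤 : Type*} [AddCommGroup 𝔤] [Module ℝ 𝔤] [Bracket 𝔤 𝔤] (𝒜 : CourantAlgebra 𝔞 𝔤) : Prop where
  surjective : Function.Surjective 𝒜.proj
  bracket_ker : ∀ a b, 𝒜.proj a = 0 → 𝒜.proj b = 0 → 𝒜.bracket a b = 0

section Action

variable {EM : Type*} [NormedAddCommGroup EM] [NormedSpace ℝ EM]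
  {M : Type*} [TopologicalSpace M] [ChartedSpace EM M] [IsManifold 𝓘(ℝ, EM) ∞ M]
  {F : Type*} [NormedAddCommGroup F] [NormedSpace ℝ F]
  {E : M → Type*} [TopologicalSpace (TotalSpace F E)] [∀ x, AddCommGroup (E x)]
  [∀ x, Module ℝ (E x)] [∀ x, TopologicalSpace (E x)] [FiberBundle F E] [VectorBundle ℝ F E]
  {EG : Type*} [NormedAddCommGroup EG] [NormedSpace ℝ EG]
  {G : Type*} [TopologicalSpace G] [ChartedSpace EG G] [Group G] [MulAction G M]
  {𝔞 : Type*} [AddCommGroup 𝔞] [Module ℝ 𝔞]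

/-- An extended action of the Courant algebra `𝔞 → 𝔤`, where `𝔤` is the Lie algebra of the Lie
group `G` acting on `M`: a morphism `Ψ : 𝔞 → Γ(E)` of Courant algebras that maps the kernel `𝔥`
of `𝔞 → 𝔤` to closed 1-forms, together with a smooth action of the same group `G` on `E` by
symmetries of the Courant algebroid covering the action on `M`, such that the two actions integrate
the infinitesimal actions `π ∘ Ψ` on `M` and `ad ∘ Ψ` on `E`. -/
structure ExtendedAction (C : CourantAlgebroid EM F E)
    (𝒜 : CourantAlgebra 𝔞 (GroupLieAlgebra 𝓘(ℝ, EG) G)) where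
  /-- the map `Ψ` -/
  Ψ : 𝔞 →ₗ[ℝ] Cₛ^∞⟮𝓘(ℝ, EM); F, E⟯
  map_bracket : ∀ a b, Ψ (𝒜.bracket a b) = C.bracket (Ψ a) (Ψ b)
  closed_of_proj_eq_zero : ∀ a, 𝒜.proj a = 0 → C.IsClosedForm (Ψ a)
  /-- the action of `G` on the fibres of `E` -/
  act : ∀ (g : G) (x : M), E x →ₗ[ℝ] E (g • x)
  act_one : ∀ (x : M) (v : E x),
    TotalSpace.mk' F ((1 : G) • x) (act 1 x v) = TotalSpace.mk' F x v
  act_mul : ∀ (g h : G) (x : M) (v : E x),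
    TotalSpace.mk' F ((g * h) • x) (act (g * h) x v) =
      TotalSpace.mk' F (g • h • x) (act g (h • x) (act h x v))
  act_smooth : ContMDiff (𝓘(ℝ, EG).prod (𝓘(ℝ, EM).prod 𝓘(ℝ, F))) (𝓘(ℝ, EM).prod 𝓘(ℝ, F)) ∞
    (fun w : G × TotalSpace F E => TotalSpace.mk' F (w.1 • w.2.proj) (act w.1 w.2.proj w.2.snd))
  act_pairing : ∀ (g : G) (x : M) (u v : E x),
    C.pairing (g • x) (act g x u) (act g x v) = C.pairing x u v
  act_anchor : ∀ (g : G) (x : M) (v : E x),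
    C.anchor (g • x) (act g x v) =
      mfderiv 𝓘(ℝ, EM) 𝓘(ℝ, EM) (fun y : M => g • y) x (C.anchor x v)
  /-- `[g · s, g · t] = g · [s, t]`, where `s' = g · s` and `t' = g · t`. -/
  act_bracket : ∀ (g : G) (s t s' t' : Cₛ^∞⟮𝓘(ℝ, EM); F, E⟯),
    (∀ x, s' (g • x) = act g x (s x)) → (∀ x, t' (g • x) = act g x (t x)) →
    ∀ x, C.bracket s' t' (g • x) = act g x (C.bracket s t x)
  /-- The infinitesimal action of `γ = proj a` on functions, the derivative at `0` of
  `t ↦ f (exp (-tγ) • x)`, is the derivative along `π (Ψ a)`. -/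
  generator : ∀ (a : 𝔞) (f : M → ℝ), ContMDiff 𝓘(ℝ, EM) 𝓘(ℝ, ℝ) ∞ f → ∀ x : M,
    dirDeriv (fun g : G => f (g • x)) 1 (𝒜.proj a) = -dirDeriv f x (C.anchor x (Ψ a x))
  /-- The infinitesimal action of `γ = proj a` on sections, the derivative at `0` of
  `t ↦ exp (tγ) · s (exp (-tγ) • x)`, is `[Ψ a, s] x`.  It is tested against vectors `v : E x`,
  using `⟨v, g⁻¹ · s (g • x)⟩ = ⟨g · v, s (g • x)⟩`. -/
  generator_section : ∀ (a : 𝔞) (s : Cₛ^∞⟮𝓘(ℝ, EM); F, E⟯) (x : M) (v : E x),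
    dirDeriv (fun g : G => C.pairing (g • x) (act g x v) (s (g • x))) 1 (𝒜.proj a) =
      -C.pairing x v (C.bracket (Ψ a) s x)

namespace ExtendedAction

variable {C : CourantAlgebroid EM F E} {𝒜 : CourantAlgebra 𝔞 (GroupLieAlgebra 𝓘(ℝ, EG) G)}
  (X : ExtendedAction C 𝒜)

/-- The distribution `K = Ψ(𝔞)` in `E`. -/
def K (x : M) : Submodule ℝ (E x) := Submodule.span ℝ (Set.range fun a : 𝔞 => X.Ψ a x)

/-- The distribution `K^⊥` in `E`. -/
def Kperp (x : M) : Submodule ℝ (E x) := (C.pairing x).orthogonal (X.K x)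

/-- The distribution `Δ_b = π(K + K^⊥)` on `M`. -/
def bigDistribution (x : M) : Submodule ℝ (TangentSpace 𝓘(ℝ, EM) x) :=
  (X.K x ⊔ X.Kperp x).map (C.anchor x)

/-- The action preserves `𝒢` and `ℐ`. -/
structure Preserves (𝒢 : ∀ x, Module.End ℝ (E x)) (ℐ : ∀ x, Vplus 𝒢 x →ₗ[ℝ] Vplus 𝒢 x) :
    Prop where
  metric : ∀ (g : G) (x : M) (v : E x), 𝒢 (g • x) (X.act g x v) = X.act g x (𝒢 x v)
  complex : ∀ (g : G) (x : M) (v : Vplus 𝒢 x) (w : Vplus 𝒢 (g • x)),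
    (w : E (g • x)) = X.act g x (v : E x) →
      (ℐ (g • x) w : E (g • x)) = X.act g x (ℐ x v : E x)

end ExtendedAction

end Action

/-! ### Leaves -/

/-- `ι : P → M` is a leaf of the distribution `Δ`: a maximal connected injectively immersed
integral submanifold. -/
structure IsLeaf.{u} {EM : Type*} [NormedAddCommGroup EM] [NormedSpace ℝ EM]
    {M : Type*} [TopologicalSpace M] [ChartedSpace EM M]
    {EP : Type*} [NormedAddCommGroup EP] [NormedSpace ℝ EP]
    {P : Type u} [TopologicalSpace P] [ChartedSpace EP P]
    (Δ : ∀ x : M, Submodule ℝ (TangentSpace 𝓘(ℝ, EM) x)) (ι : P → M) : Prop where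
  connected : ConnectedSpace P
  immersion : IsImmersion 𝓘(ℝ, EP) 𝓘(ℝ, EM) ∞ ι
  injective : Function.Injective ι
  tangent : ∀ p, LinearMap.range (mfderiv 𝓘(ℝ, EP) 𝓘(ℝ, EM) ι p).toLinearMap = Δ (ι p)
  maximal : ∀ (Q : Type u) [TopologicalSpace Q] [ChartedSpace EP Q] [IsManifold 𝓘(ℝ, EP) ∞ Q]
    [ConnectedSpace Q] (j : Q → M), IsImmersion 𝓘(ℝ, EP) 𝓘(ℝ, EM) ∞ j → Function.Injective j →
    (∀ q, LinearMap.range (mfderiv 𝓘(ℝ, EP) 𝓘(ℝ, EM) j q).toLinearMap = Δ (j q)) →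
    (Set.range j ∩ Set.range ι).Nonempty → Set.range j ⊆ Set.range ι

/-! ### The reduced Courant algebroid

The base of the reduced algebroid is the orbit space `P / G`.  Its fibre over an orbit `z` is
`K^{⊥G} / (K ∩ K^⊥)^G`: the `G`-invariant families of vectors of `K^⊥` along the orbit modulo those
with values in `K ∩ K^⊥`.  As `G` acts freely, this is a copy of `K^⊥_p / (K ∩ K^⊥)_p` for each `p`
in the orbit.  Its smooth sections are the classes of the smooth `G`-invariant sections of `K^⊥`
over `P`. -/

section Reduction

variable {EM : Type*} [NormedAddCommGroup EM] [NormedSpace ℝ EM]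
  {M : Type*} [TopologicalSpace M] [ChartedSpace EM M] [IsManifold 𝓘(ℝ, EM) ∞ M]
  {F : Type*} [NormedAddCommGroup F] [NormedSpace ℝ F]
  {E : M → Type*} [TopologicalSpace (TotalSpace F E)] [∀ x, AddCommGroup (E x)]
  [∀ x, Module ℝ (E x)] [∀ x, TopologicalSpace (E x)] [FiberBundle F E] [VectorBundle ℝ F E]
  {EG : Type*} [NormedAddCommGroup EG] [NormedSpace ℝ EG]
  {G : Type*} [TopologicalSpace G] [ChartedSpace EG G] [Group G] [MulAction G M]
  {𝔞 : Type*} [AddCommGroup 𝔞] [Module ℝ 𝔞]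
  {C : CourantAlgebroid EM F E} {𝒜 : CourantAlgebra 𝔞 (GroupLieAlgebra 𝓘(ℝ, EG) G)}
  {P : Type*} [MulAction G P]

/-- The points of the orbit `z`. -/
abbrev OrbitPoints (z : MulAction.orbitRel.Quotient G P) : Type _ :=
  {p : P // (Quotient.mk (MulAction.orbitRel G P) p) = z}

namespace ExtendedAction

variable (X : ExtendedAction C 𝒜) (ι : P →[G] M)

/-- The invariant families of vectors of `K^⊥` along the orbit `z`. -/
def invKperp (z : MulAction.orbitRel.Quotient G P) :
    Submodule ℝ (∀ p : OrbitPoints z, E (ι p.1)) where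
  carrier := {s | (∀ p, s p ∈ X.Kperp (ι p.1)) ∧
    ∀ (g : G) (p p' : OrbitPoints z), p'.1 = g • p.1 →
      TotalSpace.mk' F (ι p'.1) (s p') =
        TotalSpace.mk' F (g • ι p.1) (X.act g (ι p.1) (s p))}
  zero_mem' := by
    refine ⟨fun p => Submodule.zero_mem _, fun g p p' h => ?_⟩
    have hb : ι p'.1 = g • ι p.1 := by rw [h, map_smul]
    have key : ∀ {x y : M} (_ : x = y),
        TotalSpace.mk' F x (0 : E x) = TotalSpace.mk' F y (0 : E y) := by
      rintro x y rfl
      rfl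
    simpa only [Pi.zero_apply, map_zero] using key hb
  add_mem' := by
    rintro s t ⟨hs, hs'⟩ ⟨ht, ht'⟩
    refine ⟨fun p => Submodule.add_mem _ (hs p) (ht p), fun g p p' h => ?_⟩
    have hb : ι p'.1 = g • ι p.1 := by rw [h, map_smul]
    have key : ∀ {x y : M} (_ : x = y) (a b : E x) (c d : E y),
        TotalSpace.mk' F x a = TotalSpace.mk' F y c → TotalSpace.mk' F x b = TotalSpace.mk' F y d →
        TotalSpace.mk' F x (a + b) = TotalSpace.mk' F y (c + d) := by
      rintro x y rfl a b c d h₁ h₂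
      rw [TotalSpace.mk_inj.1 h₁, TotalSpace.mk_inj.1 h₂]
    simpa only [Pi.add_apply, map_add] using key hb _ _ _ _ (hs' g p p' h) (ht' g p p' h)
  smul_mem' := by
    rintro c s ⟨hs, hs'⟩
    refine ⟨fun p => Submodule.smul_mem _ _ (hs p), fun g p p' h => ?_⟩
    have hb : ι p'.1 = g • ι p.1 := by rw [h, map_smul]
    have key : ∀ {x y : M} (_ : x = y) (a : E x) (d : E y),
        TotalSpace.mk' F x a = TotalSpace.mk' F y d →
        TotalSpace.mk' F x (c • a) = TotalSpace.mk' F y (c • d) := by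
      rintro x y rfl a d h₁
      rw [TotalSpace.mk_inj.1 h₁]
    simpa only [Pi.smul_apply, map_smul] using key hb _ _ (hs' g p p' h)

/-- The invariant families of vectors of `K ∩ K^⊥` along the orbit `z`. -/
def invK (z : MulAction.orbitRel.Quotient G P) : Submodule ℝ (X.invKperp ι z) where
  carrier := {s | ∀ p, s.1 p ∈ X.K (ι p.1)}
  zero_mem' := fun _ => Submodule.zero_mem _
  add_mem' := fun hs ht p => Submodule.add_mem _ (hs p) (ht p)
  smul_mem' := fun _ _ hs p => Submodule.smul_mem _ _ (hs p)

/-- The fibre of the reduced algebroid `E^red` over the orbit `z`. -/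
def Ered (z : MulAction.orbitRel.Quotient G P) : Type _ := X.invKperp ι z ⧸ X.invK ι z

instance (z : MulAction.orbitRel.Quotient G P) : AddCommGroup (X.Ered ι z) :=
  inferInstanceAs (AddCommGroup (X.invKperp ι z ⧸ X.invK ι z))

instance (z : MulAction.orbitRel.Quotient G P) : Module ℝ (X.Ered ι z) :=
  inferInstanceAs (Module ℝ (X.invKperp ι z ⧸ X.invK ι z))

/-- The projection `p : K^{⊥G} → E^red`. -/
def redProj (z : MulAction.orbitRel.Quotient G P) : X.invKperp ι z →ₗ[ℝ] X.Ered ι z :=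
  (X.invK ι z).mkQ

/-- A chosen point of an orbit. -/
def basePoint (z : MulAction.orbitRel.Quotient G P) : OrbitPoints z :=
  ⟨Quotient.out z, Quotient.out_eq z⟩

/-- The pairing of invariant families (it does not depend on the point of the orbit, by invariance
of the pairing). -/
def invPairing (z : MulAction.orbitRel.Quotient G P) : LinearMap.BilinForm ℝ (X.invKperp ι z) :=
  (C.pairing (ι (basePoint z).1)).comp
    ((LinearMap.proj (basePoint z)).comp (X.invKperp ι z).subtype)
    ((LinearMap.proj (basePoint z)).comp (X.invKperp ι z).subtype)

theorem invPairing_left (z : MulAction.orbitRel.Quotient G P) :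
    X.invK ι z ≤ LinearMap.ker (X.invPairing ι z) := by
  intro s hs
  ext t
  exact t.2.1 (basePoint z) _ (hs (basePoint z))

theorem invPairing_right (z : MulAction.orbitRel.Quotient G P) :
    X.invK ι z ≤ LinearMap.ker
      ((X.invK ι z).liftQ (X.invPairing ι z) (X.invPairing_left ι z)).flip := by
  intro t ht
  refine LinearMap.ext fun u => ?_
  obtain ⟨s, rfl⟩ := (X.invK ι z).mkQ_surjective u
  exact (C.pairing_symm _ _ _).trans (s.2.1 (basePoint z) _ (ht (basePoint z)))

/-- The pairing on the reduced algebroid, induced by the pairing on `K^⊥`. -/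
def redPairing (z : MulAction.orbitRel.Quotient G P) : LinearMap.BilinForm ℝ (X.Ered ι z) :=
  ((X.invK ι z).liftQ ((X.invK ι z).liftQ (X.invPairing ι z) (X.invPairing_left ι z)).flip
    (X.invPairing_right ι z)).flip

variable (EP : Type*) [NormedAddCommGroup EP] [NormedSpace ℝ EP]
  [TopologicalSpace P] [ChartedSpace EP P]

/-- `s` is a smooth `G`-invariant section of `K^⊥` over `P` representing the section `e` of
`E^red`. -/
structure IsInvariantLift (s : ∀ p : P, E (ι p)) (e : ∀ z, X.Ered ι z) : Prop where
  smooth : ContMDiff 𝓘(ℝ, EP) (𝓘(ℝ, EM).prod 𝓘(ℝ, F)) ∞ (fun p => TotalSpace.mk' F (ι p) (s p))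
  represents : ∀ z, ∃ h : (fun p : OrbitPoints z => s p.1) ∈ X.invKperp ι z,
    X.redProj ι z ⟨_, h⟩ = e z

/-- The smooth sections of `E^red`. -/
abbrev RedSections : Type _ := {e : ∀ z, X.Ered ι z // ∃ s, X.IsInvariantLift ι EP s e}

/-- The bracket of `E^red` is the one induced by the bracket of `E`: if `s₁`, `s₂` are invariant
lifts of `e₁`, `e₂` to sections of `K^⊥` over `P`, and `a₁`, `a₂` are sections of `E` extending
`s₁`, `s₂` near a point `p` of `P`, then `[a₁, a₂]` at `p` lies in `K^⊥` and represents
`[e₁, e₂]`, i.e. it agrees with any lift `s₃` of `[e₁, e₂]` modulo `K ∩ K^⊥`. -/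
def IsReducedBracket
    (br : X.RedSections ι EP → X.RedSections ι EP → X.RedSections ι EP) : Prop :=
  ∀ (e₁ e₂ : X.RedSections ι EP) (s₁ s₂ s₃ : ∀ p : P, E (ι p)),
    X.IsInvariantLift ι EP s₁ e₁.1 → X.IsInvariantLift ι EP s₂ e₂.1 →
    X.IsInvariantLift ι EP s₃ (br e₁ e₂).1 →
    ∀ (p : P) (a₁ a₂ : Cₛ^∞⟮𝓘(ℝ, EM); F, E⟯),
      (∀ᶠ p' in 𝓝 p, a₁ (ι p') = s₁ p') → (∀ᶠ p' in 𝓝 p, a₂ (ι p') = s₂ p') →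
      C.bracket a₁ a₂ (ι p) - s₃ p ∈ X.K (ι p) ⊓ X.Kperp (ι p)

/-- The reduced algebroid with its pairing and bracket. -/
def reducedBundle (br : X.RedSections ι EP → X.RedSections ι EP → X.RedSections ι EP) :
    BracketedBundle (X.Ered ι) (X.RedSections ι EP) where
  ev e := e.1
  pairing := X.redPairing ι
  bracket := br

/-- The strong KT structure `(𝒢, ℐ)` reduces: there is a strong KT structure `(𝒢ʳ, ℐʳ)` on `E^red`
with `V_±^red = p(V_± ∩ K^⊥)` and with `+i`-eigenspace `L^red = p(L ∩ K^⊥_ℂ)`. -/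
def Reduces (br : X.RedSections ι EP → X.RedSections ι EP → X.RedSections ι EP)
    (𝒢 : ∀ x, Module.End ℝ (E x)) (ℐ : ∀ x, Vplus 𝒢 x →ₗ[ℝ] Vplus 𝒢 x) : Prop :=
  ∃ (𝒢r : ∀ z, Module.End ℝ (X.Ered ι z)) (ℐr : ∀ z, Vplus 𝒢r z →ₗ[ℝ] Vplus 𝒢r z),
    IsStrongKT (X.reducedBundle ι EP br) 𝒢r ℐr ∧
    (∀ z u, u ∈ Vplus 𝒢r z ↔
      ∃ s : X.invKperp ι z, (∀ p : OrbitPoints z, s.1 p ∈ Vplus 𝒢 (ι p.1)) ∧ X.redProj ι z s = u) ∧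
    (∀ z u, u ∈ Vminus 𝒢r z ↔
      ∃ s : X.invKperp ι z, (∀ p : OrbitPoints z, s.1 p ∈ Vminus 𝒢 (ι p.1)) ∧ X.redProj ι z s = u) ∧
    (∀ z u v, (u, v) ∈ plusIEigenspace 𝒢r ℐr z ↔
      ∃ s t : X.invKperp ι z, (∀ p : OrbitPoints z, (s.1 p, t.1 p) ∈ plusIEigenspace 𝒢 ℐ (ι p.1)) ∧
        X.redProj ι z s = u ∧ X.redProj ι z t = v)

end ExtendedAction

end Reduction

end

/-! Neither constancy of the rank of `K` nor its invariance under `G` is assumed; both are derived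
over the leaf. Since `P` carries a free action and `K ⊆ K^⊥` there, `π(K)` has rank `dim G` and
`π(K^⊥) = Δ_b` has rank `dim P`. As `ker π` is Lagrangian, these two numbers determine the rank of
`K` (`finrank_K`).

The positive definite form `⟨𝒢 u, v⟩` is invariant under `G`. It gives local orthonormal frames of
`K` and a canonical complement of `K`. For `v` in `K`, the squared length of the part of `g · v`
orthogonal to `K` is `|v|² - ∑ αᵢ(g)²`, with `αᵢ` the components of `g · v` in such a frame. The
bracket with `Ψ b` preserves `K` and acts on an orthonormal frame by an antisymmetric matrix, so `∑
αᵢ dαᵢ = 0`. The length is therefore constant on the connected group `G`, and it vanishes at `1`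
(`act_mem_K`). This argument needs no finite dimensionality of `𝔞`.

An extension `a` of an invariant section of `K^⊥` satisfies `[Ψ b, a] = 0` at the point considered.
Together with the tangency of `π(K^⊥)` to the leaf, the Courant axioms then give `[a, K^⊥] ⊆ K^⊥`,
`[a, K] ⊆ K` and `[K, a] ⊆ K`. So the bracket modulo `K` depends only on the reduced sections.
Taking the representative orthogonal to `K` makes it a smooth invariant section
(`exists_bracket_lift`, `existsUnique_reducedBracket`).

The complement of `K` in `K^⊥` is the horizontal space `K^⊥ ∩ 𝒢 K^⊥`. It is preserved by `𝒢` and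
contains `V_± ∩ K^⊥`, and the reduced fibre is the space of horizontal invariant families
(`horizontalEquiv`). Hence `𝒢` always reduces. If `ℐ` preserves `K^⊥ ∩ V₊`, then `ℐ` extended by
zero on `V₋` preserves the horizontal space and descends. Sections of `L^red` lift to sections of
`L` over `P` and extend locally to sections of `L` over `M`. Their bracket lies in `L ∩ K^⊥`, where
classes modulo `K` have unique representatives, so `L^red` is closed under the bracket. Conversely,
uniqueness of horizontal representatives forces the lift of `u - i ℐʳ u` in `L` to have as real part
the given lift of `u`, and its imaginary part puts `ℐ` of that lift into `K^⊥`
(`mem_Kperp_of_reduces`). -/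

noncomputable section

set_option linter.unusedSectionVars false

/-! ### Bump functions, and extension of functions from immersed manifolds -/

section LocalExtension

variable {EM : Type*} [NormedAddCommGroup EM] [NormedSpace ℝ EM] [FiniteDimensional ℝ EM]
  {M : Type*} [TopologicalSpace M] [ChartedSpace EM M] [IsManifold 𝓘(ℝ, EM) ∞ M] [T2Space M]

theorem exists_bump_tsupport_subset {u : Set M} {x : M} (hu : u ∈ 𝓝 x) :
    ∃ ψ : M → ℝ, ContMDiff 𝓘(ℝ, EM) 𝓘(ℝ, ℝ) ∞ ψ ∧ tsupport ψ ⊆ u ∧ ∀ᶠ y in 𝓝 x, ψ y = 1 := by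
  obtain ⟨ψ, -, hψ⟩ := (SmoothBumpFunction.nhds_basis_tsupport (I := 𝓘(ℝ, EM)) x).mem_iff.1 hu
  exact ⟨ψ, ψ.contMDiff, hψ, ψ.eventuallyEq_one⟩

theorem exists_contMDiff_eventuallyEq {f : M → ℝ} {u : Set M} {x : M} (hu : IsOpen u) (hx : x ∈ u)
    (hf : ContMDiffOn 𝓘(ℝ, EM) 𝓘(ℝ, ℝ) ∞ f u) :
    ∃ f' : M → ℝ, ContMDiff 𝓘(ℝ, EM) 𝓘(ℝ, ℝ) ∞ f' ∧ ∀ᶠ y in 𝓝 x, f' y = f y := by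
  obtain ⟨ψ, hψ, hsub, h1⟩ := exists_bump_tsupport_subset (EM := EM) (hu.mem_nhds hx)
  refine ⟨fun y => ψ y • f y, contMDiff_of_tsupport fun y hy => ?_,
    h1.mono fun y hy => by simp [hy]⟩
  have hy' := hsub (tsupport_smul_subset_left ψ f hy)
  exact (hψ y).smul ((hf y hy').contMDiffAt (hu.mem_nhds hy'))

/-- Smooth functions separate points. -/
theorem exists_contMDiff_ne {x y : M} (hxy : x ≠ y) :
    ∃ f : M → ℝ, ContMDiff 𝓘(ℝ, EM) 𝓘(ℝ, ℝ) ∞ f ∧ f x ≠ f y := by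
  obtain ⟨ψ, hψ, hsub, h1⟩ := exists_bump_tsupport_subset (EM := EM)
    (isOpen_compl_singleton.mem_nhds (show x ∈ ({y}ᶜ : Set M) from hxy))
  refine ⟨ψ, hψ, ?_⟩
  rw [h1.self_of_nhds, image_eq_zero_of_notMem_tsupport fun h => hsub h rfl]
  exact one_ne_zero

/-- The inverse square root of a smooth function that is positive at `x`. -/
theorem exists_contMDiff_sq_mul_eq_one {f : M → ℝ} {x : M}
    (hf : ContMDiff 𝓘(ℝ, EM) 𝓘(ℝ, ℝ) ∞ f) (hx : 0 < f x) :
    ∃ φ : M → ℝ, ContMDiff 𝓘(ℝ, EM) 𝓘(ℝ, ℝ) ∞ φ ∧ ∀ᶠ y in 𝓝 x, φ y * φ y * f y = 1 := by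
  have hu : IsOpen (f ⁻¹' Set.Ioi 0) := isOpen_Ioi.preimage hf.continuous
  have hsm : ContMDiffOn 𝓘(ℝ, EM) 𝓘(ℝ, ℝ) ∞ (fun y => (Real.sqrt (f y))⁻¹) (f ⁻¹' Set.Ioi 0) := by
    intro y hy
    have hy : 0 < f y := hy
    have h1 : ContDiffAt ℝ ∞ (fun t : ℝ => (Real.sqrt t)⁻¹) (f y) :=
      (Real.contDiffAt_sqrt hy.ne').inv (Real.sqrt_pos.2 hy).ne'
    exact (h1.contMDiffAt.comp y (hf y)).contMDiffWithinAt
  obtain ⟨φ, hφ, h⟩ := exists_contMDiff_eventuallyEq hu hx hsm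
  refine ⟨φ, hφ, ?_⟩
  filter_upwards [h, hu.mem_nhds hx] with y hy hpos
  have hpos : 0 < f y := hpos
  rw [hy, ← mul_inv, Real.mul_self_sqrt hpos.le, inv_mul_cancel₀ hpos.ne']

variable {EP : Type*} [NormedAddCommGroup EP] [NormedSpace ℝ EP]
  {P : Type*} [TopologicalSpace P] [ChartedSpace EP P] [IsManifold 𝓘(ℝ, EP) ∞ P]

/-- An immersion has local smooth left inverses. -/
theorem exists_leftInverse_of_isImmersionAt {j : P → M} {p : P}
    (hj : IsImmersionAt 𝓘(ℝ, EP) 𝓘(ℝ, EM) ∞ j p) :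
    ∃ (R : M → P) (w : Set M), IsOpen w ∧ j p ∈ w ∧ ContMDiffOn 𝓘(ℝ, EM) 𝓘(ℝ, EP) ∞ R w ∧
      ∀ᶠ q in 𝓝 p, R (j q) = q := by
  obtain ⟨F', _, _, hj'⟩ := hj
  let φ := hj'.domChart
  let ψ := hj'.codChart
  -- In the charts of the immersion normal form, `j` is `u ↦ equiv (u, 0)`. Hence the first
  -- component of `equiv.symm` recovers `u`.
  let L : EM → EP := fun w => (hj'.equiv.symm w).1
  have hL : ContMDiff 𝓘(ℝ, EM) 𝓘(ℝ, EP) ∞ L := by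
    rw [contMDiff_iff_contDiff]
    exact contDiff_fst.comp hj'.equiv.symm.contDiff
  have hφ := hj'.domChart_mem_maximalAtlas
  have hψ := hj'.codChart_mem_maximalAtlas
  have hwr : ∀ q ∈ φ.source, L (ψ (j q)) = φ q := by
    intro q hq
    have hm : φ q ∈ (hj'.domChart.extend 𝓘(ℝ, EP)).target := by
      simpa using! φ.map_source hq
    have := hj'.writtenInCharts hm
    simp only [Function.comp_apply, OpenPartialHomeomorph.extend_coe,
      OpenPartialHomeomorph.extend_coe_symm, modelWithCornersSelf_coe,
      modelWithCornersSelf_coe_symm, id] at this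
    change ψ (j (φ.symm (φ q))) = _ at this
    rw [φ.left_inv hq] at this
    simp [L, this]
  let w : Set M := ψ.source ∩ ψ ⁻¹' (L ⁻¹' φ.target)
  have hw : IsOpen w := ψ.isOpen_inter_preimage (φ.open_target.preimage hL.continuous)
  have hpφ := hj'.mem_domChart_source
  refine ⟨fun y => φ.symm (L (ψ y)), w, hw, ⟨hj'.mem_codChart_source, ?_⟩, ?_, ?_⟩
  · change L (ψ (j p)) ∈ φ.target
    rw [hwr p hpφ]
    exact φ.map_source hpφ
  · exact (contMDiffOn_symm_of_mem_maximalAtlas hφ).comp (hL.comp_contMDiffOn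
      ((contMDiffOn_of_mem_maximalAtlas hψ).mono Set.inter_subset_left)) fun y hy => hy.2
  · filter_upwards [φ.open_source.mem_nhds hpφ] with q hqφ
    rw [hwr q hqφ, φ.left_inv hqφ]

/-- A function that is smooth near a point of an immersed manifold extends, near that point, to a
smooth function on the ambient manifold. -/
theorem exists_contMDiff_comp_eventuallyEq {j : P → M} {p : P} {h : P → ℝ} {u : Set P}
    (hj : IsImmersionAt 𝓘(ℝ, EP) 𝓘(ℝ, EM) ∞ j p) (hu : IsOpen u) (hp : p ∈ u)
    (hh : ContMDiffOn 𝓘(ℝ, EP) 𝓘(ℝ, ℝ) ∞ h u) :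
    ∃ f : M → ℝ, ContMDiff 𝓘(ℝ, EM) 𝓘(ℝ, ℝ) ∞ f ∧ ∀ᶠ q in 𝓝 p, f (j q) = h q := by
  obtain ⟨R, w, hw, hjp, hR, hinv⟩ := exists_leftInverse_of_isImmersionAt hj
  have hRp : R (j p) = p := hinv.self_of_nhds
  obtain ⟨f, hf, hfe⟩ := exists_contMDiff_eventuallyEq
    (hR.continuousOn.isOpen_inter_preimage hw hu) ⟨hjp, by simpa [hRp] using hp⟩
    (hh.comp (hR.mono Set.inter_subset_left) fun y hy => hy.2)
  refine ⟨f, hf, ?_⟩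
  filter_upwards [hj.continuousAt.eventually hfe, hinv] with q hq hq'
  rw [hq, Function.comp_apply, hq']

/-- The derivative of an immersion is injective. -/
theorem mfderiv_injective_of_isImmersionAt {j : P → M} {p : P}
    (hj : IsImmersionAt 𝓘(ℝ, EP) 𝓘(ℝ, EM) ∞ j p) :
    Function.Injective (mfderiv 𝓘(ℝ, EP) 𝓘(ℝ, EM) j p) := by
  obtain ⟨R, w, hw, hjp, hR, hinv⟩ := exists_leftInverse_of_isImmersionAt hj
  have hRd : MDifferentiableAt 𝓘(ℝ, EM) 𝓘(ℝ, EP) R (j p) :=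
    ((hR _ hjp).contMDiffAt (hw.mem_nhds hjp)).mdifferentiableAt (by simp)
  have hjd : MDifferentiableAt 𝓘(ℝ, EP) 𝓘(ℝ, EM) j p := hj.contMDiffAt.mdifferentiableAt (by simp)
  have h1 : HasMFDerivAt 𝓘(ℝ, EP) 𝓘(ℝ, EP) (R ∘ j) p _ :=
    hRd.hasMFDerivAt.comp p hjd.hasMFDerivAt
  have h2 : HasMFDerivAt 𝓘(ℝ, EP) 𝓘(ℝ, EP) (R ∘ j) p (ContinuousLinearMap.id ℝ _) :=
    (hasMFDerivAt_id p).congr_of_eventuallyEq hinv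
  have h3 := hasMFDerivAt_unique h1 h2
  intro u v huv
  have hu := congrArg (fun T : EP →L[ℝ] EP => T u) h3
  have hv := congrArg (fun T : EP →L[ℝ] EP => T v) h3
  exact hu.symm.trans ((congrArg (mfderiv 𝓘(ℝ, EM) 𝓘(ℝ, EP) R (j p)) huv).trans hv)

end LocalExtension

/-! ### Global sections, local frames, and extension of sections along immersions -/

section Sections

variable {EM : Type*} [NormedAddCommGroup EM] [NormedSpace ℝ EM] [FiniteDimensional ℝ EM]
  {M : Type*} [TopologicalSpace M] [ChartedSpace EM M] [IsManifold 𝓘(ℝ, EM) ∞ M] [T2Space M]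
  {F : Type*} [NormedAddCommGroup F] [NormedSpace ℝ F] [FiniteDimensional ℝ F]
  {E : M → Type*} [TopologicalSpace (TotalSpace F E)] [∀ x, AddCommGroup (E x)]
  [∀ x, Module ℝ (E x)] [∀ x, TopologicalSpace (E x)] [FiberBundle F E] [VectorBundle ℝ F E]

/-- The product of a smooth function and a smooth section. -/
def ContMDiffSection.smulFun (f : M → ℝ) (hf : ContMDiff 𝓘(ℝ, EM) 𝓘(ℝ, ℝ) ∞ f)
    (s : Cₛ^∞⟮𝓘(ℝ, EM); F, E⟯) : Cₛ^∞⟮𝓘(ℝ, EM); F, E⟯ :=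
  ⟨fun x => f x • s x, hf.smul_section s.contMDiff⟩

theorem ContMDiffSection.smulFun_apply (f : M → ℝ) (hf : ContMDiff 𝓘(ℝ, EM) 𝓘(ℝ, ℝ) ∞ f)
    (s : Cₛ^∞⟮𝓘(ℝ, EM); F, E⟯) (x : M) : ContMDiffSection.smulFun f hf s x = f x • s x := rfl

theorem ContMDiffSection.sum_apply {κ : Type*} (t : Finset κ) (s : κ → Cₛ^∞⟮𝓘(ℝ, EM); F, E⟯)
    (x : M) : (∑ i ∈ t, s i) x = ∑ i ∈ t, s i x := by
  rw [← ContMDiffSection.coeAddHom_apply, map_sum, Finset.sum_apply]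
  rfl

theorem exists_section_eventuallyEq {s : ∀ x, E x} {u : Set M} {x : M} (hu : IsOpen u) (hx : x ∈ u)
    (hs : ContMDiffOn 𝓘(ℝ, EM) (𝓘(ℝ, EM).prod 𝓘(ℝ, F)) ∞ (fun y => TotalSpace.mk' F y (s y)) u) :
    ∃ a : Cₛ^∞⟮𝓘(ℝ, EM); F, E⟯, ∀ᶠ y in 𝓝 x, a y = s y := by
  obtain ⟨ψ, hψ, hsub, h1⟩ := exists_bump_tsupport_subset (EM := EM) (hu.mem_nhds hx)
  refine ⟨⟨fun y => ψ y • s y, hψ.contMDiffOn.smul_section_of_tsupport hu hsub hs⟩, ?_⟩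
  filter_upwards [h1] with y hy
  exact (congrArg (· • s y) hy).trans (one_smul ℝ _)

variable [ContMDiffVectorBundle ∞ F E 𝓘(ℝ, EM)]

variable (EM F E) in
/-- Near every point there is a frame of `E` made of global sections; the coefficients of a vector
are read off from the preferred trivialization. -/
theorem exists_global_frame (x : M) :
    ∃ a : Fin (Module.finrank ℝ F) → Cₛ^∞⟮𝓘(ℝ, EM); F, E⟯, ∀ᶠ y in 𝓝 x, ∀ v : E y,
      v = ∑ i, (Module.finBasis ℝ F).repr
        (trivializationAt F E x (TotalSpace.mk' F y v)).2 i • a i y := by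
  let e := trivializationAt F E x
  let b := Module.finBasis ℝ F
  have hx : x ∈ e.baseSet := mem_baseSet_trivializationAt F E x
  have h := fun i => exists_section_eventuallyEq (EM := EM) e.open_baseSet hx
    (e.contMDiffOn_localFrame_baseSet (I := 𝓘(ℝ, EM)) ∞ b i)
  choose a ha using h
  refine ⟨a, ?_⟩
  filter_upwards [eventually_all.2 ha, e.open_baseSet.mem_nhds hx] with y hy hye v
  conv_lhs => rw [← (e.basisAt b hye).sum_repr v]
  refine Finset.sum_congr rfl fun i _ => ?_
  rw [hy i, e.localFrame_apply_of_mem_baseSet b hye]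
  congr 1

variable (EM F) in
-- The coefficients of `v` in a global frame near `x` are used as constants.
theorem exists_section_eq {x : M} (v : E x) : ∃ a : Cₛ^∞⟮𝓘(ℝ, EM); F, E⟯, a x = v := by
  obtain ⟨a, ha⟩ := exists_global_frame EM F E x
  refine ⟨∑ i, (Module.finBasis ℝ F).repr
    (trivializationAt F E x (TotalSpace.mk' F x v)).2 i • a i, ?_⟩
  rw [ContMDiffSection.sum_apply]
  exact (ha.self_of_nhds v).symm

section Immersion

variable {EP : Type*} [NormedAddCommGroup EP] [NormedSpace ℝ EP]
  {P : Type*} [TopologicalSpace P] [ChartedSpace EP P] [IsManifold 𝓘(ℝ, EP) ∞ P]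

/-- A smooth section of `E` along an immersion extends, near each point, to a section of `E`. -/
theorem exists_section_comp_eventuallyEq {j : P → M} {p : P}
    (hj : IsImmersionAt 𝓘(ℝ, EP) 𝓘(ℝ, EM) ∞ j p) {s : ∀ q, E (j q)}
    (hs : ContMDiff 𝓘(ℝ, EP) (𝓘(ℝ, EM).prod 𝓘(ℝ, F)) ∞ (fun q => TotalSpace.mk' F (j q) (s q))) :
    ∃ a : Cₛ^∞⟮𝓘(ℝ, EM); F, E⟯, ∀ᶠ q in 𝓝 p, a (j q) = s q := by
  obtain ⟨a, ha⟩ := exists_global_frame EM F E (j p)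
  let e := trivializationAt F E (j p)
  let b := Module.finBasis ℝ F
  have hjp : j p ∈ e.baseSet := mem_baseSet_trivializationAt F E (j p)
  have hjc : Continuous j := by
    have := (Bundle.contMDiff_proj (IB := 𝓘(ℝ, EM)) (n := ∞) E (F := F)).comp hs
    exact this.continuous
  have hu : IsOpen (j ⁻¹' e.baseSet) := e.open_baseSet.preimage hjc
  have hcoef : ∀ i, ContMDiffOn 𝓘(ℝ, EP) 𝓘(ℝ, ℝ) ∞
      (fun q => b.repr (e (TotalSpace.mk' F (j q) (s q))).2 i) (j ⁻¹' e.baseSet) := by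
    intro i q hq
    have h1 : ContMDiffAt 𝓘(ℝ, EP) 𝓘(ℝ, F) ∞ (fun q => (e (TotalSpace.mk' F (j q) (s q))).2) q :=
      ((e.contMDiffAt_iff (IB := 𝓘(ℝ, EM)) (by exact (e.mem_source.2 hq))).1 (hs q)).2
    have h2 : ContMDiff 𝓘(ℝ, F) 𝓘(ℝ, ℝ) ∞ (fun w => b.repr w i) := by
      rw [contMDiff_iff_contDiff]
      exact (LinearMap.toContinuousLinearMap (b.coord i)).contDiff
    exact (h2.contMDiffAt.comp q h1).contMDiffWithinAt
  -- The coefficients of `s` are functions on an open part of `P`. Each is extended to `M`, and the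
  -- extensions are recombined with the global frame.
  choose f hf hfe using fun i => exists_contMDiff_comp_eventuallyEq hj hu hjp (hcoef i)
  refine ⟨∑ i, ContMDiffSection.smulFun (f i) (hf i) (a i), ?_⟩
  filter_upwards [hj.continuousAt.eventually ha, eventually_all.2 hfe] with q hq hq'
  rw [ContMDiffSection.sum_apply, hq (s q)]
  exact Finset.sum_congr rfl fun i _ => by rw [ContMDiffSection.smulFun_apply, hq' i]

end Immersion

end Sections

/-! ### Orthonormal families and rank–nullity on subspaces -/

section LinearAlgebra

variable {V : Type*} [AddCommGroup V] [Module ℝ V] {g : LinearMap.BilinForm ℝ V}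
  {n : ℕ} {k : Fin n → V}

theorem sum_smul_apply_of_orthonormal (hk : ∀ i j, g (k i) (k j) = if i = j then 1 else 0)
    (c : Fin n → ℝ) (j : Fin n) : g (∑ i, c i • k i) (k j) = c j := by
  simp [hk]

theorem linearIndependent_of_orthonormal (hk : ∀ i j, g (k i) (k j) = if i = j then 1 else 0) :
    LinearIndependent ℝ k := by
  rw [Fintype.linearIndependent_iff]
  intro c hc j
  rw [← sum_smul_apply_of_orthonormal hk c j, hc]
  simp

/-- Orthonormal vectors are independent, so `n` of them span any `W` that contains them and has rank
at most `n`. Positivity and symmetry of `g` play no role. -/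
theorem eq_sum_of_orthonormal (hk : ∀ i j, g (k i) (k j) = if i = j then 1 else 0)
    {W : Submodule ℝ V} [FiniteDimensional ℝ W] (hkW : ∀ i, k i ∈ W)
    (hn : Module.finrank ℝ W ≤ n) {v : V} (hv : v ∈ W) : v = ∑ i, g v (k i) • k i := by
  have hspan : Submodule.span ℝ (Set.range k) = W := by
    refine Submodule.eq_of_le_of_finrank_le (Submodule.span_le.2 ?_) ?_
    · rintro _ ⟨i, rfl⟩
      exact hkW i
    · rw [finrank_span_eq_card (linearIndependent_of_orthonormal hk), Fintype.card_fin]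
      exact hn
  rw [← hspan, Submodule.mem_span_range_iff_exists_fun] at hv
  obtain ⟨c, rfl⟩ := hv
  exact Finset.sum_congr rfl fun i _ => by rw [sum_smul_apply_of_orthonormal hk]

theorem finrank_map_add_finrank_inf_ker {V V' : Type*} [AddCommGroup V] [Module ℝ V]
    [AddCommGroup V'] [Module ℝ V'] [FiniteDimensional ℝ V] (f : V →ₗ[ℝ] V') (W : Submodule ℝ V) :
    Module.finrank ℝ (W.map f) + Module.finrank ℝ (W ⊓ LinearMap.ker f : Submodule ℝ V) =
      Module.finrank ℝ W := by
  have h := (f.comp W.subtype).finrank_range_add_finrank_ker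
  rw [LinearMap.range_comp, Submodule.range_subtype, LinearMap.ker_comp] at h
  rw [← h, ← Submodule.finrank_map_subtype_eq W, Submodule.map_comap_subtype]

end LinearAlgebra

/-! ### Functions with vanishing derivative -/

section Connected

variable {EG : Type*} [NormedAddCommGroup EG] [NormedSpace ℝ EG]
  {G : Type*} [TopologicalSpace G] [ChartedSpace EG G] [IsManifold 𝓘(ℝ, EG) ∞ G]

/-- The mean value theorem applies on a ball in a chart, which is convex. -/
theorem isLocallyConstant_of_hasMFDerivAt_zero {f : G → ℝ}
    (hf : ∀ x, HasMFDerivAt 𝓘(ℝ, EG) 𝓘(ℝ, ℝ) f x 0) : IsLocallyConstant f := by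
  rw [IsLocallyConstant.iff_eventually_eq]
  intro x
  let φ := chartAt EG x
  obtain ⟨r, hr, hball⟩ := Metric.mem_nhds_iff.1
    (φ.open_target.mem_nhds (φ.map_source (mem_chart_source EG x)))
  have hder : ∀ y ∈ Metric.ball (φ x) r, HasFDerivAt (f ∘ φ.symm) (0 : EG →L[ℝ] ℝ) y := by
    intro y hy
    have h1 : MDifferentiableAt 𝓘(ℝ, EG) 𝓘(ℝ, EG) φ.symm y :=
      mdifferentiableAt_atlas_symm (chart_mem_atlas EG x) (hball hy)
    have h2 := (hf (φ.symm y)).comp y h1.hasMFDerivAt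
    rw [ContinuousLinearMap.zero_comp] at h2
    exact h2.hasFDerivAt
  have hconst : ∀ y ∈ Metric.ball (φ x) r, (f ∘ φ.symm) y = (f ∘ φ.symm) (φ x) := fun y hy =>
    (convex_ball (φ x) r).is_const_of_fderivWithin_eq_zero (𝕜 := ℝ)
      (fun z hz => (hder z hz).differentiableAt.differentiableWithinAt)
      (fun z hz => (hder z hz).hasFDerivWithinAt.fderivWithin
        (Metric.isOpen_ball.uniqueDiffWithinAt hz)) hy (Metric.mem_ball_self hr)
  filter_upwards [φ.open_source.mem_nhds (mem_chart_source EG x),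
    (φ.continuousAt (mem_chart_source EG x)).eventually (Metric.ball_mem_nhds _ hr)] with y hy hy'
  have := hconst _ hy'
  simpa [φ.left_inv hy, φ.left_inv (mem_chart_source EG x)] using this

end Connected

/-! ### The positive definite form of a generalized metric, and Gram–Schmidt -/

section Metric

variable {EM : Type*} [NormedAddCommGroup EM] [NormedSpace ℝ EM]
  {M : Type*} [TopologicalSpace M] [ChartedSpace EM M] [IsManifold 𝓘(ℝ, EM) ∞ M]
  {F : Type*} [NormedAddCommGroup F] [NormedSpace ℝ F]
  {E : M → Type*} [TopologicalSpace (TotalSpace F E)] [∀ x, AddCommGroup (E x)]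
  [∀ x, Module ℝ (E x)] [∀ x, TopologicalSpace (E x)] [FiberBundle F E] [VectorBundle ℝ F E]

/-- The bilinear form `⟨𝒢 u, v⟩`. -/
def genMetric (C : CourantAlgebroid EM F E) (𝒢 : ∀ x, Module.End ℝ (E x)) (x : M) :
    LinearMap.BilinForm ℝ (E x) := (C.pairing x).comp (𝒢 x) LinearMap.id

variable {C : CourantAlgebroid EM F E} {𝒢 : ∀ x, Module.End ℝ (E x)}

theorem genMetric_apply (x : M) (u v : E x) : genMetric C 𝒢 x u v = C.pairing x (𝒢 x u) v := rfl

theorem pairing_𝒢_𝒢 (h𝒢 : IsGeneralizedMetric C.toBracketedBundle 𝒢)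
    (x : M) (u v : E x) : C.pairing x (𝒢 x u) (𝒢 x v) = C.pairing x u v :=
  h𝒢.orthogonal x u v

theorem pairing_𝒢_left (h𝒢 : IsGeneralizedMetric C.toBracketedBundle 𝒢)
    (x : M) (u v : E x) : C.pairing x (𝒢 x u) v = C.pairing x u (𝒢 x v) :=
  h𝒢.selfAdjoint x u v

/-- Orthogonality and self-adjointness give `⟨𝒢𝒢u, v⟩ = ⟨𝒢u, 𝒢v⟩ = ⟨u, v⟩`, and the pairing is
nondegenerate. -/
theorem 𝒢_𝒢 (h𝒢 : IsGeneralizedMetric C.toBracketedBundle 𝒢)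
    (x : M) (u : E x) : 𝒢 x (𝒢 x u) = u := by
  refine sub_eq_zero.1 (C.pairing_nondegenerate x _ fun v => ?_)
  rw [map_sub, LinearMap.sub_apply, pairing_𝒢_left h𝒢, pairing_𝒢_𝒢 h𝒢, sub_self]

theorem genMetric_symm (h𝒢 : IsGeneralizedMetric C.toBracketedBundle 𝒢)
    (x : M) (u v : E x) : genMetric C 𝒢 x u v = genMetric C 𝒢 x v u := by
  rw [genMetric_apply, genMetric_apply, pairing_𝒢_left h𝒢, C.pairing_symm]

theorem genMetric_self_pos (h𝒢 : IsGeneralizedMetric C.toBracketedBundle 𝒢)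
    (x : M) {u : E x} (hu : u ≠ 0) : 0 < genMetric C 𝒢 x u u :=
  h𝒢.pos x u hu

theorem eq_zero_of_genMetric_self (h𝒢 : IsGeneralizedMetric C.toBracketedBundle 𝒢)
    {x : M} {u : E x} (hu : genMetric C 𝒢 x u u = 0) : u = 0 := by
  by_contra h
  exact (genMetric_self_pos h𝒢 x h).ne' hu

theorem exists_section_𝒢 (h𝒢 : IsGeneralizedMetric C.toBracketedBundle 𝒢)
    (s : Cₛ^∞⟮𝓘(ℝ, EM); F, E⟯) :
    ∃ t : Cₛ^∞⟮𝓘(ℝ, EM); F, E⟯, ∀ x, t x = 𝒢 x (s x) := h𝒢.smooth s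

theorem contMDiff_genMetric (h𝒢 : IsGeneralizedMetric C.toBracketedBundle 𝒢)
    (s t : Cₛ^∞⟮𝓘(ℝ, EM); F, E⟯) :
    ContMDiff 𝓘(ℝ, EM) 𝓘(ℝ, ℝ) ∞ (fun x => genMetric C 𝒢 x (s x) (t x)) := by
  obtain ⟨s', hs'⟩ := exists_section_𝒢 h𝒢 s
  simpa only [genMetric_apply, hs'] using C.pairing_smooth s' t

variable [FiniteDimensional ℝ EM] [T2Space M] [FiniteDimensional ℝ F]

variable (C 𝒢) in
/-- Sections `k` that are orthonormal at `y`. -/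
def OrthonormalAt {n : ℕ} (k : Fin n → Cₛ^∞⟮𝓘(ℝ, EM); F, E⟯) (y : M) : Prop :=
  ∀ i j, genMetric C 𝒢 y (k i y) (k j y) = if i = j then 1 else 0

/-- One step of the Gram–Schmidt process. -/
theorem exists_orthonormal_snoc (h𝒢 : IsGeneralizedMetric C.toBracketedBundle 𝒢)
    {n : ℕ} {k : Fin n → Cₛ^∞⟮𝓘(ℝ, EM); F, E⟯} {x : M}
    (hk : ∀ᶠ y in 𝓝 x, OrthonormalAt C 𝒢 k y) (s : Cₛ^∞⟮𝓘(ℝ, EM); F, E⟯)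
    (hs : s x ∉ Submodule.span ℝ (Set.range fun i => k i x))
    (S : Submodule ℝ Cₛ^∞⟮𝓘(ℝ, EM); F, E⟯)
    (hS : ∀ (f : M → ℝ) (hf : ContMDiff 𝓘(ℝ, EM) 𝓘(ℝ, ℝ) ∞ f), ∀ s ∈ S,
      ContMDiffSection.smulFun f hf s ∈ S) (hkS : ∀ i, k i ∈ S) (hsS : s ∈ S) :
    ∃ t ∈ S,
      ∀ᶠ y in 𝓝 x, OrthonormalAt C 𝒢 (Fin.snoc k t : Fin (n + 1) → Cₛ^∞⟮𝓘(ℝ, EM); F, E⟯) y := by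
  let t₀ : Cₛ^∞⟮𝓘(ℝ, EM); F, E⟯ := s - ∑ i, ContMDiffSection.smulFun _
    (contMDiff_genMetric h𝒢 s (k i)) (k i)
  have ht₀ : ∀ y, t₀ y = s y - ∑ i, genMetric C 𝒢 y (s y) (k i y) • k i y := by
    intro y
    change s y - (∑ i, _ : Cₛ^∞⟮𝓘(ℝ, EM); F, E⟯) y = _
    rw [ContMDiffSection.sum_apply]
    rfl
  have hsum : ∀ y, ∑ i, genMetric C 𝒢 y (s y) (k i y) • k i y ∈
      Submodule.span ℝ (Set.range fun i => k i y) := fun y =>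
    Submodule.sum_mem _ fun i _ => Submodule.smul_mem _ _ (Submodule.subset_span ⟨i, rfl⟩)
  have hne : t₀ x ≠ 0 := by
    rw [ht₀, sub_ne_zero]
    intro h
    exact hs (h ▸ hsum x)
  obtain ⟨φ, hφ, hφ1⟩ := exists_contMDiff_sq_mul_eq_one (contMDiff_genMetric h𝒢 t₀ t₀)
    (genMetric_self_pos h𝒢 x hne)
  refine ⟨ContMDiffSection.smulFun φ hφ t₀, ?_, ?_⟩
  -- Projection and normalization only multiply by smooth functions, so the new section stays in the
  -- function module `S`.
  · exact hS _ _ _ (Submodule.sub_mem _ hsS (Submodule.sum_mem _ fun i _ => hS _ _ _ (hkS i)))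
  · filter_upwards [hk, hφ1] with y hky hy
    have horth : ∀ j, genMetric C 𝒢 y (t₀ y) (k j y) = 0 := by
      intro j
      rw [ht₀, map_sub, LinearMap.sub_apply, sum_smul_apply_of_orthonormal hky, sub_self]
    intro i j
    induction i using Fin.lastCases with
    | last =>
      induction j using Fin.lastCases with
      | last => simpa [ContMDiffSection.smulFun_apply, mul_assoc] using hy
      | cast j =>
        simp [ContMDiffSection.smulFun_apply, horth, (Fin.castSucc_lt_last j).ne']
    | cast i =>
      induction j using Fin.lastCases with
      | last =>
        simp [ContMDiffSection.smulFun_apply, genMetric_symm h𝒢 y (k i y), horth,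
          (Fin.castSucc_lt_last i).ne]
      | cast j => simpa using hky i j

end Metric

/-! ### The rank of `K` along the leaf -/

section Rank

variable {EM : Type*} [NormedAddCommGroup EM] [NormedSpace ℝ EM] [FiniteDimensional ℝ EM]
  {M : Type*} [TopologicalSpace M] [ChartedSpace EM M] [IsManifold 𝓘(ℝ, EM) ∞ M] [T2Space M]
  {F : Type*} [NormedAddCommGroup F] [NormedSpace ℝ F] [FiniteDimensional ℝ F]
  {E : M → Type*} [TopologicalSpace (TotalSpace F E)] [∀ x, AddCommGroup (E x)]
  [∀ x, Module ℝ (E x)] [∀ x, TopologicalSpace (E x)] [FiberBundle F E] [VectorBundle ℝ F E]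
  [ContMDiffVectorBundle ∞ F E 𝓘(ℝ, EM)]
  {EG : Type*} [NormedAddCommGroup EG] [NormedSpace ℝ EG] [FiniteDimensional ℝ EG]
  {G : Type*} [TopologicalSpace G] [ChartedSpace EG G] [Group G] [LieGroup 𝓘(ℝ, EG) ∞ G]
  [MulAction G M] [ContMDiffSMul 𝓘(ℝ, EG) 𝓘(ℝ, EM) ∞ G M]
  {𝔞 : Type*} [AddCommGroup 𝔞] [Module ℝ 𝔞]
  {C : CourantAlgebroid EM F E} {𝒜 : CourantAlgebra 𝔞 (GroupLieAlgebra 𝓘(ℝ, EG) G)}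
  (X : ExtendedAction C 𝒜) {𝒢 : ∀ x, Module.End ℝ (E x)}

theorem finiteDimensional_fiber {M : Type*} [TopologicalSpace M] (F : Type*)
    [NormedAddCommGroup F] [NormedSpace ℝ F] [FiniteDimensional ℝ F] {E : M → Type*}
    [TopologicalSpace (TotalSpace F E)] [∀ x, AddCommGroup (E x)] [∀ x, Module ℝ (E x)]
    [∀ x, TopologicalSpace (E x)] [FiberBundle F E] [VectorBundle ℝ F E] (x : M) :
    FiniteDimensional ℝ (E x) :=
  Module.Finite.equiv ((trivializationAt F E x).linearEquivAt ℝ x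
    (mem_baseSet_trivializationAt F E x)).symm

theorem dirDeriv_zero (f : M → ℝ) (x : M) : dirDeriv (EM := EM) f x 0 = 0 := map_zero _

variable (F) in
theorem finrank_fiber (x : M) : Module.finrank ℝ (E x) = Module.finrank ℝ F :=
  ((trivializationAt F E x).linearEquivAt ℝ x (mem_baseSet_trivializationAt F E x)).finrank_eq

namespace CourantAlgebroid

/-- Polarization of `[e, e] = ½ π* d⟨e, e⟩` at `e = a + b`. It measures the failure of antisymmetry
of the bracket. -/
theorem bracket_swap (a b : Cₛ^∞⟮𝓘(ℝ, EM); F, E⟯) (x : M) (v : E x) :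
    C.pairing x (C.bracket a b x) v + C.pairing x (C.bracket b a x) v =
      dirDeriv (fun y => C.pairing y (a y) (b y)) x (C.anchor x v) := by
  have h := C.bracket_self (a + b) x v
  have ha := C.bracket_self a x v
  have hb := C.bracket_self b x v
  have hab : C.bracket (a + b) (a + b) x =
      C.bracket a a x + C.bracket a b x + (C.bracket b a x + C.bracket b b x) := by
    simp only [map_add, LinearMap.add_apply, ContMDiffSection.coe_add, Pi.add_apply]
    abel
  have hd : ∀ s t : Cₛ^∞⟮𝓘(ℝ, EM); F, E⟯, HasMFDerivAt 𝓘(ℝ, EM) 𝓘(ℝ, ℝ)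
      (fun y => C.pairing y (s y) (t y)) x
      (mfderiv 𝓘(ℝ, EM) 𝓘(ℝ, ℝ) (fun y => C.pairing y (s y) (t y)) x) := fun s t =>
    ((C.pairing_smooth s t x).mdifferentiableAt (by simp)).hasMFDerivAt
  have hfun : (fun y => C.pairing y ((a + b) y) ((a + b) y)) =
      (fun y => C.pairing y (a y) (a y)) + (fun y => C.pairing y (b y) (b y)) +
        ((fun y => C.pairing y (a y) (b y)) + (fun y => C.pairing y (a y) (b y))) := by
    funext y
    simp only [ContMDiffSection.coe_add, Pi.add_apply, map_add, LinearMap.add_apply,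
      C.pairing_symm y (b y) (a y)]
    ring
  have hder := (((hd a a).add (hd b b)).add ((hd a b).add (hd a b))).mfderiv
  rw [← hfun] at hder
  have hv := congrArg (fun T : EM →L[ℝ] ℝ => T (C.anchor x v)) hder
  have hv' : dirDeriv (fun y => C.pairing y ((a + b) y) ((a + b) y)) x (C.anchor x v) =
      dirDeriv (fun y => C.pairing y (a y) (a y)) x (C.anchor x v) +
      dirDeriv (fun y => C.pairing y (b y) (b y)) x (C.anchor x v) +
      (dirDeriv (fun y => C.pairing y (a y) (b y)) x (C.anchor x v) +
        dirDeriv (fun y => C.pairing y (a y) (b y)) x (C.anchor x v)) := hv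
  rw [hab, hv'] at h
  simp only [map_add, LinearMap.add_apply] at h
  linarith

theorem eq_of_pairing_eq {x : M} {u v : E x} (h : ∀ w, C.pairing x w u = C.pairing x w v) :
    u = v := by
  refine sub_eq_zero.1 (C.pairing_nondegenerate x _ fun w => ?_)
  rw [C.pairing_symm, map_sub, h, sub_self]

theorem nondegenerate (x : M) : (C.pairing x).Nondegenerate :=
  ⟨C.pairing_nondegenerate x, fun v hv => C.pairing_nondegenerate x v fun w => by
    rw [C.pairing_symm, hv]⟩

theorem orthogonal_orthogonal {x : M} (W : Submodule ℝ (E x)) :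
    (C.pairing x).orthogonal ((C.pairing x).orthogonal W) = W := by
  have := finiteDimensional_fiber F (E := E) x
  exact LinearMap.BilinForm.orthogonal_orthogonal (nondegenerate x)
    (fun u v h => by rw [C.pairing_symm, h]) W

theorem finrank_add_finrank_orthogonal {x : M} (W : Submodule ℝ (E x)) :
    Module.finrank ℝ W + Module.finrank ℝ ((C.pairing x).orthogonal W) = Module.finrank ℝ F := by
  have := finiteDimensional_fiber F (E := E) x
  rw [LinearMap.BilinForm.finrank_orthogonal (nondegenerate x), finrank_fiber F]
  have := Submodule.finrank_le W
  rw [finrank_fiber F] at this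
  omega

/-- The kernel of the anchor of an exact Courant algebroid is Lagrangian. -/
theorem IsExact.orthogonal_ker (hC : C.IsExact) (x : M) :
    (C.pairing x).orthogonal (LinearMap.ker (C.anchor x)) = LinearMap.ker (C.anchor x) := by
  ext u
  rw [LinearMap.BilinForm.mem_orthogonal_iff, LinearMap.mem_ker, hC.ker_eq_range]
  constructor
  · intro h
    obtain ⟨σ, hσ⟩ := (C.anchor x).exists_rightInverse_of_surjective
      (LinearMap.range_eq_top.2 (hC.surjective x))
    refine ⟨(C.pairing x u).comp σ, fun v => ?_⟩
    have h1 := h (v - σ (C.anchor x v)) (by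
      rw [LinearMap.mem_ker, map_sub, ← LinearMap.comp_apply, hσ, LinearMap.id_apply, sub_self])
    rw [C.pairing_symm, map_sub, sub_eq_zero] at h1
    exact h1
  · rintro ⟨ξ, hξ⟩ v hv
    rw [C.pairing_symm, hξ, LinearMap.mem_ker.1 hv, map_zero]

theorem IsExact.finrank_ker (hC : C.IsExact) (x : M) :
    Module.finrank ℝ EM + Module.finrank ℝ (LinearMap.ker (C.anchor x)) = Module.finrank ℝ F := by
  have := finiteDimensional_fiber F (E := E) x
  have h := (C.anchor x).finrank_range_add_finrank_ker
  rw [LinearMap.range_eq_top.2 (hC.surjective x), finrank_top] at h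
  exact h.trans (finrank_fiber F x)

/-- Because `ker π` is its own orthogonal, `W^⊥ ∩ ker π = (W + ker π)^⊥`. The identity then follows
by counting dimensions. -/
theorem IsExact.finrank_map_anchor_orthogonal (hC : C.IsExact) {x : M} (W : Submodule ℝ (E x)) :
    Module.finrank ℝ (((C.pairing x).orthogonal W).map (C.anchor x)) +
      Module.finrank ℝ (W ⊓ LinearMap.ker (C.anchor x) : Submodule ℝ (E x)) =
        Module.finrank ℝ (LinearMap.ker (C.anchor x)) := by
  have := finiteDimensional_fiber F (E := E) x
  have h1 := finrank_map_add_finrank_inf_ker (C.anchor x) ((C.pairing x).orthogonal W)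
  have h2 : (C.pairing x).orthogonal W ⊓ LinearMap.ker (C.anchor x) =
      (C.pairing x).orthogonal (W ⊔ LinearMap.ker (C.anchor x)) := by
    ext u
    have hu : u ∈ LinearMap.ker (C.anchor x) ↔
        u ∈ (C.pairing x).orthogonal (LinearMap.ker (C.anchor x)) := by rw [hC.orthogonal_ker]
    simp only [Submodule.mem_inf, hu, LinearMap.BilinForm.mem_orthogonal_iff, Submodule.mem_sup]
    constructor
    · rintro ⟨hu, hu'⟩ _ ⟨w, hw, w', hw', rfl⟩
      rw [map_add, LinearMap.add_apply, hu w hw, hu' w' hw', add_zero]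
    · exact fun hu => ⟨fun w hw => hu w ⟨w, hw, 0, Submodule.zero_mem _, add_zero w⟩,
        fun w hw => hu w ⟨0, Submodule.zero_mem _, w, hw, zero_add w⟩⟩
  rw [h2] at h1
  have h3 := finrank_add_finrank_orthogonal (C := C) W
  have h4 := finrank_add_finrank_orthogonal (C := C) (W ⊔ LinearMap.ker (C.anchor x))
  have h5 := Submodule.finrank_sup_add_finrank_inf_eq W (LinearMap.ker (C.anchor x))
  omega

end CourantAlgebroid

namespace ExtendedAction

theorem contMDiff_smul_right (x : M) :
    ContMDiff 𝓘(ℝ, EG) 𝓘(ℝ, EM) ∞ (fun g : G => g • x) := by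
  have : ContMDiff 𝓘(ℝ, EG) 𝓘(ℝ, EM) ∞ (fun g : G => (id g) • (fun _ : G => x) g) :=
    contMDiff_id.smul contMDiff_const
  exact this

/-- At a point with trivial stabilizer the infinitesimal action is injective. -/
theorem proj_eq_zero_of_anchor_eq_zero {a : 𝔞} {x : M}
    (hx : Function.Injective fun g : G => g • x) (h : C.anchor x (X.Ψ a x) = 0) :
    𝒜.proj a = 0 := by
  have : LieGroup 𝓘(ℝ, EG) (minSmoothness ℝ 3) G := by
    simp only [minSmoothness_of_isRCLikeNormedField]
    exact LieGroup.of_le (n := ∞) (by norm_cast)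
  have : IsManifold 𝓘(ℝ, EG) 1 G := IsManifold.of_le (n := ∞) (by simp)
  let v := 𝒜.proj a
  have hv : ContMDiffAt 𝓘(ℝ, EG) (𝓘(ℝ, EG).prod 𝓘(ℝ, EG)) 1
      (fun g : G => (⟨g, mulInvariantVectorField v g⟩ : TangentBundle 𝓘(ℝ, EG) G)) 1 :=
    (contMDiffAt_mulInvariantVectorField v).of_le (by
      simp only [minSmoothness_of_isRCLikeNormedField]; norm_num)
  -- The integral curve through `1` of the left-invariant field of `v` replaces the exponential map.
  -- If `γ t • x` does not move, freeness makes `γ` constant, and so `v = 0`.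
  obtain ⟨γ, hγ0, hγ⟩ := exists_isMIntegralCurveAt_of_contMDiffAt_boundaryless (t₀ := 0) hv
  obtain ⟨ε, hε, hball⟩ := Metric.eventually_nhds_iff_ball.1 hγ
  have hconst : ∀ t ∈ Metric.ball (0 : ℝ) ε, γ t = γ 0 := by
    intro t ht
    refine hx ?_
    by_contra hne
    obtain ⟨f, hf, hfne⟩ := exists_contMDiff_ne (EM := EM) hne
    refine hfne ?_
    have hder : ∀ τ ∈ Metric.ball (0 : ℝ) ε, HasFDerivAt (fun τ => f (γ τ • x)) (0 : ℝ →L[ℝ] ℝ) τ := by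
      intro τ hτ
      let Φ : G → ℝ := fun g => f (g • x)
      have hΦ : ContMDiff 𝓘(ℝ, EG) 𝓘(ℝ, ℝ) ∞ Φ := hf.comp (contMDiff_smul_right x)
      let k := γ τ
      -- Left invariance moves the derivative at `k = γ τ` back to `1`. There `generator` applies to
      -- the translated function `y ↦ f (k • y)`.
      have hfk : ContMDiff 𝓘(ℝ, EM) 𝓘(ℝ, ℝ) ∞ (fun y => f (k • y)) :=
        hf.comp (ContMDiffSMul.contMDiff_const_smul (I := 𝓘(ℝ, EG)) (n := ∞) k)
      have hgen := X.generator a _ hfk x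
      rw [h, dirDeriv_zero, neg_zero, dirDeriv] at hgen
      have hmul : MDifferentiableAt 𝓘(ℝ, EG) 𝓘(ℝ, EG) (fun g : G => k * g) 1 :=
        (contMDiff_mul_left (I := 𝓘(ℝ, EG)) (n := ∞) (a := k)).mdifferentiableAt (by simp)
      have hcomp : (fun g : G => f (k • g • x)) = Φ ∘ fun g : G => k * g := by
        funext g
        simp only [Φ, Function.comp_apply, mul_smul]
      have hΦd : ∀ g, MDifferentiableAt 𝓘(ℝ, EG) 𝓘(ℝ, ℝ) Φ g := fun g =>
        (hΦ g).mdifferentiableAt (by simp)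
      rw [hcomp, mfderiv_comp _ (hΦd _) hmul] at hgen
      have hzero : mfderiv 𝓘(ℝ, EG) 𝓘(ℝ, ℝ) Φ k (mulInvariantVectorField v k) = 0 := by
        have h7 : mfderiv 𝓘(ℝ, EG) 𝓘(ℝ, ℝ) Φ (k * 1) (mulInvariantVectorField v k) = 0 := hgen
        rwa [mul_one] at h7
      have hchain := (hΦd (γ τ)).hasMFDerivAt.comp τ (hball τ hτ)
      refine (hasMFDerivAt_iff_hasFDerivAt.1 hchain).congr_fderiv ?_
      ext
      change mfderiv 𝓘(ℝ, EG) 𝓘(ℝ, ℝ) Φ k ((1 : ℝ) • mulInvariantVectorField v k) = 0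
      rw [one_smul, hzero]
    exact (convex_ball (0 : ℝ) ε).is_const_of_fderivWithin_eq_zero (𝕜 := ℝ)
      (fun z hz => (hder z hz).differentiableAt.differentiableWithinAt)
      (fun z hz => (hder z hz).hasFDerivWithinAt.fderivWithin
        (Metric.isOpen_ball.uniqueDiffWithinAt hz)) ht (Metric.mem_ball_self hε)
  have h1 := hγ.self_of_nhds
  have h2 : HasMFDerivAt 𝓘(ℝ, ℝ) 𝓘(ℝ, EG) γ 0 0 :=
    (hasMFDerivAt_const (γ 0) (0 : ℝ)).congr_of_eventuallyEq
      (eventually_of_mem (Metric.ball_mem_nhds _ hε) hconst)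
  have h3 := congrArg (fun T : ℝ →L[ℝ] EG => T 1) (hasMFDerivAt_unique h1 h2)
  have h4 : mulInvariantVectorField v (γ 0) = 0 := (one_smul ℝ _).symm.trans h3
  rw [hγ0] at h4
  have h5 : mulInvariantVectorField v (1 : G) = v := by
    have h6 : (fun g : G => 1 * g) = id := funext one_mul
    change mfderiv 𝓘(ℝ, EG) 𝓘(ℝ, EG) (fun g : G => 1 * g) 1 v = v
    rw [h6, mfderiv_id]
    rfl
  exact h5.symm.trans h4

/-- Freeness gives one direction. For the other, `Ψ` sends `ker proj` to 1-forms, which the anchor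
kills. -/
theorem anchor_Ψ_eq_zero_iff (hC : C.IsExact) {a : 𝔞} {x : M}
    (hx : Function.Injective fun g : G => g • x) :
    C.anchor x (X.Ψ a x) = 0 ↔ 𝒜.proj a = 0 := by
  refine ⟨X.proj_eq_zero_of_anchor_eq_zero hx, fun h => ?_⟩
  obtain ⟨ξ, hξ, -⟩ := X.closed_of_proj_eq_zero a h
  exact (hC.ker_eq_range x _).2 ⟨ξ x, hξ x⟩

/-- Evaluation of `Ψ` at a point. -/
def ΨAt (x : M) : 𝔞 →ₗ[ℝ] E x where
  toFun a := X.Ψ a x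
  map_add' a b := by rw [map_add]; rfl
  map_smul' c a := by rw [map_smul]; rfl

theorem K_eq_range (x : M) : X.K x = LinearMap.range (X.ΨAt x) :=
  (Submodule.span_eq (LinearMap.range (X.ΨAt x)))

theorem Ψ_mem_K (a : 𝔞) (x : M) : X.Ψ a x ∈ X.K x := Submodule.subset_span ⟨a, rfl⟩

/-- The maps `π ∘ Ψ` at `x` and `proj` have the same kernel, so their images are isomorphic, both
being `𝔞` modulo that kernel. -/
theorem finrank_map_anchor_K (hC : C.IsExact) (h𝒜 : 𝒜.IsExact) {x : M}
    (hx : Function.Injective fun g : G => g • x) :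
    Module.finrank ℝ ((X.K x).map (C.anchor x)) = Module.finrank ℝ EG := by
  have hker : LinearMap.ker ((C.anchor x).comp (X.ΨAt x)) = LinearMap.ker 𝒜.proj := by
    ext a
    exact X.anchor_Ψ_eq_zero_iff hC hx
  rw [K_eq_range, ← LinearMap.range_comp]
  have e₁ := ((C.anchor x).comp (X.ΨAt x)).quotKerEquivRange.finrank_eq
  have e₂ := (𝒜.proj.quotKerEquivOfSurjective h𝒜.surjective).finrank_eq
  rw [hker] at e₁
  exact e₁.symm.trans e₂

variable {EP : Type*} [NormedAddCommGroup EP] [NormedSpace ℝ EP] [FiniteDimensional ℝ EP]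
  {P : Type*} [TopologicalSpace P] [ChartedSpace EP P] [IsManifold 𝓘(ℝ, EP) ∞ P]
  [MulAction G P] [IsCancelSMul G P] {ι : P →[G] M}
  
theorem smul_injective_of_leaf (hleaf : IsLeaf (EP := EP) X.bigDistribution ι) (p : P) :
    Function.Injective fun g : G => g • ι p := by
  intro g h hgh
  have h1 : ι (g • p) = ι (h • p) := by rw [map_smul, map_smul]; exact hgh
  exact IsCancelSMul.right_cancel _ _ _ (hleaf.injective h1)

theorem K_le_Kperp {x : M} (hiso : ∀ u ∈ X.K x, ∀ v ∈ X.K x, C.pairing x u v = 0) :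
    X.K x ≤ X.Kperp x := fun v hv u hu => hiso u hu v hv

/-- Over a leaf on which `K` is isotropic the distribution `K` has constant rank. -/
theorem finrank_K (hC : C.IsExact) (h𝒜 : 𝒜.IsExact)
    (hleaf : IsLeaf (EP := EP) X.bigDistribution ι)
    (hiso : ∀ p, ∀ u ∈ X.K (ι p), ∀ v ∈ X.K (ι p), C.pairing (ι p) u v = 0) (p : P) :
    Module.finrank ℝ (X.K (ι p)) + Module.finrank ℝ EP + Module.finrank ℝ EM =
      Module.finrank ℝ EG + Module.finrank ℝ F := by
  have := finiteDimensional_fiber F (E := E) (ι p)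
  -- The rank of `K` splits as that of `π(K)`, which is `dim G`, plus that of `K ∩ ker π`. The
  -- latter is `dim ker π - dim π(K^⊥)`, and `π(K^⊥) = Δ_b` is the tangent space of the leaf.
  have h1 := finrank_map_add_finrank_inf_ker (C.anchor (ι p)) (X.K (ι p))
  have h2 := hC.finrank_map_anchor_orthogonal (X.K (ι p))
  have h3 := hC.finrank_ker (ι p)
  have h4 := X.finrank_map_anchor_K hC h𝒜 (X.smul_injective_of_leaf hleaf p)
  have h5 : ((C.pairing (ι p)).orthogonal (X.K (ι p))).map (C.anchor (ι p)) =
      X.bigDistribution (ι p) := by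
    rw [bigDistribution, sup_eq_right.2 (X.K_le_Kperp (hiso p))]
    rfl
  have h6 : Module.finrank ℝ (X.bigDistribution (ι p)) = Module.finrank ℝ EP := by
    rw [← hleaf.tangent p]
    exact LinearMap.finrank_range_of_inj (mfderiv_injective_of_isImmersionAt
      (hleaf.immersion.isImmersionAt p))
  rw [h5, h6] at h2
  omega

end ExtendedAction

/-! ### Orthonormal frames of `K` adapted to the infinitesimal action -/

section Frames

/-- The sections `s` of `K` such that the brackets `[Ψ b, s]` are sections of `K`. -/
def ExtendedAction.KSections : Submodule ℝ Cₛ^∞⟮𝓘(ℝ, EM); F, E⟯ where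
  carrier := {s | (∀ y, s y ∈ X.K y) ∧ ∀ b y, C.bracket (X.Ψ b) s y ∈ X.K y}
  zero_mem' := ⟨fun y => Submodule.zero_mem _, fun b y => by
    rw [map_zero]
    exact Submodule.zero_mem _⟩
  add_mem' := fun hs ht => ⟨fun y => Submodule.add_mem _ (hs.1 y) (ht.1 y), fun b y => by
    rw [map_add]
    exact Submodule.add_mem _ (hs.2 b y) (ht.2 b y)⟩
  smul_mem' := fun c s hs => ⟨fun y => Submodule.smul_mem _ _ (hs.1 y), fun b y => by
    rw [map_smul]
    exact Submodule.smul_mem _ _ (hs.2 b y)⟩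

/-- The derivative term of the Leibniz rule is a multiple of `s`, hence again in `K`. This is what
lets Gram–Schmidt stay inside `KSections`. -/
theorem ExtendedAction.smulFun_mem_KSections {f : M → ℝ} (hf : ContMDiff 𝓘(ℝ, EM) 𝓘(ℝ, ℝ) ∞ f)
    {s : Cₛ^∞⟮𝓘(ℝ, EM); F, E⟯} (hs : s ∈ X.KSections) :
    ContMDiffSection.smulFun f hf s ∈ X.KSections := by
  refine ⟨fun y => Submodule.smul_mem _ _ (hs.1 y), fun b y => ?_⟩
  rw [C.bracket_smul f hf (X.Ψ b) s _ (fun _ => rfl)]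
  exact Submodule.add_mem _ (Submodule.smul_mem _ _ (hs.2 b y))
    (Submodule.smul_mem _ _ (hs.1 y))

theorem ExtendedAction.Ψ_mem_KSections (a : 𝔞) : X.Ψ a ∈ X.KSections :=
  ⟨X.Ψ_mem_K a, fun b y => by
    rw [← X.map_bracket]
    exact X.Ψ_mem_K _ y⟩

/-- Near every point there are `finrank K` orthonormal sections of `K`. -/
theorem ExtendedAction.exists_orthonormal_frame_K (h𝒢 : IsGeneralizedMetric C.toBracketedBundle 𝒢)
    (x : M) :
    ∃ k : Fin (Module.finrank ℝ (X.K x)) → Cₛ^∞⟮𝓘(ℝ, EM); F, E⟯,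
      (∀ i, k i ∈ X.KSections) ∧ ∀ᶠ y in 𝓝 x, OrthonormalAt C 𝒢 k y := by
  have := finiteDimensional_fiber F (E := E) x
  have key : ∀ n ≤ Module.finrank ℝ (X.K x), ∃ k : Fin n → Cₛ^∞⟮𝓘(ℝ, EM); F, E⟯,
      (∀ i, k i ∈ X.KSections) ∧ ∀ᶠ y in 𝓝 x, OrthonormalAt C 𝒢 k y := by
    intro n
    induction n with
    | zero =>
      exact fun _ => ⟨Fin.elim0, fun i => i.elim0, Eventually.of_forall fun y i => i.elim0⟩
    | succ n ih =>
      intro hn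
      obtain ⟨k, hkK, hk⟩ := ih (by omega)
      -- Fewer vectors than the rank cannot span `K x`, so some generator `Ψ a` supplies the next
      -- direction.
      have hex : ∃ a : 𝔞, X.Ψ a x ∉ Submodule.span ℝ (Set.range fun i => k i x) := by
        by_contra! hall
        have hle : X.K x ≤ Submodule.span ℝ (Set.range fun i => k i x) := by
          refine Submodule.span_le.2 ?_
          rintro _ ⟨a, rfl⟩
          exact hall a
        have h1 := Submodule.finrank_mono hle
        have h2 := finrank_range_le_card (R := ℝ) (fun i => k i x)
        rw [Fintype.card_fin] at h2
        exact absurd (h1.trans h2) (by omega)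
      obtain ⟨a, ha⟩ := hex
      obtain ⟨t, ht, hort⟩ := exists_orthonormal_snoc h𝒢 hk (X.Ψ a) ha X.KSections
        (fun f hf s hs => X.smulFun_mem_KSections hf hs) hkK (X.Ψ_mem_KSections a)
      refine ⟨Fin.snoc k t, fun i => ?_, hort⟩
      induction i using Fin.lastCases with
      | last => rwa [Fin.snoc_last]
      | cast i =>
        rw [Fin.snoc_castSucc]
        exact hkK i
  exact key _ le_rfl

/-- The component of a vector orthogonal to `K` for the metric `⟨𝒢 u, v⟩`. -/
theorem ExtendedAction.exists_orthogonal_component (h𝒢 : IsGeneralizedMetric C.toBracketedBundle 𝒢)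
    (x : M) (v : E x) :
    ∃ c : E x, v - c ∈ X.K x ∧ ∀ k ∈ X.K x, genMetric C 𝒢 x c k = 0 := by
  have := finiteDimensional_fiber F (E := E) x
  obtain ⟨k, hkS, hk⟩ := X.exists_orthonormal_frame_K h𝒢 x
  have hko := hk.self_of_nhds
  have hkK := fun i => (hkS i).1 x
  refine ⟨v - ∑ i, genMetric C 𝒢 x v (k i x) • k i x, ?_, fun w hw => ?_⟩
  · rw [sub_sub_cancel]
    exact Submodule.sum_mem _ fun i _ => Submodule.smul_mem _ _ (hkK i)
  · rw [eq_sum_of_orthonormal hko hkK le_rfl hw, map_sum]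
    refine Finset.sum_eq_zero fun i _ => ?_
    rw [map_smul, map_sub, LinearMap.sub_apply, sum_smul_apply_of_orthonormal hko, sub_self,
      smul_zero]

/-- The difference `c - c'` lies in `K` and is orthogonal to `K` for a positive definite form.
Allowing `v` and `v'` to differ by `K` makes the component a canonical representative of a class
modulo `K`. -/
theorem ExtendedAction.orthogonal_component_unique (h𝒢 : IsGeneralizedMetric C.toBracketedBundle 𝒢)
    {x : M} {v v' c c' : E x}
    (hv : v - v' ∈ X.K x)
    (h : v - c ∈ X.K x) (h' : v' - c' ∈ X.K x) (hc : ∀ k ∈ X.K x, genMetric C 𝒢 x c k = 0)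
    (hc' : ∀ k ∈ X.K x, genMetric C 𝒢 x c' k = 0) : c = c' := by
  have hK : c - c' ∈ X.K x := by
    have := Submodule.add_mem _ (Submodule.sub_mem _ hv h) h'
    convert this using 1
    abel
  refine sub_eq_zero.1 (eq_zero_of_genMetric_self h𝒢 ?_)
  rw [LinearMap.map_sub₂, hc _ hK, hc' _ hK, sub_self]

end Frames

end Rank

/-! ### Invariance of `K` under the group along the leaf -/

section Invariance

variable {EM : Type*} [NormedAddCommGroup EM] [NormedSpace ℝ EM] [FiniteDimensional ℝ EM]
  {M : Type*} [TopologicalSpace M] [ChartedSpace EM M] [IsManifold 𝓘(ℝ, EM) ∞ M] [T2Space M]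
  {F : Type*} [NormedAddCommGroup F] [NormedSpace ℝ F] [FiniteDimensional ℝ F]
  {E : M → Type*} [TopologicalSpace (TotalSpace F E)] [∀ x, AddCommGroup (E x)]
  [∀ x, Module ℝ (E x)] [∀ x, TopologicalSpace (E x)] [FiberBundle F E] [VectorBundle ℝ F E]
  [ContMDiffVectorBundle ∞ F E 𝓘(ℝ, EM)]
  {EG : Type*} [NormedAddCommGroup EG] [NormedSpace ℝ EG] [FiniteDimensional ℝ EG]
  {G : Type*} [TopologicalSpace G] [ChartedSpace EG G] [Group G] [LieGroup 𝓘(ℝ, EG) ∞ G]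
  [MulAction G M] [ContMDiffSMul 𝓘(ℝ, EG) 𝓘(ℝ, EM) ∞ G M]
  {𝔞 : Type*} [AddCommGroup 𝔞] [Module ℝ 𝔞]
  {C : CourantAlgebroid EM F E} {𝒜 : CourantAlgebra 𝔞 (GroupLieAlgebra 𝓘(ℝ, EG) G)}
  (X : ExtendedAction C 𝒜) {𝒢 : ∀ x, Module.End ℝ (E x)}

theorem dirDeriv_eq_zero_of_eventually_const {N EN : Type*} [NormedAddCommGroup EN]
    [NormedSpace ℝ EN] [TopologicalSpace N] [ChartedSpace EN N] {f : N → ℝ} {x : N} {c : ℝ}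
    (h : ∀ᶠ y in 𝓝 x, f y = c) (v : TangentSpace 𝓘(ℝ, EN) x) : dirDeriv f x v = 0 := by
  have h1 : f =ᶠ[𝓝 x] fun _ => c := h
  rw [dirDeriv, h1.mfderiv_eq, mfderiv_const]
  rfl

/-- The derivative is `-2 ∑ αᵢ dαᵢ`. The product rule delivers it as a sum of two equal halves. -/
theorem hasMFDerivAt_const_sub_sum_sq {N EN : Type*} [NormedAddCommGroup EN]
    [NormedSpace ℝ EN] [TopologicalSpace N] [ChartedSpace EN N] {n : ℕ} {α : Fin n → N → ℝ} {x : N}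
    (c : ℝ) (hα : ∀ i, MDifferentiableAt 𝓘(ℝ, EN) 𝓘(ℝ, ℝ) (α i) x)
    (h : ∀ w : TangentSpace 𝓘(ℝ, EN) x, ∑ i, α i x * dirDeriv (α i) x w = 0) :
    HasMFDerivAt 𝓘(ℝ, EN) 𝓘(ℝ, ℝ) (fun y => c - ∑ i, α i y * α i y) x 0 := by
  have h1 := (hasMFDerivAt_const (I := 𝓘(ℝ, EN)) (I' := 𝓘(ℝ, ℝ)) c x).sub
    (HasMFDerivAt.sum (t := Finset.univ)
      fun i _ => (hα i).hasMFDerivAt.mul (hα i).hasMFDerivAt)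
  have hfun : ((fun _ : N => c) - ∑ i, α i * α i) = fun y => c - ∑ i, α i y * α i y := by
    funext y
    simp [Finset.sum_apply]
  rw [hfun] at h1
  refine h1.congr_mfderiv ?_
  refine ContinuousLinearMap.ext fun w => ?_
  have hw : (∑ i, α i x * dirDeriv (α i) x w) + ∑ i, α i x * dirDeriv (α i) x w = 0 := by
    rw [h w, add_zero]
  rw [← Finset.sum_add_distrib] at hw
  have hT : ∀ T : Fin n → EN →L[ℝ] ℝ, ∀ u : EN, (0 - ∑ i, T i : EN →L[ℝ] ℝ) u = -∑ i, T i u :=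
    fun T u => by simp
  refine (hT _ w).trans ?_
  exact neg_eq_zero.2 hw

/-- The pairing of a smooth section of `E` along a map with a section of `E` is smooth. -/
theorem contMDiff_pairing_along {N EN : Type*} [NormedAddCommGroup EN] [NormedSpace ℝ EN]
    [TopologicalSpace N] [ChartedSpace EN N] {f : N → M} {σ : ∀ n, E (f n)}
    (hσ : ContMDiff 𝓘(ℝ, EN) (𝓘(ℝ, EM).prod 𝓘(ℝ, F)) ∞ (fun n => TotalSpace.mk' F (f n) (σ n)))
    (s : Cₛ^∞⟮𝓘(ℝ, EM); F, E⟯) :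
    ContMDiff 𝓘(ℝ, EN) 𝓘(ℝ, ℝ) ∞ (fun n => C.pairing (f n) (σ n) (s (f n))) := by
  intro n₀
  have hf : ContMDiff 𝓘(ℝ, EN) 𝓘(ℝ, EM) ∞ f :=
    (Bundle.contMDiff_proj (IB := 𝓘(ℝ, EM)) (n := ∞) E (F := F)).comp hσ
  obtain ⟨a, ha⟩ := exists_global_frame EM F E (f n₀)
  let b := Module.finBasis ℝ F
  let e := trivializationAt F E (f n₀)
  have hcoef : ∀ i, ContMDiffAt 𝓘(ℝ, EN) 𝓘(ℝ, ℝ) ∞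
      (fun n => b.repr (e (TotalSpace.mk' F (f n) (σ n))).2 i) n₀ := by
    intro i
    have h1 := (Bundle.contMDiffAt_totalSpace.1 (hσ n₀)).2
    have h2 : ContMDiff 𝓘(ℝ, F) 𝓘(ℝ, ℝ) ∞ (fun w => b.repr w i) := by
      rw [contMDiff_iff_contDiff]
      exact (LinearMap.toContinuousLinearMap (b.coord i)).contDiff
    exact h2.contMDiffAt.comp n₀ h1
  have hsum : ContMDiffAt 𝓘(ℝ, EN) 𝓘(ℝ, ℝ) ∞
      (fun n => ∑ i, b.repr (e (TotalSpace.mk' F (f n) (σ n))).2 i •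
        C.pairing (f n) (a i (f n)) (s (f n))) n₀ :=
    contMDiffAt_finsetSum fun i _ => (hcoef i).smul
      (((C.pairing_smooth (a i) s).comp hf) n₀)
  refine hsum.congr_of_eventuallyEq ?_
  filter_upwards [hf.continuous.continuousAt.eventually ha] with n hn
  conv_lhs => rw [hn (σ n)]
  rw [LinearMap.map_sum₂]
  exact Finset.sum_congr rfl fun i _ => by rw [LinearMap.map_smul₂]

namespace ExtendedAction

/-- The action of `G` on the total space of `E`. -/
def actTotal (g : G) (w : TotalSpace F E) : TotalSpace F E :=
  TotalSpace.mk' F (g • w.proj) (X.act g w.proj w.snd)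

theorem actTotal_mul (g h : G) (w : TotalSpace F E) :
    X.actTotal (g * h) w = X.actTotal g (X.actTotal h w) := X.act_mul g h w.proj w.snd

theorem actTotal_one (w : TotalSpace F E) : X.actTotal 1 w = w := X.act_one w.proj w.snd

theorem exists_actTotal_eq (g : G) (w : TotalSpace F E) {x : M} (hx : w.proj = g • x) :
    ∃ v : E x, X.actTotal g (TotalSpace.mk' F x v) = w ∧
      TotalSpace.mk' F x v = X.actTotal g⁻¹ w := by
  have h1 : (X.actTotal g⁻¹ w).proj = x := by
    change g⁻¹ • w.proj = x
    rw [hx, inv_smul_smul]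
  obtain ⟨v, hv⟩ : ∃ v : E x, TotalSpace.mk' F x v = X.actTotal g⁻¹ w := by
    subst h1
    exact ⟨_, rfl⟩
  exact ⟨v, by rw [hv, ← actTotal_mul, mul_inv_cancel, actTotal_one], hv⟩

theorem exists_act_eq (g : G) {x : M} (u : E (g • x)) : ∃ v : E x, X.act g x v = u ∧
    TotalSpace.mk' F x v = X.actTotal g⁻¹ (TotalSpace.mk' F (g • x) u) := by
  obtain ⟨v, hv, hv'⟩ := X.exists_actTotal_eq g (TotalSpace.mk' F (g • x) u) rfl
  exact ⟨v, TotalSpace.mk_inj.1 hv, hv'⟩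

theorem contMDiff_act (x : M) (v : E x) :
    ContMDiff 𝓘(ℝ, EG) (𝓘(ℝ, EM).prod 𝓘(ℝ, F)) ∞
      (fun g : G => TotalSpace.mk' F (g • x) (X.act g x v)) := by
  have h : ContMDiff 𝓘(ℝ, EG) (𝓘(ℝ, EG).prod (𝓘(ℝ, EM).prod 𝓘(ℝ, F))) ∞
      (fun g : G => (g, TotalSpace.mk' F x v)) := contMDiff_id.prodMk contMDiff_const
  exact X.act_smooth.comp h

theorem contMDiff_pairing_act (x : M) (v : E x) (s : Cₛ^∞⟮𝓘(ℝ, EM); F, E⟯) :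
    ContMDiff 𝓘(ℝ, EG) 𝓘(ℝ, ℝ) ∞
      (fun g : G => C.pairing (g • x) (X.act g x v) (s (g • x))) :=
  contMDiff_pairing_along (X.contMDiff_act x v) s

/-- The right translations are transitive on the tangent vectors of `G`. -/
theorem exists_mfderiv_mul_right_eq (g : G) (w : EG) :
    ∃ γ : GroupLieAlgebra 𝓘(ℝ, EG) G,
      (mfderiv 𝓘(ℝ, EG) 𝓘(ℝ, EG) (fun h : G => h * g) 1 γ : EG) = w := by
  have hd : ∀ a b : G, MDifferentiableAt 𝓘(ℝ, EG) 𝓘(ℝ, EG) (fun h : G => h * a) b := fun a b =>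
    (contMDiff_mul_right (I := 𝓘(ℝ, EG)) (n := ∞) (a := a) b).mdifferentiableAt (by simp)
  have h1 := (hd g (g * g⁻¹)).hasMFDerivAt.comp g (hd g⁻¹ g).hasMFDerivAt
  have h2 : ((fun h : G => h * g) ∘ fun h : G => h * g⁻¹) = id := by
    funext h
    simp
  rw [h2] at h1
  have h3 := congrArg (fun T : EG →L[ℝ] EG => T w) (hasMFDerivAt_unique h1 (hasMFDerivAt_id g))
  refine ⟨(mfderiv 𝓘(ℝ, EG) 𝓘(ℝ, EG) (fun h : G => h * g⁻¹) g w : EG), ?_⟩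
  have h4 : (mfderiv 𝓘(ℝ, EG) 𝓘(ℝ, EG) (fun h : G => h * g) (g * g⁻¹)
    (mfderiv 𝓘(ℝ, EG) 𝓘(ℝ, EG) (fun h : G => h * g⁻¹) g w : EG) : EG) = w := h3
  rwa [mul_inv_cancel] at h4

/-- The derivative of `g ↦ ⟨g · v, s (g • x)⟩` at an arbitrary point of `G`. -/
theorem mfderiv_pairing_act (x : M) (v : E x) (s : Cₛ^∞⟮𝓘(ℝ, EM); F, E⟯) (g : G) (b : 𝔞) :
    dirDeriv (fun g : G => C.pairing (g • x) (X.act g x v) (s (g • x))) g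
      (mfderiv 𝓘(ℝ, EG) 𝓘(ℝ, EG) (fun h : G => h * g) 1 (𝒜.proj b) : EG) =
      -C.pairing (g • x) (X.act g x v) (C.bracket (X.Ψ b) s (g • x)) := by
  rw [← X.generator_section b s (g • x) (X.act g x v)]
  let α : G → ℝ := fun g => C.pairing (g • x) (X.act g x v) (s (g • x))
  have hα : (fun h : G => C.pairing (h • g • x) (X.act h (g • x) (X.act g x v)) (s (h • g • x))) =
      α ∘ fun h => h * g := by
    funext h
    exact congrArg (fun w : TotalSpace F E => C.pairing w.proj w.snd (s w.proj))
      (X.act_mul h g x v).symm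
  have hd : MDifferentiableAt 𝓘(ℝ, EG) 𝓘(ℝ, EG) (fun h : G => h * g) 1 :=
    (contMDiff_mul_right (I := 𝓘(ℝ, EG)) (n := ∞) (a := g) 1).mdifferentiableAt (by simp)
  have hαd : MDifferentiableAt 𝓘(ℝ, EG) 𝓘(ℝ, ℝ) α (1 * g) :=
    (X.contMDiff_pairing_act x v s _).mdifferentiableAt (by simp)
  rw [hα]
  have h1 : (mfderiv 𝓘(ℝ, EG) 𝓘(ℝ, ℝ) (α ∘ fun h => h * g) 1 (𝒜.proj b) : ℝ) =
      (mfderiv 𝓘(ℝ, EG) 𝓘(ℝ, ℝ) α (1 * g)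
        (mfderiv 𝓘(ℝ, EG) 𝓘(ℝ, EG) (fun h : G => h * g) 1 (𝒜.proj b) : EG) : ℝ) :=
    congrArg (fun T : EG →L[ℝ] ℝ => T (𝒜.proj b))
      (mfderiv_comp (I' := 𝓘(ℝ, EG)) (f := fun h : G => h * g) (1 : G) hαd hd)
  rw [one_mul] at h1
  exact h1.symm

/-- Infinitesimal form of the invariance of `𝒢`: the functions of `g` whose derivatives compute the
two sides coincide. -/
theorem bracket_Ψ_𝒢 (h𝒢 : IsGeneralizedMetric C.toBracketedBundle 𝒢)
    (hinv : ∀ (g : G) (x : M) (v : E x), 𝒢 (g • x) (X.act g x v) = X.act g x (𝒢 x v))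
    (b : 𝔞) {s t : Cₛ^∞⟮𝓘(ℝ, EM); F, E⟯} (ht : ∀ x, t x = 𝒢 x (s x)) (x : M) :
    C.bracket (X.Ψ b) t x = 𝒢 x (C.bracket (X.Ψ b) s x) := by
  refine CourantAlgebroid.eq_of_pairing_eq (C := C) fun v => neg_injective ?_
  rw [← pairing_𝒢_left h𝒢, ← X.generator_section, ← X.generator_section]
  congr 1
  funext g
  rw [ht, ← pairing_𝒢_left h𝒢, hinv]

theorem genMetric_act (hinv : ∀ (g : G) (x : M) (v : E x), 𝒢 (g • x) (X.act g x v) = X.act g x (𝒢 x v))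
    (g : G) (x : M) (u v : E x) :
    genMetric C 𝒢 (g • x) (X.act g x u) (X.act g x v) = genMetric C 𝒢 x u v := by
  rw [genMetric_apply, genMetric_apply, hinv, X.act_pairing]

/-- The constants `⟨𝒢 kᵢ, kⱼ⟩ = δᵢⱼ` are differentiated along `Ψ b`, which commutes with `𝒢`. -/
theorem genMetric_bracket_Ψ_antisymm (h𝒢 : IsGeneralizedMetric C.toBracketedBundle 𝒢)
    (hinv : ∀ (g : G) (x : M) (v : E x), 𝒢 (g • x) (X.act g x v) = X.act g x (𝒢 x v))
    {n : ℕ} {k : Fin n → Cₛ^∞⟮𝓘(ℝ, EM); F, E⟯} {x : M}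
    (hk : ∀ᶠ y in 𝓝 x, OrthonormalAt C 𝒢 k y) (b : 𝔞) (i j : Fin n) :
    genMetric C 𝒢 x (C.bracket (X.Ψ b) (k i) x) (k j x) =
      -genMetric C 𝒢 x (C.bracket (X.Ψ b) (k j) x) (k i x) := by
  obtain ⟨t, ht⟩ := exists_section_𝒢 h𝒢 (k i)
  have h := C.bracket_pairing (X.Ψ b) t (k j) x
  rw [dirDeriv_eq_zero_of_eventually_const (c := if i = j then 1 else 0)
    (hk.mono fun y hy => by rw [ht]; exact hy i j), X.bracket_Ψ_𝒢 h𝒢 hinv b ht, ht] at h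
  rw [genMetric_symm h𝒢 x (C.bracket (X.Ψ b) (k j) x), genMetric_apply, genMetric_apply]
  linarith

variable {EP : Type*} [NormedAddCommGroup EP] [NormedSpace ℝ EP] [FiniteDimensional ℝ EP]
  {P : Type*} [TopologicalSpace P] [ChartedSpace EP P] [IsManifold 𝓘(ℝ, EP) ∞ P]
  [MulAction G P] [IsCancelSMul G P] {ι : P →[G] M}

theorem finrank_K_eq (hC : C.IsExact) (h𝒜 : 𝒜.IsExact)
    (hleaf : IsLeaf (EP := EP) X.bigDistribution ι)
    (hiso : ∀ p, ∀ u ∈ X.K (ι p), ∀ v ∈ X.K (ι p), C.pairing (ι p) u v = 0)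
    (p q : P) :
    Module.finrank ℝ (X.K (ι p)) = Module.finrank ℝ (X.K (ι q)) := by
  have h1 := X.finrank_K hC h𝒜 hleaf hiso p
  have h2 := X.finrank_K hC h𝒜 hleaf hiso q
  omega

variable [ConnectedSpace G]

/-- The distribution `K` is invariant over the leaf. -/
theorem act_mem_K (h𝒢 : IsGeneralizedMetric C.toBracketedBundle 𝒢)
    (hinv : ∀ (g : G) (x : M) (v : E x), 𝒢 (g • x) (X.act g x v) = X.act g x (𝒢 x v))
    (hC : C.IsExact) (h𝒜 : 𝒜.IsExact)
    (hleaf : IsLeaf (EP := EP) X.bigDistribution ι)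
    (hiso : ∀ p, ∀ u ∈ X.K (ι p), ∀ v ∈ X.K (ι p), C.pairing (ι p) u v = 0)
    (g : G) (p : P) {v : E (ι p)} (hv : v ∈ X.K (ι p)) :
    X.act g (ι p) v ∈ X.K (g • ι p) := by
  let x := ι p
  choose c hcK hcperp using fun g : G => X.exists_orthogonal_component h𝒢 (g • x) (X.act g x v)
  -- `Q g` is the squared distance of `g · v` from `K`. It is shown to be constant on `G`, and it
  -- vanishes at `1`.
  let Q : G → ℝ := fun g => genMetric C 𝒢 (g • x) (c g) (c g)
  have hder : ∀ g, HasMFDerivAt 𝓘(ℝ, EG) 𝓘(ℝ, ℝ) Q g 0 := by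
    intro g₀
    have := finiteDimensional_fiber F (E := E) (g₀ • x)
    obtain ⟨k, hkS, hk⟩ := X.exists_orthonormal_frame_K h𝒢 (g₀ • x)
    let α : Fin _ → G → ℝ := fun i g => C.pairing (g • x) (X.act g x (𝒢 x v)) (k i (g • x))
    have hαm : ∀ i g, α i g = genMetric C 𝒢 (g • x) (X.act g x v) (k i (g • x)) := fun i g => by
      rw [genMetric_apply, hinv]
    -- Pythagoras, with `|g · v| = |v|`. Constancy of the rank along the orbit is what makes the
    -- frame chosen at `g₀ • x` span `K` at the nearby points.
    have hQ : ∀ᶠ g in 𝓝 g₀, Q g = genMetric C 𝒢 x v v - ∑ i, α i g * α i g := by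
      filter_upwards [(contMDiff_smul_right (EG := EG) (EM := EM) (G := G)
        x).continuous.continuousAt.eventually hk] with g hg
      have := finiteDimensional_fiber F (E := E) (g • x)
      have hrank : Module.finrank ℝ (X.K (g • x)) ≤ Module.finrank ℝ (X.K (g₀ • x)) := by
        have := X.finrank_K_eq hC h𝒜 hleaf hiso (g • p) (g₀ • p)
        rw [map_smul, map_smul] at this
        exact this.le
      have hc := eq_sum_of_orthonormal hg (fun i => (hkS i).1 _) hrank (hcK g)
      have hck : ∀ i, genMetric C 𝒢 (g • x) (c g) (k i (g • x)) = 0 := fun i =>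
        hcperp g _ ((hkS i).1 _)
      have hc' : X.act g x v = c g + ∑ i, α i g • k i (g • x) := by
        rw [← sub_eq_iff_eq_add', hc]
        exact Finset.sum_congr rfl fun i _ => by
          rw [LinearMap.map_sub₂, hck, sub_zero, hαm]
      have h1 := X.genMetric_act hinv g x v v
      have h2 : genMetric C 𝒢 (g • x) (X.act g x v) (X.act g x v) =
          genMetric C 𝒢 (g • x) (X.act g x v) (c g) + ∑ i, α i g * α i g := by
        conv_lhs => enter [2]; rw [hc']
        rw [map_add, map_sum]
        congr 1
        exact Finset.sum_congr rfl fun i _ => by rw [map_smul, smul_eq_mul, ← hαm]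
      have h3 : genMetric C 𝒢 (g • x) (X.act g x v) (c g) = Q g := by
        have h4 := hcperp g _ (hcK g)
        rw [map_sub, genMetric_symm h𝒢 _ (c g) (X.act g x v), sub_eq_zero] at h4
        exact h4
      rw [← h1, h2, h3]
      ring
    have hsum : HasMFDerivAt 𝓘(ℝ, EG) 𝓘(ℝ, ℝ)
        (fun g => genMetric C 𝒢 x v v - ∑ i, α i g * α i g) g₀ 0 := by
      refine hasMFDerivAt_const_sub_sum_sq _ (fun i =>
        (X.contMDiff_pairing_act x (𝒢 x v) (k i) g₀).mdifferentiableAt (by simp)) fun w => ?_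
      -- Every tangent vector at `g₀` is a right translate of some `proj b`, so the derivative of
      -- `αᵢ` is governed by `[Ψ b, kᵢ]`. That bracket lies in `K` and expands in the frame.
      obtain ⟨γ, hγ⟩ := exists_mfderiv_mul_right_eq (EG := EG) g₀ w
      obtain ⟨b, rfl⟩ := h𝒜.surjective γ
      have hdα : ∀ i, dirDeriv (α i) g₀ w = -∑ j,
          genMetric C 𝒢 (g₀ • x) (C.bracket (X.Ψ b) (k i) (g₀ • x)) (k j (g₀ • x)) * α j g₀ := by
        intro i
        rw [← hγ, X.mfderiv_pairing_act x (𝒢 x v) (k i) g₀ b]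
        conv_lhs => rw [eq_sum_of_orthonormal hk.self_of_nhds (fun i => (hkS i).1 _) le_rfl
          ((hkS i).2 b (g₀ • x))]
        rw [map_sum]
        congr 1
        exact Finset.sum_congr rfl fun j _ => by rw [map_smul, smul_eq_mul]
      have hanti := X.genMetric_bracket_Ψ_antisymm h𝒢 hinv hk b
      simp only [hdα, mul_neg, Finset.sum_neg_distrib, neg_eq_zero, Finset.mul_sum]
      -- The quadratic form of an antisymmetric matrix equals its own negative, hence vanishes.
      have hS : ∑ i, ∑ j, α i g₀ * (genMetric C 𝒢 (g₀ • x)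
            (C.bracket (X.Ψ b) (k i) (g₀ • x)) (k j (g₀ • x)) * α j g₀) =
          -∑ i, ∑ j, α i g₀ * (genMetric C 𝒢 (g₀ • x)
            (C.bracket (X.Ψ b) (k i) (g₀ • x)) (k j (g₀ • x)) * α j g₀) := by
        conv_lhs => rw [Finset.sum_comm]
        rw [← Finset.sum_neg_distrib]
        refine Finset.sum_congr rfl fun i _ => ?_
        rw [← Finset.sum_neg_distrib]
        refine Finset.sum_congr rfl fun j _ => ?_
        rw [hanti j i]
        ring
      linarith
    exact hsum.congr_of_eventuallyEq hQ
  have hconst := (isLocallyConstant_of_hasMFDerivAt_zero hder).apply_eq_of_isPreconnected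
    isPreconnected_univ (Set.mem_univ g) (Set.mem_univ 1)
  have h1 : X.act 1 x v ∈ X.K ((1 : G) • x) :=
    (congrArg (fun w : TotalSpace F E => w.snd ∈ X.K w.proj) (X.act_one x v)).mpr hv
  have h2 : c 1 = 0 := by
    refine eq_zero_of_genMetric_self h𝒢 (hcperp 1 _ ?_)
    have := Submodule.sub_mem _ h1 (hcK 1)
    rwa [sub_sub_cancel] at this
  have h3 : c g = 0 := by
    refine eq_zero_of_genMetric_self h𝒢 (hconst.trans ?_)
    change genMetric C 𝒢 _ (c 1) (c 1) = 0
    rw [h2, map_zero]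
  have h4 := hcK g
  rwa [h3, sub_zero] at h4

end ExtendedAction

end Invariance

/-! ### Brackets of basic sections modulo `K` -/

section Bracket

variable {EM : Type*} [NormedAddCommGroup EM] [NormedSpace ℝ EM] [FiniteDimensional ℝ EM]
  {M : Type*} [TopologicalSpace M] [ChartedSpace EM M] [IsManifold 𝓘(ℝ, EM) ∞ M] [T2Space M]
  {F : Type*} [NormedAddCommGroup F] [NormedSpace ℝ F] [FiniteDimensional ℝ F]
  {E : M → Type*} [TopologicalSpace (TotalSpace F E)] [∀ x, AddCommGroup (E x)]
  [∀ x, Module ℝ (E x)] [∀ x, TopologicalSpace (E x)] [FiberBundle F E] [VectorBundle ℝ F E]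
  [ContMDiffVectorBundle ∞ F E 𝓘(ℝ, EM)]
  {EG : Type*} [NormedAddCommGroup EG] [NormedSpace ℝ EG] [FiniteDimensional ℝ EG]
  {G : Type*} [TopologicalSpace G] [ChartedSpace EG G] [Group G] [LieGroup 𝓘(ℝ, EG) ∞ G]
  [MulAction G M] [ContMDiffSMul 𝓘(ℝ, EG) 𝓘(ℝ, EM) ∞ G M]
  {𝔞 : Type*} [AddCommGroup 𝔞] [Module ℝ 𝔞]
  {C : CourantAlgebroid EM F E} {𝒜 : CourantAlgebra 𝔞 (GroupLieAlgebra 𝓘(ℝ, EG) G)}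
  (X : ExtendedAction C 𝒜) {𝒢 : ∀ x, Module.End ℝ (E x)}

variable {EP : Type*} [NormedAddCommGroup EP] [NormedSpace ℝ EP] [FiniteDimensional ℝ EP]
  {P : Type*} [TopologicalSpace P] [ChartedSpace EP P] [IsManifold 𝓘(ℝ, EP) ∞ P]
  [MulAction G P] [ContMDiffSMul 𝓘(ℝ, EG) 𝓘(ℝ, EP) ∞ G P] [IsCancelSMul G P] {ι : P →[G] M}
  [ConnectedSpace G]

namespace ExtendedAction

variable (𝒢 ι EP) in
/-- The standing assumptions for the reduction along the leaf `ι : P → M`. -/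
structure ReductionSetting : Prop where
  exact : C.IsExact
  algExact : 𝒜.IsExact
  metric : IsGeneralizedMetric C.toBracketedBundle 𝒢
  inv : ∀ (g : G) (x : M) (v : E x), 𝒢 (g • x) (X.act g x v) = X.act g x (𝒢 x v)
  leaf : IsLeaf (EP := EP) X.bigDistribution ι
  iso : ∀ p, ∀ u ∈ X.K (ι p), ∀ v ∈ X.K (ι p), C.pairing (ι p) u v = 0

variable {X}

namespace ReductionSetting

theorem K_le_Kperp (H : ReductionSetting X 𝒢 EP ι) (p : P) : X.K (ι p) ≤ X.Kperp (ι p) :=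
  X.K_le_Kperp (H.iso p)

theorem actTotal_mem_K (H : ReductionSetting X 𝒢 EP ι) (g : G) {w : TotalSpace F E} {p : P}
    (hp : w.proj = ι p) (hw : w.snd ∈ X.K w.proj) :
    (X.actTotal g w).snd ∈ X.K (X.actTotal g w).proj := by
  obtain ⟨x, v⟩ := w
  change x = ι p at hp
  subst hp
  exact X.act_mem_K H.metric H.inv H.exact H.algExact H.leaf H.iso g p hw

theorem act_mem_K_iff (H : ReductionSetting X 𝒢 EP ι) (g : G) {p : P} {v : E (ι p)} :
    X.act g (ι p) v ∈ X.K (g • ι p) ↔ v ∈ X.K (ι p) := by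
  refine ⟨fun h => ?_, fun h => H.actTotal_mem_K g (w := TotalSpace.mk' F (ι p) v) rfl h⟩
  have h1 := H.actTotal_mem_K g⁻¹ (w := X.actTotal g (TotalSpace.mk' F (ι p) v)) (p := g • p)
    (map_smul ι g p).symm h
  rw [← X.actTotal_mul, inv_mul_cancel, X.actTotal_one] at h1
  exact h1

theorem act_mem_Kperp_iff (H : ReductionSetting X 𝒢 EP ι) (g : G) {p : P} {v : E (ι p)} :
    X.act g (ι p) v ∈ X.Kperp (g • ι p) ↔ v ∈ X.Kperp (ι p) := by
  constructor
  · intro h u hu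
    exact (X.act_pairing g (ι p) u v).symm.trans (h _ ((H.act_mem_K_iff g).2 hu))
  · intro h u hu
    obtain ⟨u', rfl, -⟩ := X.exists_act_eq g u
    exact (X.act_pairing g (ι p) u' v).trans (h _ ((H.act_mem_K_iff g).1 hu))

/-- The derivative, in a direction tangent to the leaf, of a function constant along the leaf. -/
theorem dirDeriv_eq_zero (H : ReductionSetting X 𝒢 EP ι) {f : M → ℝ}
    (hf : ContMDiff 𝓘(ℝ, EM) 𝓘(ℝ, ℝ) ∞ f) {p : P} (h : ∀ᶠ q in 𝓝 p, f (ι q) = 0) {u : E (ι p)}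
    (hu : u ∈ X.Kperp (ι p)) : dirDeriv f (ι p) (C.anchor (ι p) u) = 0 := by
  -- The anchor maps `K^⊥` into `Δ_b`, the tangent space of the leaf, so only the restriction of `f`
  -- to `P` matters.
  have h1 : C.anchor (ι p) u ∈ X.bigDistribution (ι p) :=
    Submodule.mem_map_of_mem (Submodule.mem_sup_right hu)
  rw [← H.leaf.tangent p] at h1
  obtain ⟨w, hw⟩ := h1
  have hι : MDifferentiableAt 𝓘(ℝ, EP) 𝓘(ℝ, EM) ι p :=
    (H.leaf.immersion.isImmersionAt p).contMDiffAt.mdifferentiableAt (by simp)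
  have hfd : MDifferentiableAt 𝓘(ℝ, EM) 𝓘(ℝ, ℝ) f (ι p) := (hf (ι p)).mdifferentiableAt (by simp)
  have h2 := dirDeriv_eq_zero_of_eventually_const (f := f ∘ ι) h w
  rw [dirDeriv, mfderiv_comp p hfd hι] at h2
  rw [← hw]
  exact h2

/-- Near every point of the leaf, `K` has an orthonormal frame of global sections. -/
theorem exists_frame (H : ReductionSetting X 𝒢 EP ι) (p : P) :
    ∃ (n : ℕ) (k : Fin n → Cₛ^∞⟮𝓘(ℝ, EM); F, E⟯), (∀ i y, k i y ∈ X.K y) ∧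
      ∀ᶠ q in 𝓝 p, OrthonormalAt C 𝒢 k (ι q) ∧
        ∀ v ∈ X.K (ι q), v = ∑ i, genMetric C 𝒢 (ι q) v (k i (ι q)) • k i (ι q) := by
  obtain ⟨k, hkS, hk⟩ := X.exists_orthonormal_frame_K H.metric (ι p)
  refine ⟨_, k, fun i => (hkS i).1, ?_⟩
  filter_upwards [(H.leaf.immersion.isImmersionAt p).continuousAt.eventually hk] with q hq
  have := finiteDimensional_fiber F (E := E) (ι q)
  exact ⟨hq, fun v hv => eq_sum_of_orthonormal hq (fun i => (hkS i).1 _)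
    (X.finrank_K_eq H.exact H.algExact H.leaf H.iso q p).le hv⟩

/-- The component orthogonal to `K`, along the leaf, of a section of `E` is locally a section. -/
theorem exists_section_orthogonal_component (H : ReductionSetting X 𝒢 EP ι) (p : P)
    (a : Cₛ^∞⟮𝓘(ℝ, EM); F, E⟯) :
    ∃ t : Cₛ^∞⟮𝓘(ℝ, EM); F, E⟯, ∀ᶠ q in 𝓝 p, a (ι q) - t (ι q) ∈ X.K (ι q) ∧
      ∀ k ∈ X.K (ι q), genMetric C 𝒢 (ι q) (t (ι q)) k = 0 := by
  obtain ⟨n, k, hkK, hk⟩ := H.exists_frame p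
  let c : Cₛ^∞⟮𝓘(ℝ, EM); F, E⟯ :=
    ∑ i, ContMDiffSection.smulFun _ (contMDiff_genMetric H.metric a (k i)) (k i)
  have hc : ∀ y, c y = ∑ i, genMetric C 𝒢 y (a y) (k i y) • k i y := fun y => by
    rw [ContMDiffSection.sum_apply]
    rfl
  refine ⟨a - c, hk.mono fun q hq => ⟨?_, fun v hv => ?_⟩⟩
  · rw [ContMDiffSection.coe_sub, Pi.sub_apply, sub_sub_cancel, hc]
    exact Submodule.sum_mem _ fun i _ => Submodule.smul_mem _ _ (hkK i _)
  · rw [hq.2 v hv, map_sum]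
    refine Finset.sum_eq_zero fun i _ => ?_
    rw [map_smul, ContMDiffSection.coe_sub, Pi.sub_apply, LinearMap.map_sub₂, hc,
      sum_smul_apply_of_orthonormal hq.1, sub_self, smul_zero]

/-- Every vector of `K^⊥` over the leaf extends to a local section of `K^⊥`. -/
theorem exists_Kperp_section (H : ReductionSetting X 𝒢 EP ι) {p : P} {w : E (ι p)}
    (hw : w ∈ X.Kperp (ι p)) :
    ∃ a : Cₛ^∞⟮𝓘(ℝ, EM); F, E⟯, a (ι p) = w ∧ ∀ᶠ q in 𝓝 p, a (ι q) ∈ X.Kperp (ι q) := by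
  obtain ⟨a₀, ha₀⟩ := exists_section_eq EM F w
  obtain ⟨n, k, hkK, hk⟩ := H.exists_frame p
  choose k' hk' using fun i => exists_section_𝒢 H.metric (k i)
  -- Since `⟨𝒢 kᵢ, kⱼ⟩ = δᵢⱼ`, subtracting `∑ ⟨a₀, kᵢ⟩ 𝒢 kᵢ` projects onto `K^⊥` along `𝒢 K`. The
  -- correction vanishes at `p` because `w` is already in `K^⊥`.
  let c : Cₛ^∞⟮𝓘(ℝ, EM); F, E⟯ :=
    ∑ i, ContMDiffSection.smulFun _ (C.pairing_smooth a₀ (k i)) (k' i)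
  have hc : ∀ y, c y = ∑ i, C.pairing y (a₀ y) (k i y) • 𝒢 y (k i y) := fun y => by
    rw [ContMDiffSection.sum_apply]
    exact Finset.sum_congr rfl fun i _ => by rw [ContMDiffSection.smulFun_apply, hk']
  refine ⟨a₀ - c, ?_, hk.mono fun q hq v hv => ?_⟩
  · rw [ContMDiffSection.coe_sub, Pi.sub_apply, hc, ha₀]
    refine sub_eq_self.2 (Finset.sum_eq_zero fun i _ => ?_)
    rw [C.pairing_symm, hw _ (hkK i _), zero_smul]
  · have h1 : ∀ j, C.pairing (ι q) (c (ι q)) (k j (ι q)) =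
        C.pairing (ι q) (a₀ (ι q)) (k j (ι q)) := by
      intro j
      have h2 : c (ι q) = 𝒢 (ι q) (∑ i, C.pairing (ι q) (a₀ (ι q)) (k i (ι q)) • k i (ι q)) := by
        rw [hc, map_sum]
        exact Finset.sum_congr rfl fun i _ => by rw [map_smul]
      rw [h2, ← genMetric_apply (C := C), sum_smul_apply_of_orthonormal hq.1]
    change C.pairing (ι q) v _ = 0
    rw [hq.2 v hv, LinearMap.map_sum₂]
    refine Finset.sum_eq_zero fun i _ => ?_
    rw [LinearMap.map_smul₂, C.pairing_symm, ContMDiffSection.coe_sub, Pi.sub_apply,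
      LinearMap.map_sub₂, h1, sub_self, smul_zero]

end ReductionSetting

variable (X ι) in
/-- `a` restricts near `p` to a section of `K^⊥` along the leaf whose brackets with the sections
`Ψ b` vanish at `p`. -/
structure BasicAt (a : Cₛ^∞⟮𝓘(ℝ, EM); F, E⟯) (p : P) : Prop where
  perp : ∀ᶠ q in 𝓝 p, a (ι q) ∈ X.Kperp (ι q)
  bracket_eq_zero : ∀ b, C.bracket (X.Ψ b) a (ι p) = 0

namespace ReductionSetting

variable {a a' w k : Cₛ^∞⟮𝓘(ℝ, EM); F, E⟯} {p : P}

/-- Differentiating `⟨w, Ψ b⟩ = 0` along `π(a)` reduces the claim to `⟨w, [a, Ψ b]⟩ = 0`. Up to sign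
this is `⟨w, [Ψ b, a]⟩ = 0`, since `⟨a, Ψ b⟩` vanishes along the leaf and `π(w)` is tangent to it.
-/
theorem bracket_mem_Kperp (H : ReductionSetting X 𝒢 EP ι) (ha : X.BasicAt ι a p)
    (hw : ∀ᶠ q in 𝓝 p, w (ι q) ∈ X.Kperp (ι q)) : C.bracket a w (ι p) ∈ X.Kperp (ι p) := by
  have key : ∀ b, C.pairing (ι p) (X.Ψ b (ι p)) (C.bracket a w (ι p)) = 0 := by
    intro b
    have h1 := C.bracket_pairing a w (X.Ψ b) (ι p)
    rw [H.dirDeriv_eq_zero (C.pairing_smooth _ _) (hw.mono fun q hq => by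
      rw [C.pairing_symm]; exact hq _ (X.Ψ_mem_K b _)) ha.perp.self_of_nhds] at h1
    have h2 := CourantAlgebroid.bracket_swap (C := C) a (X.Ψ b) (ι p) (w (ι p))
    rw [H.dirDeriv_eq_zero (C.pairing_smooth _ _) (ha.perp.mono fun q hq => by
      rw [C.pairing_symm]; exact hq _ (X.Ψ_mem_K b _)) hw.self_of_nhds, ha.bracket_eq_zero,
      LinearMap.map_zero₂, add_zero, C.pairing_symm] at h2
    rw [h2, add_zero] at h1
    rw [C.pairing_symm, ← h1]
  intro v hv
  rw [X.K_eq_range] at hv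
  obtain ⟨b, rfl⟩ := hv
  exact key b

/-- Dual to `bracket_mem_Kperp`: by `K = K^⊥⊥` the bracket is tested against local sections `w` of
`K^⊥`, using `⟨k, w⟩ = 0` along the leaf. -/
theorem bracket_mem_K_right (H : ReductionSetting X 𝒢 EP ι) (ha : X.BasicAt ι a p)
    (hk : ∀ᶠ q in 𝓝 p, k (ι q) ∈ X.K (ι q)) : C.bracket a k (ι p) ∈ X.K (ι p) := by
  rw [← CourantAlgebroid.orthogonal_orthogonal (C := C) (X.K (ι p))]
  intro u hu
  obtain ⟨w, rfl, hw⟩ := H.exists_Kperp_section hu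
  have h1 := C.bracket_pairing a k w (ι p)
  rw [H.dirDeriv_eq_zero (C.pairing_smooth _ _) ((hk.and hw).mono fun q hq => hq.2 _ hq.1)
    ha.perp.self_of_nhds, H.bracket_mem_Kperp ha hw _ hk.self_of_nhds, add_zero] at h1
  exact (C.pairing_symm _ _ _).trans h1.symm

theorem bracket_mem_K_left (H : ReductionSetting X 𝒢 EP ι) (ha : X.BasicAt ι a p)
    (hk : ∀ᶠ q in 𝓝 p, k (ι q) ∈ X.K (ι q)) : C.bracket k a (ι p) ∈ X.K (ι p) := by
  rw [← CourantAlgebroid.orthogonal_orthogonal (C := C) (X.K (ι p))]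
  intro u hu
  have h1 := CourantAlgebroid.bracket_swap (C := C) k a (ι p) u
  rw [H.dirDeriv_eq_zero (C.pairing_smooth _ _) ((hk.and ha.perp).mono fun q hq => hq.2 _ hq.1)
    hu, hu _ (H.bracket_mem_K_right ha hk), add_zero] at h1
  exact (C.pairing_symm _ _ _).trans h1

/-- Modulo `K` the bracket only depends on the sections modulo `K` along the leaf. -/
theorem bracket_sub_bracket_mem_K (H : ReductionSetting X 𝒢 EP ι)
    {a₁ a₂ a₁' a₂' : Cₛ^∞⟮𝓘(ℝ, EM); F, E⟯} (h₁' : X.BasicAt ι a₁' p) (h₂ : X.BasicAt ι a₂ p)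
    (h₁₁ : ∀ᶠ q in 𝓝 p, a₁ (ι q) - a₁' (ι q) ∈ X.K (ι q))
    (h₂₂ : ∀ᶠ q in 𝓝 p, a₂ (ι q) - a₂' (ι q) ∈ X.K (ι q)) :
    C.bracket a₁ a₂ (ι p) - C.bracket a₁' a₂' (ι p) ∈ X.K (ι p) := by
  have h1 := H.bracket_mem_K_left (k := a₁ - a₁') h₂ h₁₁
  have h2 := H.bracket_mem_K_right (k := a₂ - a₂') h₁' h₂₂
  have h3 := Submodule.add_mem _ h1 h2
  rw [map_sub, map_sub, LinearMap.sub_apply, ContMDiffSection.coe_sub, ContMDiffSection.coe_sub,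
    Pi.sub_apply, Pi.sub_apply, sub_add_sub_cancel] at h3
  exact h3

end ReductionSetting

end ExtendedAction

end Bracket

/-! ### Invariant lifts and the reduced bracket -/

section Existence

variable {EM : Type*} [NormedAddCommGroup EM] [NormedSpace ℝ EM] [FiniteDimensional ℝ EM]
  {M : Type*} [TopologicalSpace M] [ChartedSpace EM M] [IsManifold 𝓘(ℝ, EM) ∞ M] [T2Space M]
  {F : Type*} [NormedAddCommGroup F] [NormedSpace ℝ F] [FiniteDimensional ℝ F]
  {E : M → Type*} [TopologicalSpace (TotalSpace F E)] [∀ x, AddCommGroup (E x)]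
  [∀ x, Module ℝ (E x)] [∀ x, TopologicalSpace (E x)] [FiberBundle F E] [VectorBundle ℝ F E]
  [ContMDiffVectorBundle ∞ F E 𝓘(ℝ, EM)]
  {EG : Type*} [NormedAddCommGroup EG] [NormedSpace ℝ EG] [FiniteDimensional ℝ EG]
  {G : Type*} [TopologicalSpace G] [ChartedSpace EG G] [Group G] [LieGroup 𝓘(ℝ, EG) ∞ G]
  [MulAction G M] [ContMDiffSMul 𝓘(ℝ, EG) 𝓘(ℝ, EM) ∞ G M]
  {𝔞 : Type*} [AddCommGroup 𝔞] [Module ℝ 𝔞]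
  {C : CourantAlgebroid EM F E} {𝒜 : CourantAlgebra 𝔞 (GroupLieAlgebra 𝓘(ℝ, EG) G)}
  (X : ExtendedAction C 𝒜) {𝒢 : ∀ x, Module.End ℝ (E x)}

variable {EP : Type*} [NormedAddCommGroup EP] [NormedSpace ℝ EP] [FiniteDimensional ℝ EP]
  {P : Type*} [TopologicalSpace P] [ChartedSpace EP P] [IsManifold 𝓘(ℝ, EP) ∞ P]
  [MulAction G P] [ContMDiffSMul 𝓘(ℝ, EG) 𝓘(ℝ, EP) ∞ G P] [IsCancelSMul G P] {ι : P →[G] M}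
  [ConnectedSpace G]

namespace ExtendedAction

variable {X}

/-- The push-forward of a section by an element of `G`. -/
theorem exists_section_act (g : G) (s : Cₛ^∞⟮𝓘(ℝ, EM); F, E⟯) :
    ∃ s' : Cₛ^∞⟮𝓘(ℝ, EM); F, E⟯, ∀ x, s' (g • x) = X.act g x (s x) := by
  -- The vector `g · s (g⁻¹ • y)` lives in the fibre over `g • g⁻¹ • y`. Equality in the total space
  -- identifies that fibre with the one over `y`.
  have hex : ∀ y, ∃ u : E y, TotalSpace.mk' F y u =
      X.actTotal g (TotalSpace.mk' F (g⁻¹ • y) (s (g⁻¹ • y))) := by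
    intro y
    generalize hw : X.actTotal g (TotalSpace.mk' F (g⁻¹ • y) (s (g⁻¹ • y))) = w
    have hy : w.proj = y := by
      rw [← hw]
      exact smul_inv_smul g y
    subst hy
    exact ⟨_, rfl⟩
  choose u hu using hex
  have hsm : ContMDiff 𝓘(ℝ, EM) (𝓘(ℝ, EM).prod 𝓘(ℝ, F)) ∞ (fun y => TotalSpace.mk' F y (u y)) := by
    have h1 : ContMDiff 𝓘(ℝ, EM) (𝓘(ℝ, EG).prod (𝓘(ℝ, EM).prod 𝓘(ℝ, F))) ∞
        (fun y : M => (g, TotalSpace.mk' F (g⁻¹ • y) (s (g⁻¹ • y)))) :=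
      contMDiff_const.prodMk (s.contMDiff.comp
        (ContMDiffSMul.contMDiff_const_smul (I := 𝓘(ℝ, EG)) (n := ∞) g⁻¹))
    have h2 := X.act_smooth.comp h1
    have h3 : (fun y => TotalSpace.mk' F y (u y)) = _ := funext hu
    rw [h3]
    exact h2
  refine ⟨⟨u, hsm⟩, fun x => ?_⟩
  have h1 := hu (g • x)
  rw [congrArg (fun y => TotalSpace.mk' F y (s y)) (inv_smul_smul g x)] at h1
  exact TotalSpace.mk_inj.1 h1

variable (X ι) in
/-- A smooth invariant section of `K^⊥` over `P`. -/
structure IsInvariantSection (EP : Type*) [NormedAddCommGroup EP] [NormedSpace ℝ EP]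
    [ChartedSpace EP P] (s : ∀ p : P, E (ι p)) : Prop where
  smooth : ContMDiff 𝓘(ℝ, EP) (𝓘(ℝ, EM).prod 𝓘(ℝ, F)) ∞ (fun p => TotalSpace.mk' F (ι p) (s p))
  mem_Kperp : ∀ p, s p ∈ X.Kperp (ι p)
  act_eq : ∀ (g : G) (p : P), TotalSpace.mk' F (ι (g • p)) (s (g • p)) =
    TotalSpace.mk' F (g • ι p) (X.act g (ι p) (s p))

theorem IsInvariantLift.isInvariantSection {s : ∀ p : P, E (ι p)} {e : ∀ z, X.Ered ι z}
    (h : X.IsInvariantLift ι EP s e) : X.IsInvariantSection ι EP s where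
  smooth := h.smooth
  mem_Kperp p := by
    obtain ⟨hm, -⟩ := h.represents (Quotient.mk _ p)
    exact hm.1 ⟨p, rfl⟩
  act_eq g p := by
    obtain ⟨hm, -⟩ := h.represents (Quotient.mk _ p)
    exact hm.2 g ⟨p, rfl⟩ ⟨g • p, Quotient.sound ⟨g, rfl⟩⟩ rfl

theorem IsInvariantSection.mem_invKperp {s : ∀ p : P, E (ι p)} (h : X.IsInvariantSection ι EP s)
    (z : MulAction.orbitRel.Quotient G P) :
    (fun p : OrbitPoints z => s p.1) ∈ X.invKperp ι z := by
  refine ⟨fun p => h.mem_Kperp p.1, ?_⟩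
  rintro g ⟨p, hp⟩ ⟨p', hp'⟩ hpp
  change p' = g • p at hpp
  subst hpp
  exact h.act_eq g p

theorem IsInvariantSection.isInvariantLift {s : ∀ p : P, E (ι p)}
    (h : X.IsInvariantSection ι EP s) :
    X.IsInvariantLift ι EP s fun z => X.redProj ι z ⟨_, h.mem_invKperp z⟩ :=
  ⟨h.smooth, fun z => ⟨h.mem_invKperp z, rfl⟩⟩

theorem IsInvariantLift.sub_mem_K {s s' : ∀ p : P, E (ι p)} {e : ∀ z, X.Ered ι z}
    (h : X.IsInvariantLift ι EP s e) (h' : X.IsInvariantLift ι EP s' e) (p : P) :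
    s p - s' p ∈ X.K (ι p) := by
  obtain ⟨hm, he⟩ := h.represents (Quotient.mk _ p)
  obtain ⟨hm', he'⟩ := h'.represents (Quotient.mk _ p)
  exact (Submodule.Quotient.eq _).1 (he.trans he'.symm) ⟨p, rfl⟩

theorem IsInvariantLift.eq_of_sub_mem_K {s s' : ∀ p : P, E (ι p)} {e e' : ∀ z, X.Ered ι z}
    (h : X.IsInvariantLift ι EP s e) (h' : X.IsInvariantLift ι EP s' e')
    (hss : ∀ p, s p - s' p ∈ X.K (ι p)) : e = e' := by
  funext z
  obtain ⟨hm, he⟩ := h.represents z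
  obtain ⟨hm', he'⟩ := h'.represents z
  rw [← he, ← he']
  exact (Submodule.Quotient.eq _).2 fun p => hss p.1

theorem contMDiff_of_eventually_section (hι : ContMDiff 𝓘(ℝ, EP) 𝓘(ℝ, EM) ∞ ι)
    {s : ∀ p : P, E (ι p)}
    (h : ∀ p, ∃ a : Cₛ^∞⟮𝓘(ℝ, EM); F, E⟯, ∀ᶠ q in 𝓝 p, a (ι q) = s q) :
    ContMDiff 𝓘(ℝ, EP) (𝓘(ℝ, EM).prod 𝓘(ℝ, F)) ∞ (fun p => TotalSpace.mk' F (ι p) (s p)) := by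
  intro p
  obtain ⟨a, ha⟩ := h p
  refine ((a.contMDiff.comp hι) p).congr_of_eventuallyEq ?_
  filter_upwards [ha] with q hq
  exact congrArg (TotalSpace.mk' F (ι q)) hq.symm

namespace ReductionSetting

theorem contMDiff_ι (H : ReductionSetting X 𝒢 EP ι) : ContMDiff 𝓘(ℝ, EP) 𝓘(ℝ, EM) ∞ ι :=
  fun p => (H.leaf.immersion.isImmersionAt p).contMDiffAt

theorem exists_extension (H : ReductionSetting X 𝒢 EP ι) {s : ∀ p : P, E (ι p)}
    (hs : ContMDiff 𝓘(ℝ, EP) (𝓘(ℝ, EM).prod 𝓘(ℝ, F)) ∞ (fun p => TotalSpace.mk' F (ι p) (s p)))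
    (p : P) : ∃ a : Cₛ^∞⟮𝓘(ℝ, EM); F, E⟯, ∀ᶠ q in 𝓝 p, a (ι q) = s q :=
  exists_section_comp_eventuallyEq (H.leaf.immersion.isImmersionAt p) hs

end ReductionSetting

/-- Local extensions of invariant sections are basic. -/
theorem IsInvariantSection.basicAt {s : ∀ p : P, E (ι p)} (h : X.IsInvariantSection ι EP s) {p : P}
    {a : Cₛ^∞⟮𝓘(ℝ, EM); F, E⟯} (ha : ∀ᶠ q in 𝓝 p, a (ι q) = s q) : X.BasicAt ι a p where
  perp := ha.mono fun q hq => hq ▸ h.mem_Kperp q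
  bracket_eq_zero b := by
    refine CourantAlgebroid.eq_of_pairing_eq (C := C) fun v => ?_
    rw [map_zero, ← neg_eq_zero, ← X.generator_section]
    -- For `g` near `1` the point `g • p` is still where `a` extends `s`. So `⟨g · v, a (g • x)⟩ =
    -- ⟨g · v, g · s p⟩ = ⟨v, s p⟩` is constant in `g`.
    refine dirDeriv_eq_zero_of_eventually_const (c := C.pairing (ι p) v (s p)) ?_ _
    have hcont : ContinuousAt (fun g : G => g • p) 1 :=
      ((contMDiff_id.smul contMDiff_const : ContMDiff 𝓘(ℝ, EG) 𝓘(ℝ, EP) ∞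
        (fun g : G => id g • (fun _ : G => p) g))).continuous.continuousAt
    have ha' : ∀ᶠ q in 𝓝 ((1 : G) • p), a (ι q) = s q := by rwa [one_smul]
    filter_upwards [hcont.eventually ha'] with g hg
    have h1 : TotalSpace.mk' F (g • ι p) (a (g • ι p)) =
        TotalSpace.mk' F (g • ι p) (X.act g (ι p) (s p)) := by
      rw [← h.act_eq g p, ← hg]
      exact congrArg (fun y => TotalSpace.mk' F y (a y)) (map_smul ι g p).symm
    rw [TotalSpace.mk_inj.1 h1, X.act_pairing]

/-- Push-forwards of local extensions of invariant sections are local extensions. -/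
theorem IsInvariantSection.eventually_act {s : ∀ p : P, E (ι p)} (h : X.IsInvariantSection ι EP s)
    {p : P} {a a' : Cₛ^∞⟮𝓘(ℝ, EM); F, E⟯} (ha : ∀ᶠ q in 𝓝 p, a (ι q) = s q) {g : G}
    (ha' : ∀ x, a' (g • x) = X.act g x (a x)) : ∀ᶠ q in 𝓝 (g • p), a' (ι q) = s q := by
  have hcont : ContinuousAt (fun q : P => g⁻¹ • q) (g • p) :=
    (ContMDiffSMul.contMDiff_const_smul (I := 𝓘(ℝ, EG)) (I' := 𝓘(ℝ, EP)) (n := ∞)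
      g⁻¹).continuous.continuousAt
  have ha₁ : ∀ᶠ q in 𝓝 (g⁻¹ • g • p), a (ι q) = s q := by rwa [inv_smul_smul]
  filter_upwards [hcont.eventually ha₁] with q hq
  obtain ⟨q', rfl⟩ : ∃ q', q = g • q' := ⟨g⁻¹ • q, (smul_inv_smul g q).symm⟩
  rw [inv_smul_smul] at hq
  have h1 := h.act_eq g q'
  rw [← hq, ← ha'] at h1
  refine (TotalSpace.mk_inj (F := F)).1 (Eq.trans ?_ h1.symm)
  exact congrArg (fun y => TotalSpace.mk' F y (a' y)) (map_smul ι g q')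

namespace ReductionSetting

/-- The component orthogonal to `K` is equivariant. -/
theorem orthogonal_component_act (H : ReductionSetting X 𝒢 EP ι) (g : G) (p : P) {v c : E (ι p)}
    (hvc : v - c ∈ X.K (ι p)) (hc : ∀ k ∈ X.K (ι p), genMetric C 𝒢 (ι p) c k = 0)
    {y : M} {v' c' : E y} (hv : TotalSpace.mk' F y v' = TotalSpace.mk' F (g • ι p) (X.act g (ι p) v))
    {v'' : E y} (hv'' : v'' - v' ∈ X.K y)
    (hvc' : v'' - c' ∈ X.K y) (hc' : ∀ k ∈ X.K y, genMetric C 𝒢 y c' k = 0) :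
    TotalSpace.mk' F y c' = TotalSpace.mk' F (g • ι p) (X.act g (ι p) c) := by
  have hy : y = g • ι p := congrArg TotalSpace.proj hv
  subst hy
  obtain rfl := TotalSpace.mk_inj.1 hv
  refine congrArg _ (X.orthogonal_component_unique H.metric hv'' hvc' ?_ hc' ?_)
  · rw [← map_sub, H.act_mem_K_iff]
    exact hvc
  · intro k hk
    obtain ⟨k', rfl, -⟩ := X.exists_act_eq g k
    rw [X.genMetric_act H.inv]
    exact hc _ ((H.act_mem_K_iff g).1 hk)

/-- Every section of the reduced algebroid has a lift orthogonal to `K` for `⟨𝒢 u, v⟩`. -/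
theorem exists_orthogonal_lift (H : ReductionSetting X 𝒢 EP ι) {s : ∀ p : P, E (ι p)}
    (hs : X.IsInvariantSection ι EP s) :
    ∃ c : ∀ p : P, E (ι p), X.IsInvariantSection ι EP c ∧ (∀ p, s p - c p ∈ X.K (ι p)) ∧
      ∀ p, ∀ k ∈ X.K (ι p), genMetric C 𝒢 (ι p) (c p) k = 0 := by
  choose c hcK hc using fun p => X.exists_orthogonal_component H.metric (ι p) (s p)
  refine ⟨c, ⟨?_, fun p => ?_, fun g p => ?_⟩, hcK, hc⟩
  · refine contMDiff_of_eventually_section H.contMDiff_ι fun p => ?_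
    obtain ⟨a, ha⟩ := H.exists_extension hs.smooth p
    obtain ⟨t, ht⟩ := H.exists_section_orthogonal_component p a
    refine ⟨t, (ha.and ht).mono fun q hq => ?_⟩
    refine X.orthogonal_component_unique H.metric (v := a (ι q)) (v' := s q) ?_ hq.2.1 (hcK q)
      hq.2.2 (hc q)
    rw [hq.1, sub_self]
    exact Submodule.zero_mem _
  · have := Submodule.sub_mem _ (hs.mem_Kperp p) (H.K_le_Kperp p (hcK p))
    rwa [sub_sub_cancel] at this
  · exact H.orthogonal_component_act g p (hcK p) (hc p) (hs.act_eq g p)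
      (by rw [sub_self]; exact Submodule.zero_mem _) (hcK (g • p)) (hc (g • p))

/-- The bracket of invariant sections is represented, modulo `K`, by an invariant section. -/
theorem exists_bracket_lift (H : ReductionSetting X 𝒢 EP ι) {s₁ s₂ : ∀ p : P, E (ι p)}
    (h₁ : X.IsInvariantSection ι EP s₁) (h₂ : X.IsInvariantSection ι EP s₂) :
    ∃ c : ∀ p : P, E (ι p), X.IsInvariantSection ι EP c ∧
      ∀ p, ∃ a₁ a₂ : Cₛ^∞⟮𝓘(ℝ, EM); F, E⟯, (∀ᶠ q in 𝓝 p, a₁ (ι q) = s₁ q) ∧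
        (∀ᶠ q in 𝓝 p, a₂ (ι q) = s₂ q) ∧ C.bracket a₁ a₂ (ι p) - c p ∈ X.K (ι p) := by
  choose a₁ ha₁ using H.exists_extension h₁.smooth
  choose a₂ ha₂ using H.exists_extension h₂.smooth
  choose c hcK hc using fun p =>
    X.exists_orthogonal_component H.metric (ι p) (C.bracket (a₁ p) (a₂ p) (ι p))
  -- Modulo `K` the bracket does not see the choice of extensions, so its component orthogonal to
  -- `K` is canonical. Smoothness and equivariance of `c` both follow from this.
  have hindep : ∀ (p : P) (b₁ b₂ : Cₛ^∞⟮𝓘(ℝ, EM); F, E⟯), (∀ᶠ q in 𝓝 p, b₁ (ι q) = s₁ q) →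
      (∀ᶠ q in 𝓝 p, b₂ (ι q) = s₂ q) →
      C.bracket (a₁ p) (a₂ p) (ι p) - C.bracket b₁ b₂ (ι p) ∈ X.K (ι p) := by
    intro p b₁ b₂ hb₁ hb₂
    refine H.bracket_sub_bracket_mem_K (h₁.basicAt hb₁) (h₂.basicAt (ha₂ p)) ?_ ?_
    · filter_upwards [hb₁, ha₁ p] with q hq hq'
      rw [hq, hq', sub_self]
      exact Submodule.zero_mem _
    · filter_upwards [hb₂, ha₂ p] with q hq hq'
      rw [hq, hq', sub_self]
      exact Submodule.zero_mem _
  refine ⟨c, ⟨?_, fun p => ?_, fun g p => ?_⟩, fun p => ⟨a₁ p, a₂ p, ha₁ p, ha₂ p, hcK p⟩⟩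
  · refine contMDiff_of_eventually_section H.contMDiff_ι fun p => ?_
    obtain ⟨t, ht⟩ := H.exists_section_orthogonal_component p (C.bracket (a₁ p) (a₂ p))
    refine ⟨t, ?_⟩
    -- The extensions chosen at `p` also serve as extensions at every nearby `q`.
    filter_upwards [ht, (ha₁ p).eventually_nhds, (ha₂ p).eventually_nhds] with q hq hq₁ hq₂
    exact (X.orthogonal_component_unique H.metric (hindep q _ _ hq₁ hq₂) (hcK q) hq.1 (hc q)
      hq.2).symm
  · have h1 := H.bracket_mem_Kperp (h₁.basicAt (ha₁ p)) (h₂.basicAt (ha₂ p)).perp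
    have := Submodule.sub_mem _ h1 (H.K_le_Kperp p (hcK p))
    rwa [sub_sub_cancel] at this
  -- Push-forwards of extensions at `p` are extensions at `g • p`, and `G` preserves the bracket.
  · obtain ⟨b₁, hb₁⟩ := exists_section_act (X := X) g (a₁ p)
    obtain ⟨b₂, hb₂⟩ := exists_section_act (X := X) g (a₂ p)
    have hb := X.act_bracket g _ _ _ _ hb₁ hb₂ (ι p)
    refine H.orthogonal_component_act g p (hcK p) (hc p) (v' := C.bracket b₁ b₂ (ι (g • p))) ?_
      (hindep (g • p) b₁ b₂ (h₁.eventually_act (ha₁ p) hb₁) (h₂.eventually_act (ha₂ p) hb₂))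
      (hcK (g • p)) (hc (g • p))
    rw [← hb]
    exact congrArg (fun y => TotalSpace.mk' F y (C.bracket b₁ b₂ y)) (map_smul ι g p)

theorem existsUnique_reducedBracket (H : ReductionSetting X 𝒢 EP ι) :
    ∃! br, X.IsReducedBracket ι EP br := by
  have hlift : ∀ e : X.RedSections ι EP, ∃ s, X.IsInvariantLift ι EP s e.1 := fun e => e.2
  choose s hs using hlift
  choose c hc hcb using fun e₁ e₂ : X.RedSections ι EP =>
    H.exists_bracket_lift (hs e₁).isInvariantSection (hs e₂).isInvariantSection
  refine ⟨fun e₁ e₂ => ⟨_, c e₁ e₂, (hc e₁ e₂).isInvariantLift⟩, ?_, fun br hbr => ?_⟩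
  · intro e₁ e₂ s₁ s₂ s₃ h₁ h₂ h₃ p a₁ a₂ ha₁ ha₂
    obtain ⟨b₁, b₂, hb₁, hb₂, hb⟩ := hcb e₁ e₂ p
    have hK : C.bracket a₁ a₂ (ι p) - s₃ p ∈ X.K (ι p) := by
      have h4 : C.bracket a₁ a₂ (ι p) - C.bracket b₁ b₂ (ι p) ∈ X.K (ι p) := by
        refine H.bracket_sub_bracket_mem_K ((hs e₁).isInvariantSection.basicAt hb₁)
          (h₂.isInvariantSection.basicAt ha₂) ?_ ?_
        · filter_upwards [ha₁, hb₁] with q hq hq'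
          rw [hq, hq']
          exact h₁.sub_mem_K (hs e₁) q
        · filter_upwards [ha₂, hb₂] with q hq hq'
          rw [hq, hq']
          exact h₂.sub_mem_K (hs e₂) q
      have h5 := ((hc e₁ e₂).isInvariantLift).sub_mem_K h₃ p
      have h6 := Submodule.add_mem _ (Submodule.add_mem _ h4 hb) h5
      rwa [sub_add_sub_cancel, sub_add_sub_cancel] at h6
    exact ⟨hK, H.K_le_Kperp p hK⟩
  · funext e₁ e₂
    -- Any lift of `br e₁ e₂` and the constructed lift both agree with the same bracket on `M`
    -- modulo `K`, hence with each other.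
    obtain ⟨s₃, hs₃⟩ := (br e₁ e₂).2
    refine Subtype.ext (hs₃.eq_of_sub_mem_K (hc e₁ e₂).isInvariantLift fun p => ?_)
    obtain ⟨b₁, b₂, hb₁, hb₂, hb⟩ := hcb e₁ e₂ p
    have h1 := (hbr e₁ e₂ _ _ s₃ (hs e₁) (hs e₂) hs₃ p b₁ b₂ hb₁ hb₂).1
    have := Submodule.sub_mem _ hb h1
    rwa [sub_sub_sub_cancel_left] at this

end ReductionSetting

end ExtendedAction

end Existence

/-! ### Horizontal families and reduction of the generalized metric -/

section KTReduction

section Linear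

variable {B : Type*} {V : B → Type*} [∀ b, AddCommGroup (V b)] [∀ b, Module ℝ (V b)]
  {𝒢 : ∀ b, Module.End ℝ (V b)} {ℐ : ∀ b, Vplus 𝒢 b →ₗ[ℝ] Vplus 𝒢 b}

/-- When `ℐ² = -1` the second eigenvector equation is redundant, so `L` is the graph of `-ℐ`, that
is, the vectors `u - i ℐ u`. -/
theorem mem_plusIEigenspace_iff (hℐ : ∀ b u, ℐ b (ℐ b u) = -u) {b : B} {u v : V b} :
    (u, v) ∈ plusIEigenspace 𝒢 ℐ b ↔ ∃ h : u ∈ Vplus 𝒢 b, v = -(ℐ b ⟨u, h⟩ : V b) := by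
  constructor
  · rintro ⟨h₁, h₂, h, -⟩
    refine ⟨h₁, ?_⟩
    have h3 : (ℐ b ⟨u, h₁⟩ : V b) = -v := congrArg Subtype.val h
    rw [h3, neg_neg]
  · rintro ⟨h, rfl⟩
    refine ⟨h, Submodule.neg_mem _ (ℐ b ⟨u, h⟩).2, Subtype.ext (neg_neg _).symm, ?_⟩
    change ℐ b (-(ℐ b ⟨u, h⟩)) = _
    rw [map_neg, hℐ, neg_neg]

/-- The projection to the `+1`-eigenspace of an involution. -/
def plusProj (h : ∀ b u, 𝒢 b (𝒢 b u) = u) (b : B) : V b →ₗ[ℝ] Vplus 𝒢 b :=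
  LinearMap.codRestrict _ ((1 / 2 : ℝ) • (LinearMap.id + 𝒢 b)) fun u => by
    rw [Module.End.mem_eigenspace_iff, one_smul]
    simp only [LinearMap.smul_apply, LinearMap.add_apply, LinearMap.id_apply, map_smul, map_add, h]
    rw [add_comm]

theorem plusProj_apply (h : ∀ b u, 𝒢 b (𝒢 b u) = u) (b : B) (u : V b) :
    (plusProj h b u : V b) = (1 / 2 : ℝ) • (u + 𝒢 b u) := rfl

theorem plusProj_of_mem (h : ∀ b u, 𝒢 b (𝒢 b u) = u) {b : B} {u : V b} (hu : u ∈ Vplus 𝒢 b) :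
    plusProj h b u = ⟨u, hu⟩ := by
  refine Subtype.ext ?_
  rw [plusProj_apply]
  rw [Module.End.mem_eigenspace_iff, one_smul] at hu
  rw [hu, ← two_smul ℝ, smul_smul]
  norm_num

end Linear

variable {EM : Type*} [NormedAddCommGroup EM] [NormedSpace ℝ EM] [FiniteDimensional ℝ EM]
  {M : Type*} [TopologicalSpace M] [ChartedSpace EM M] [IsManifold 𝓘(ℝ, EM) ∞ M] [T2Space M]
  {F : Type*} [NormedAddCommGroup F] [NormedSpace ℝ F] [FiniteDimensional ℝ F]
  {E : M → Type*} [TopologicalSpace (TotalSpace F E)] [∀ x, AddCommGroup (E x)]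
  [∀ x, Module ℝ (E x)] [∀ x, TopologicalSpace (E x)] [FiberBundle F E] [VectorBundle ℝ F E]
  [ContMDiffVectorBundle ∞ F E 𝓘(ℝ, EM)]
  {EG : Type*} [NormedAddCommGroup EG] [NormedSpace ℝ EG] [FiniteDimensional ℝ EG]
  {G : Type*} [TopologicalSpace G] [ChartedSpace EG G] [Group G] [LieGroup 𝓘(ℝ, EG) ∞ G]
  [MulAction G M] [ContMDiffSMul 𝓘(ℝ, EG) 𝓘(ℝ, EM) ∞ G M]
  {𝔞 : Type*} [AddCommGroup 𝔞] [Module ℝ 𝔞]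
  {C : CourantAlgebroid EM F E} {𝒜 : CourantAlgebra 𝔞 (GroupLieAlgebra 𝓘(ℝ, EG) G)}
  (X : ExtendedAction C 𝒜) {𝒢 : ∀ x, Module.End ℝ (E x)}

variable {EP : Type*} [NormedAddCommGroup EP] [NormedSpace ℝ EP] [FiniteDimensional ℝ EP]
  {P : Type*} [TopologicalSpace P] [ChartedSpace EP P] [IsManifold 𝓘(ℝ, EP) ∞ P]
  [MulAction G P] [ContMDiffSMul 𝓘(ℝ, EG) 𝓘(ℝ, EP) ∞ G P] [IsCancelSMul G P] {ι : P →[G] M}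
  [ConnectedSpace G]

namespace ExtendedAction

variable (𝒢) in
/-- The distribution `K^⊥ ∩ 𝒢 K^⊥`, a `𝒢`-invariant complement of `K` in `K^⊥`. -/
def horizontal (x : M) : Submodule ℝ (E x) := X.Kperp x ⊓ (X.Kperp x).comap (𝒢 x)

variable (𝒢 ι) in
/-- The invariant families with values in `K^⊥ ∩ 𝒢 K^⊥`. -/
def horizontalFamilies (z : MulAction.orbitRel.Quotient G P) : Submodule ℝ (X.invKperp ι z) where
  carrier := {s | ∀ p, s.1 p ∈ X.horizontal 𝒢 (ι p.1)}
  zero_mem' := fun _ => Submodule.zero_mem _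
  add_mem' := fun hs ht p => Submodule.add_mem _ (hs p) (ht p)
  smul_mem' := fun _ _ hs p => Submodule.smul_mem _ _ (hs p)

variable (𝒢 ι) in
/-- A smooth equivariant endomorphism that preserves `K^⊥ ∩ 𝒢 K^⊥` over `P`. -/
structure IsReducibleEnd (T : ∀ x, Module.End ℝ (E x)) : Prop where
  smooth : ∀ s : Cₛ^∞⟮𝓘(ℝ, EM); F, E⟯, ∃ t : Cₛ^∞⟮𝓘(ℝ, EM); F, E⟯, ∀ x, t x = T x (s x)
  act : ∀ (g : G) (x : M) (v : E x), T (g • x) (X.act g x v) = X.act g x (T x v)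
  mem : ∀ p, ∀ v ∈ X.horizontal 𝒢 (ι p), T (ι p) v ∈ X.horizontal 𝒢 (ι p)

variable {X}

theorem mem_horizontal_of_genMetric {x : M} {v : E x} (hv : v ∈ X.Kperp x)
    (h : ∀ k ∈ X.K x, genMetric C 𝒢 x v k = 0) : v ∈ X.horizontal 𝒢 x :=
  ⟨hv, fun k hk => (C.pairing_symm _ _ _).trans (h k hk)⟩

/-- This makes `V_± ∩ K^⊥` horizontal, so these vectors are determined by their classes modulo `K`.
-/
theorem mem_horizontal_of_mem_eigenspace {x : M} {v : E x} (hv : v ∈ X.Kperp x) {c : ℝ}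
    (h : v ∈ Module.End.eigenspace (𝒢 x) c) : v ∈ X.horizontal 𝒢 x := by
  refine ⟨hv, ?_⟩
  change 𝒢 x v ∈ X.Kperp x
  rw [Module.End.mem_eigenspace_iff.1 h]
  exact Submodule.smul_mem _ _ hv

/-- Equality in the total space is compatible with an equivariant family of endomorphisms. -/
theorem mk_end_eq_act {T : ∀ x, Module.End ℝ (E x)}
    (hT : ∀ (g : G) (x : M) (v : E x), T (g • x) (X.act g x v) = X.act g x (T x v)) {g : G}
    {x y : M} {v : E x} {w : E y}
    (h : TotalSpace.mk' F y w = TotalSpace.mk' F (g • x) (X.act g x v)) :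
    TotalSpace.mk' F y (T y w) = TotalSpace.mk' F (g • x) (X.act g x (T x v)) := by
  have hy : y = g • x := congrArg TotalSpace.proj h
  subst hy
  rw [TotalSpace.mk_inj.1 h, hT]

theorem mem_eigenspace_of_mk_eq_act
    (hT : ∀ (g : G) (x : M) (v : E x), 𝒢 (g • x) (X.act g x v) = X.act g x (𝒢 x v)) {g : G}
    {x y : M} {v : E x} {w : E y} {c : ℝ}
    (h : TotalSpace.mk' F y w = TotalSpace.mk' F (g • x) (X.act g x v))
    (hv : v ∈ Module.End.eigenspace (𝒢 x) c) : w ∈ Module.End.eigenspace (𝒢 y) c := by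
  have hy : y = g • x := congrArg TotalSpace.proj h
  subst hy
  rw [Module.End.mem_eigenspace_iff] at hv ⊢
  rw [TotalSpace.mk_inj.1 h, hT, hv, map_smul]

theorem redPairing_redProj {z : MulAction.orbitRel.Quotient G P} (s t : X.invKperp ι z) :
    X.redPairing ι z (X.redProj ι z s) (X.redProj ι z t) =
      C.pairing (ι (basePoint z).1) (s.1 (basePoint z)) (t.1 (basePoint z)) := rfl

/-- An invariant family is determined by one value. This transfers positivity at the chosen base
point to the reduced fibre. -/
theorem eq_zero_of_basePoint {z : MulAction.orbitRel.Quotient G P} {s : X.invKperp ι z}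
    (hs : s.1 (basePoint z) = 0) : s = 0 := by
  refine Subtype.ext (funext fun q => ?_)
  obtain ⟨g, hg⟩ := Quotient.exact (q.2.trans (basePoint z).2.symm)
  have h1 := s.2.2 g (basePoint z) q hg.symm
  rw [hs, map_zero] at h1
  have h2 : ∀ {x y : M} {v : E x}, TotalSpace.mk' F x v = TotalSpace.mk' F y 0 → v = 0 := by
    intro x y v h
    have hy : x = y := congrArg TotalSpace.proj h
    subst hy
    exact TotalSpace.mk_inj.1 h
  exact h2 h1

/-- Apply an equivariant family of endomorphisms to an invariant family. -/
theorem IsReducibleEnd.mem_invKperp {T : ∀ x, Module.End ℝ (E x)} (hT : X.IsReducibleEnd 𝒢 ι T)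
    {z : MulAction.orbitRel.Quotient G P} {s : X.invKperp ι z}
    (hs : s ∈ X.horizontalFamilies 𝒢 ι z) :
    (fun p : OrbitPoints z => T (ι p.1) (s.1 p)) ∈ X.invKperp ι z :=
  ⟨fun p => (hT.mem p.1 _ (hs p)).1, fun g p p' h => mk_end_eq_act hT.act (s.2.2 g p p' h)⟩

variable (ι) in
/-- The endomorphism of the horizontal invariant families induced by `T`. -/
def IsReducibleEnd.familyEnd {T : ∀ x, Module.End ℝ (E x)} (hT : X.IsReducibleEnd 𝒢 ι T)
    (z : MulAction.orbitRel.Quotient G P) : Module.End ℝ (X.horizontalFamilies 𝒢 ι z) where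
  toFun s := ⟨⟨_, hT.mem_invKperp s.2⟩, fun p => hT.mem p.1 _ (s.2 p)⟩
  map_add' _ _ := Subtype.ext (Subtype.ext (funext fun p => map_add (T (ι p.1)) _ _))
  map_smul' _ _ := Subtype.ext (Subtype.ext (funext fun p => map_smul (T (ι p.1)) _ _))

/-- A vector of `K^⊥` extends to an invariant family along its orbit. -/
theorem exists_invKperp_eq (hK : ∀ (g : G) (p : P) (v : E (ι p)), v ∈ X.Kperp (ι p) →
    X.act g (ι p) v ∈ X.Kperp (g • ι p)) (p : P) {v : E (ι p)} (hv : v ∈ X.Kperp (ι p)) :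
    ∃ s : X.invKperp ι (Quotient.mk _ p), s.1 ⟨p, rfl⟩ = v ∧
      ∀ q, ∃ g : G, TotalSpace.mk' F (ι q.1) (s.1 q) =
        TotalSpace.mk' F (g • ι p) (X.act g (ι p) v) := by
  have hg : ∀ q : OrbitPoints (Quotient.mk (MulAction.orbitRel G P) p), ∃ g : G, g • p = q.1 :=
    fun q => Quotient.exact q.2
  choose γ hγ using hg
  have hex : ∀ q : OrbitPoints (Quotient.mk (MulAction.orbitRel G P) p), ∃ u : E (ι q.1),
      TotalSpace.mk' F (ι q.1) u = X.actTotal (γ q) (TotalSpace.mk' F (ι p) v) := by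
    intro q
    have h1 : ι q.1 = γ q • ι p := by rw [← hγ, map_smul]
    rw [h1]
    exact ⟨_, rfl⟩
  choose u hu using hex
  have hmem : ∀ {x y : M} {a : E x} {b : E y}, TotalSpace.mk' F x a = TotalSpace.mk' F y b →
      b ∈ X.Kperp y → a ∈ X.Kperp x := by
    intro x y a b h hb
    have hy : x = y := congrArg TotalSpace.proj h
    subst hy
    rwa [TotalSpace.mk_inj.1 h]
  refine ⟨⟨u, fun q => hmem (hu q) (hK _ _ _ hv), fun g q q' h => ?_⟩, ?_, fun q => ⟨γ q, hu q⟩⟩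
  -- Freeness makes the group element that carries `p` to `q` unique, whence this cocycle identity.
  · have h1 : γ q' = g * γ q := by
      refine IsCancelSMul.right_cancel _ _ p ?_
      rw [mul_smul, hγ, hγ, h]
    rw [hu, h1, X.actTotal_mul, ← hu]
    rfl
  · have h1 : γ ⟨p, rfl⟩ = 1 := by
      refine IsCancelSMul.right_cancel _ _ p ?_
      rw [hγ, one_smul]
    have h2 := hu ⟨p, rfl⟩
    rw [h1, X.actTotal_one] at h2
    exact TotalSpace.mk_inj.1 h2

namespace ReductionSetting

theorem eq_zero_of_mem_K_of_mem_horizontal (H : ReductionSetting X 𝒢 EP ι) {x : M} {v : E x}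
    (h : v ∈ X.K x) (h' : v ∈ X.horizontal 𝒢 x) : v = 0 :=
  eq_zero_of_genMetric_self H.metric ((C.pairing_symm _ _ _).trans (h'.2 v h))

/-- Horizontal vectors meet `K` only in `0` by positivity, and orthogonal projection off `K` sends
an invariant family to a horizontal one in the same class. -/
theorem horizontalFamilies_bijective (H : ReductionSetting X 𝒢 EP ι)
    (z : MulAction.orbitRel.Quotient G P) :
    Function.Bijective ((X.redProj ι z).comp (X.horizontalFamilies 𝒢 ι z).subtype) := by
  constructor
  · refine (injective_iff_map_eq_zero _).2 fun s hs => ?_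
    have h1 : (s : X.invKperp ι z) ∈ X.invK ι z := (Submodule.Quotient.mk_eq_zero _).1 hs
    exact Subtype.ext (Subtype.ext (funext fun p =>
      H.eq_zero_of_mem_K_of_mem_horizontal (h1 p) (s.2 p)))
  · intro u
    obtain ⟨s, rfl⟩ := (X.invK ι z).mkQ_surjective u
    choose c hcK hc using fun p : OrbitPoints z =>
      X.exists_orthogonal_component H.metric (ι p.1) (s.1 p)
    have hperp : ∀ p, c p ∈ X.Kperp (ι p.1) := fun p => by
      have := Submodule.sub_mem _ (s.2.1 p) (H.K_le_Kperp p.1 (hcK p))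
      rwa [sub_sub_cancel] at this
    refine ⟨⟨⟨c, hperp, fun g p p' h => ?_⟩, fun p =>
      mem_horizontal_of_genMetric (hperp p) (hc p)⟩, ?_⟩
    · exact H.orthogonal_component_act g p.1 (hcK p) (hc p) (s.2.2 g p p' h)
        (by rw [sub_self]; exact Submodule.zero_mem _) (hcK p') (hc p')
    · refine (Submodule.Quotient.eq _).2 fun p => ?_
      have := Submodule.neg_mem _ (hcK p)
      rwa [neg_sub] at this

/-- The reduced fibre is the space of horizontal invariant families. -/
def horizontalEquiv (H : ReductionSetting X 𝒢 EP ι) (z : MulAction.orbitRel.Quotient G P) :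
    X.horizontalFamilies 𝒢 ι z ≃ₗ[ℝ] X.Ered ι z :=
  LinearEquiv.ofBijective _ (H.horizontalFamilies_bijective z)

theorem exists_horizontal (H : ReductionSetting X 𝒢 EP ι) {z : MulAction.orbitRel.Quotient G P}
    (u : X.Ered ι z) : ∃ s ∈ X.horizontalFamilies 𝒢 ι z, X.redProj ι z s = u := by
  obtain ⟨s, hs⟩ := (H.horizontalEquiv z).surjective u
  exact ⟨s, s.2, hs⟩

theorem eq_of_redProj_eq (H : ReductionSetting X 𝒢 EP ι) {z : MulAction.orbitRel.Quotient G P}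
    {s t : X.invKperp ι z} (hs : s ∈ X.horizontalFamilies 𝒢 ι z)
    (ht : t ∈ X.horizontalFamilies 𝒢 ι z) (h : X.redProj ι z s = X.redProj ι z t) : s = t :=
  congrArg Subtype.val ((H.horizontalEquiv z).injective (a₁ := ⟨s, hs⟩) (a₂ := ⟨t, ht⟩) h)

/-- The endomorphism of the reduced algebroid induced by `T`. -/
def redEnd (H : ReductionSetting X 𝒢 EP ι) {T : ∀ x, Module.End ℝ (E x)}
    (hT : X.IsReducibleEnd 𝒢 ι T) (z : MulAction.orbitRel.Quotient G P) :
    Module.End ℝ (X.Ered ι z) := (H.horizontalEquiv z).conj (hT.familyEnd ι z)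

theorem redEnd_redProj (H : ReductionSetting X 𝒢 EP ι) {T : ∀ x, Module.End ℝ (E x)}
    (hT : X.IsReducibleEnd 𝒢 ι T) {z : MulAction.orbitRel.Quotient G P} {s : X.invKperp ι z}
    (hs : s ∈ X.horizontalFamilies 𝒢 ι z) :
    H.redEnd hT z (X.redProj ι z s) = X.redProj ι z ⟨_, hT.mem_invKperp hs⟩ := by
  have h1 : X.redProj ι z s = H.horizontalEquiv z ⟨s, hs⟩ := rfl
  rw [h1, redEnd, LinearEquiv.conj_apply_apply, LinearEquiv.symm_apply_apply]
  rfl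

theorem exists_horizontal_lift (H : ReductionSetting X 𝒢 EP ι) (e : X.RedSections ι EP) :
    ∃ s, X.IsInvariantLift ι EP s e.1 ∧ ∀ p, s p ∈ X.horizontal 𝒢 (ι p) := by
  obtain ⟨s, hs⟩ := e.2
  obtain ⟨c, hc, hsc, hcK⟩ := H.exists_orthogonal_lift hs.isInvariantSection
  have h1 := hs.eq_of_sub_mem_K hc.isInvariantLift hsc
  exact ⟨c, h1 ▸ hc.isInvariantLift, fun p => mem_horizontal_of_genMetric (hc.mem_Kperp p) (hcK p)⟩

theorem isInvariantLift_redEnd (H : ReductionSetting X 𝒢 EP ι) {T : ∀ x, Module.End ℝ (E x)}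
    (hT : X.IsReducibleEnd 𝒢 ι T) {s : ∀ p : P, E (ι p)} {e : ∀ z, X.Ered ι z}
    (hs : X.IsInvariantLift ι EP s e) (hs' : ∀ p, s p ∈ X.horizontal 𝒢 (ι p)) :
    X.IsInvariantLift ι EP (fun p => T (ι p) (s p)) fun z => H.redEnd hT z (e z) where
  smooth := by
    refine contMDiff_of_eventually_section H.contMDiff_ι fun p => ?_
    obtain ⟨a, ha⟩ := H.exists_extension hs.smooth p
    obtain ⟨b, hb⟩ := hT.smooth a
    exact ⟨b, ha.mono fun q hq => by rw [hb, hq]⟩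
  represents z := by
    obtain ⟨hm, he⟩ := hs.represents z
    have h1 : (⟨_, hm⟩ : X.invKperp ι z) ∈ X.horizontalFamilies 𝒢 ι z := fun p => hs' p.1
    refine ⟨hT.mem_invKperp h1, ?_⟩
    rw [← he, H.redEnd_redProj hT h1]

theorem exists_redSection_redEnd (H : ReductionSetting X 𝒢 EP ι) {T : ∀ x, Module.End ℝ (E x)}
    (hT : X.IsReducibleEnd 𝒢 ι T) (e : X.RedSections ι EP) :
    ∃ e' : X.RedSections ι EP, ∀ z, e'.1 z = H.redEnd hT z (e.1 z) := by
  obtain ⟨s, hs, hs'⟩ := H.exists_horizontal_lift e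
  exact ⟨⟨_, _, H.isInvariantLift_redEnd hT hs hs'⟩, fun z => rfl⟩

theorem isReducibleEnd_metric (H : ReductionSetting X 𝒢 EP ι) : X.IsReducibleEnd 𝒢 ι 𝒢 where
  smooth := exists_section_𝒢 H.metric
  act := H.inv
  mem p v hv := by
    refine ⟨hv.2, ?_⟩
    change 𝒢 (ι p) (𝒢 (ι p) v) ∈ X.Kperp (ι p)
    rw [𝒢_𝒢 H.metric]
    exact hv.1

/-- The reduced generalized metric. -/
def redMetric (H : ReductionSetting X 𝒢 EP ι) (z : MulAction.orbitRel.Quotient G P) :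
    Module.End ℝ (X.Ered ι z) := H.redEnd H.isReducibleEnd_metric z

theorem redProj_mem_eigenspace_iff (H : ReductionSetting X 𝒢 EP ι)
    {z : MulAction.orbitRel.Quotient G P} {s : X.invKperp ι z}
    (hs : s ∈ X.horizontalFamilies 𝒢 ι z) {c : ℝ} :
    X.redProj ι z s ∈ Module.End.eigenspace (H.redMetric z) c ↔
      ∀ p, s.1 p ∈ Module.End.eigenspace (𝒢 (ι p.1)) c := by
  rw [Module.End.mem_eigenspace_iff, redMetric, H.redEnd_redProj _ hs, ← map_smul]
  constructor
  · intro h p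
    have h1 := H.eq_of_redProj_eq (fun p => H.isReducibleEnd_metric.mem p.1 _ (hs p))
      (Submodule.smul_mem _ c hs) h
    rw [Module.End.mem_eigenspace_iff]
    exact congrFun (congrArg Subtype.val h1) p
  · intro h
    refine congrArg _ (Subtype.ext (funext fun p => ?_))
    exact Module.End.mem_eigenspace_iff.1 (h p)

theorem mem_eigenspace_redMetric_iff (H : ReductionSetting X 𝒢 EP ι)
    {z : MulAction.orbitRel.Quotient G P} {u : X.Ered ι z} {c : ℝ} :
    u ∈ Module.End.eigenspace (H.redMetric z) c ↔
      ∃ s : X.invKperp ι z, (∀ p : OrbitPoints z, s.1 p ∈ Module.End.eigenspace (𝒢 (ι p.1)) c) ∧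
        X.redProj ι z s = u := by
  constructor
  · intro hu
    obtain ⟨s, hs, rfl⟩ := H.exists_horizontal u
    exact ⟨s, (H.redProj_mem_eigenspace_iff hs).1 hu, rfl⟩
  · rintro ⟨s, hs, rfl⟩
    exact (H.redProj_mem_eigenspace_iff
      fun p => mem_horizontal_of_mem_eigenspace (s.2.1 p) (hs p)).2 hs

/-- On horizontal representatives the reduced operator is `𝒢` itself and the reduced pairing is that
of `E`, so each axiom is inherited. -/
theorem isGeneralizedMetric_redMetric (H : ReductionSetting X 𝒢 EP ι)
    (br : X.RedSections ι EP → X.RedSections ι EP → X.RedSections ι EP) :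
    IsGeneralizedMetric (X.reducedBundle ι EP br) H.redMetric where
  smooth := H.exists_redSection_redEnd H.isReducibleEnd_metric
  orthogonal z u v := by
    obtain ⟨s, hs, rfl⟩ := H.exists_horizontal u
    obtain ⟨t, ht, rfl⟩ := H.exists_horizontal v
    rw [redMetric, H.redEnd_redProj _ hs, H.redEnd_redProj _ ht]
    exact pairing_𝒢_𝒢 H.metric _ _ _
  selfAdjoint z u v := by
    obtain ⟨s, hs, rfl⟩ := H.exists_horizontal u
    obtain ⟨t, ht, rfl⟩ := H.exists_horizontal v
    rw [redMetric, H.redEnd_redProj _ hs, H.redEnd_redProj _ ht]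
    exact pairing_𝒢_left H.metric _ _ _
  pos z u hu := by
    obtain ⟨s, hs, rfl⟩ := H.exists_horizontal u
    rw [redMetric, H.redEnd_redProj _ hs]
    refine genMetric_self_pos H.metric _ fun h => hu ?_
    rw [eq_zero_of_basePoint h, map_zero]

end ReductionSetting

end ExtendedAction

end KTReduction

/-! ### Reduction of the complex structure, and the equivalence -/

section MainTheorem

section Linear

variable {B : Type*} {V : B → Type*} [∀ b, AddCommGroup (V b)] [∀ b, Module ℝ (V b)]
  {𝒢 : ∀ b, Module.End ℝ (V b)}

/-- The extension of an endomorphism of `V₊` by zero on `V₋`. -/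
def extendPlus (h : ∀ b u, 𝒢 b (𝒢 b u) = u) (ℐ : ∀ b, Vplus 𝒢 b →ₗ[ℝ] Vplus 𝒢 b) (b : B) :
    Module.End ℝ (V b) := (Vplus 𝒢 b).subtype ∘ₗ ℐ b ∘ₗ plusProj h b

theorem extendPlus_mem (h : ∀ b u, 𝒢 b (𝒢 b u) = u) (ℐ : ∀ b, Vplus 𝒢 b →ₗ[ℝ] Vplus 𝒢 b) (b : B)
    (u : V b) : extendPlus h ℐ b u ∈ Vplus 𝒢 b := (ℐ b (plusProj h b u)).2

theorem extendPlus_of_mem (h : ∀ b u, 𝒢 b (𝒢 b u) = u) (ℐ : ∀ b, Vplus 𝒢 b →ₗ[ℝ] Vplus 𝒢 b)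
    {b : B} {u : V b} (hu : u ∈ Vplus 𝒢 b) : extendPlus h ℐ b u = ℐ b ⟨u, hu⟩ :=
  congrArg (fun w => (ℐ b w : V b)) (plusProj_of_mem h hu)

end Linear

variable {EM : Type*} [NormedAddCommGroup EM] [NormedSpace ℝ EM] [FiniteDimensional ℝ EM]
  {M : Type*} [TopologicalSpace M] [ChartedSpace EM M] [IsManifold 𝓘(ℝ, EM) ∞ M] [T2Space M]
  {F : Type*} [NormedAddCommGroup F] [NormedSpace ℝ F] [FiniteDimensional ℝ F]
  {E : M → Type*} [TopologicalSpace (TotalSpace F E)] [∀ x, AddCommGroup (E x)]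
  [∀ x, Module ℝ (E x)] [∀ x, TopologicalSpace (E x)] [FiberBundle F E] [VectorBundle ℝ F E]
  [ContMDiffVectorBundle ∞ F E 𝓘(ℝ, EM)]
  {EG : Type*} [NormedAddCommGroup EG] [NormedSpace ℝ EG] [FiniteDimensional ℝ EG]
  {G : Type*} [TopologicalSpace G] [ChartedSpace EG G] [Group G] [LieGroup 𝓘(ℝ, EG) ∞ G]
  [MulAction G M] [ContMDiffSMul 𝓘(ℝ, EG) 𝓘(ℝ, EM) ∞ G M]
  {𝔞 : Type*} [AddCommGroup 𝔞] [Module ℝ 𝔞]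
  {C : CourantAlgebroid EM F E} {𝒜 : CourantAlgebra 𝔞 (GroupLieAlgebra 𝓘(ℝ, EG) G)}
  (X : ExtendedAction C 𝒜) {𝒢 : ∀ x, Module.End ℝ (E x)}

  {ℐ : ∀ x, Vplus 𝒢 x →ₗ[ℝ] Vplus 𝒢 x}

variable {EP : Type*} [NormedAddCommGroup EP] [NormedSpace ℝ EP] [FiniteDimensional ℝ EP]
  {P : Type*} [TopologicalSpace P] [ChartedSpace EP P] [IsManifold 𝓘(ℝ, EP) ∞ P]
  [MulAction G P] [ContMDiffSMul 𝓘(ℝ, EG) 𝓘(ℝ, EP) ∞ G P] [IsCancelSMul G P] {ι : P →[G] M}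
  [ConnectedSpace G]

theorem exists_section_plusProj (h𝒢 : IsGeneralizedMetric C.toBracketedBundle 𝒢)
    (s : Cₛ^∞⟮𝓘(ℝ, EM); F, E⟯) :
    ∃ t : Cₛ^∞⟮𝓘(ℝ, EM); F, E⟯, ∀ x, t x = plusProj (𝒢_𝒢 h𝒢) x (s x) := by
  obtain ⟨t, ht⟩ := exists_section_𝒢 h𝒢 s
  refine ⟨(1 / 2 : ℝ) • (s + t), fun x => ?_⟩
  rw [plusProj_apply, ← ht]
  rfl

namespace ExtendedAction

variable {X}

/-- The converse part of the reduction theorem: if the structure reduces, then `ℐ` preserves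
`K^⊥ ∩ V₊`. -/
theorem ReductionSetting.mem_Kperp_of_reduces (H : ReductionSetting X 𝒢 EP ι)
    (hKT : IsStrongKT C.toBracketedBundle 𝒢 ℐ)
    {br : X.RedSections ι EP → X.RedSections ι EP → X.RedSections ι EP}
    (hred : X.Reduces ι EP br 𝒢 ℐ) (p : P) (v : Vplus 𝒢 (ι p)) (hv : (v : E (ι p)) ∈ X.Kperp (ι p)) :
    (ℐ (ι p) v : E (ι p)) ∈ X.Kperp (ι p) := by
  obtain ⟨𝒢r, ℐr, hr, hplus, -, hL⟩ := hred
  obtain ⟨s, hsp, hs⟩ := exists_invKperp_eq (fun g p v => (H.act_mem_Kperp_iff g).2) p hv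
  have hsV : ∀ q, s.1 q ∈ Vplus 𝒢 (ι q.1) := fun q => by
    obtain ⟨g, hg⟩ := hs q
    exact mem_eigenspace_of_mk_eq_act H.inv hg v.2
  have hu := (hplus _ _).2 ⟨s, hsV, rfl⟩
  -- With `u` the class of `s`, the vector `u - i ℐʳ u` of `L^red` lifts to `s' + i t'` in `L`, with
  -- `t' = -ℐ s'` in `K^⊥`. Horizontal uniqueness gives `s' = s`, so `ℐ v = -t'` at `p`.
  obtain ⟨s', t', hst, hs', -⟩ := (hL _ _ _).1 ((mem_plusIEigenspace_iff hr.sq_eq_neg).2 ⟨hu, rfl⟩)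
  have hpt := hst ⟨p, rfl⟩
  obtain ⟨hm, ht⟩ := (mem_plusIEigenspace_iff hKT.sq_eq_neg).1 hpt
  have hss : s' = s := H.eq_of_redProj_eq
    (fun q => mem_horizontal_of_mem_eigenspace (s'.2.1 q) (hst q).1)
    (fun q => mem_horizontal_of_mem_eigenspace (s.2.1 q) (hsV q)) hs'
  subst hss
  have hv' : (⟨s'.1 ⟨p, rfl⟩, hm⟩ : Vplus 𝒢 (ι p)) = v := Subtype.ext hsp
  have h1 := Submodule.neg_mem _ (t'.2.1 ⟨p, rfl⟩)
  rw [ht, neg_neg] at h1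
  rw [← hv']
  exact h1

variable (X ℐ ι) in
/-- A reduction setting together with an invariant strong KT structure such that `ℐ` preserves
`K^⊥ ∩ V₊`. -/
structure KTReductionSetting (EP : Type*) [NormedAddCommGroup EP] [NormedSpace ℝ EP]
    [ChartedSpace EP P] : Prop extends ReductionSetting X 𝒢 EP ι where
  kt : IsStrongKT C.toBracketedBundle 𝒢 ℐ
  pres : X.Preserves 𝒢 ℐ
  mem_Kperp : ∀ p (v : Vplus 𝒢 (ι p)), (v : E (ι p)) ∈ X.Kperp (ι p) →
    (ℐ (ι p) v : E (ι p)) ∈ X.Kperp (ι p)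

namespace KTReductionSetting

/-- `ℐ`, extended by zero on `V₋`. -/
def complexEnd (H : X.KTReductionSetting ℐ ι EP) : ∀ x, Module.End ℝ (E x) :=
  extendPlus (𝒢_𝒢 H.metric) ℐ

theorem complexEnd_of_mem (H : X.KTReductionSetting ℐ ι EP) {x : M} {u : E x}
    (hu : u ∈ Vplus 𝒢 x) : H.complexEnd x u = ℐ x ⟨u, hu⟩ := extendPlus_of_mem _ _ hu

theorem complexEnd_mem (H : X.KTReductionSetting ℐ ι EP) (x : M) (u : E x) :
    H.complexEnd x u ∈ Vplus 𝒢 x := extendPlus_mem _ _ _ _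

theorem complexEnd_complexEnd (H : X.KTReductionSetting ℐ ι EP) {x : M} {u : E x}
    (hu : u ∈ Vplus 𝒢 x) : H.complexEnd x (H.complexEnd x u) = -u := by
  rw [H.complexEnd_of_mem (H.complexEnd_mem x u)]
  have h1 : (⟨H.complexEnd x u, H.complexEnd_mem x u⟩ : Vplus 𝒢 x) = ℐ x ⟨u, hu⟩ :=
    Subtype.ext (H.complexEnd_of_mem hu)
  rw [h1, H.kt.sq_eq_neg]
  rfl

theorem mem_plusIEigenspace_iff_complexEnd (H : X.KTReductionSetting ℐ ι EP) {x : M}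
    {u v : E x} :
    (u, v) ∈ plusIEigenspace 𝒢 ℐ x ↔ u ∈ Vplus 𝒢 x ∧ v = -H.complexEnd x u := by
  rw [mem_plusIEigenspace_iff H.kt.sq_eq_neg]
  constructor
  · rintro ⟨h, rfl⟩
    exact ⟨h, by rw [H.complexEnd_of_mem h]⟩
  · rintro ⟨h, rfl⟩
    exact ⟨h, by rw [H.complexEnd_of_mem h]⟩

/-- For horizontal `v` both `v` and `𝒢 v` are in `K^⊥`, so the `V₊`-part of `v` lies in `K^⊥ ∩ V₊`,
which `ℐ` preserves. -/
theorem isReducibleEnd_complexEnd (H : X.KTReductionSetting ℐ ι EP) :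
    X.IsReducibleEnd 𝒢 ι H.complexEnd where
  smooth s := by
    obtain ⟨t, ht⟩ := exists_section_plusProj H.metric s
    have htm : ∀ x, t x ∈ Vplus 𝒢 x := fun x => ht x ▸ (plusProj (𝒢_𝒢 H.metric) x (s x)).2
    obtain ⟨r, hr⟩ := H.kt.smooth t htm
    refine ⟨r, fun x => (hr x).trans ?_⟩
    exact congrArg (fun w => (ℐ x w : E x)) (Subtype.ext (ht x))
  act g x v := by
    refine H.pres.complex g x (plusProj (𝒢_𝒢 H.metric) x v) _ ?_
    rw [plusProj_apply, plusProj_apply, H.inv, map_smul, map_add]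
  mem p v hv := by
    refine mem_horizontal_of_mem_eigenspace ?_ (H.complexEnd_mem _ _)
    refine H.mem_Kperp p _ ?_
    rw [plusProj_apply]
    exact Submodule.smul_mem _ _ (Submodule.add_mem _ hv.1 hv.2)

theorem redEnd_complexEnd_mem (H : X.KTReductionSetting ℐ ι EP)
    (z : MulAction.orbitRel.Quotient G P) (u : X.Ered ι z) :
    H.redEnd H.isReducibleEnd_complexEnd z u ∈ Vplus H.redMetric z := by
  obtain ⟨s, hs, rfl⟩ := H.exists_horizontal u
  rw [H.redEnd_redProj _ hs]
  exact H.mem_eigenspace_redMetric_iff.2 ⟨_, fun p => H.complexEnd_mem _ _, rfl⟩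

/-- The reduced complex structure. -/
def redComplex (H : X.KTReductionSetting ℐ ι EP) (z : MulAction.orbitRel.Quotient G P) :
    Vplus H.redMetric z →ₗ[ℝ] Vplus H.redMetric z :=
  (H.redEnd H.isReducibleEnd_complexEnd z).restrict fun u _ => H.redEnd_complexEnd_mem z u

theorem coe_redComplex (H : X.KTReductionSetting ℐ ι EP) {z : MulAction.orbitRel.Quotient G P}
    (u : Vplus H.redMetric z) :
    (H.redComplex z u : X.Ered ι z) = H.redEnd H.isReducibleEnd_complexEnd z u := rfl

theorem exists_plus_family (H : X.KTReductionSetting ℐ ι EP)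
    {z : MulAction.orbitRel.Quotient G P} {u : X.Ered ι z} (hu : u ∈ Vplus H.redMetric z) :
    ∃ s ∈ X.horizontalFamilies 𝒢 ι z, (∀ p, s.1 p ∈ Vplus 𝒢 (ι p.1)) ∧ X.redProj ι z s = u := by
  obtain ⟨s, hs, rfl⟩ := H.exists_horizontal u
  exact ⟨s, hs, (H.redProj_mem_eigenspace_iff hs).1 hu, rfl⟩

theorem redComplex_redComplex (H : X.KTReductionSetting ℐ ι EP)
    (z : MulAction.orbitRel.Quotient G P) (u : Vplus H.redMetric z) :
    H.redComplex z (H.redComplex z u) = -u := by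
  obtain ⟨u, hu⟩ := u
  obtain ⟨s, hs, hsV, rfl⟩ := H.exists_plus_family hu
  refine Subtype.ext ?_
  rw [H.coe_redComplex, H.coe_redComplex]
  change H.redEnd _ z (H.redEnd _ z (X.redProj ι z s)) = -X.redProj ι z s
  rw [H.redEnd_redProj _ hs, H.redEnd_redProj _
    (fun p => H.isReducibleEnd_complexEnd.mem p.1 _ (hs p)), ← map_neg]
  exact congrArg _ (Subtype.ext (funext fun p => H.complexEnd_complexEnd (hsV p)))

theorem mem_plusIEigenspace_redComplex_iff (H : X.KTReductionSetting ℐ ι EP)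
    {z : MulAction.orbitRel.Quotient G P} {u v : X.Ered ι z} :
    (u, v) ∈ plusIEigenspace H.redMetric H.redComplex z ↔ u ∈ Vplus H.redMetric z ∧
      v = -H.redEnd H.isReducibleEnd_complexEnd z u := by
  rw [mem_plusIEigenspace_iff H.redComplex_redComplex]
  exact ⟨fun ⟨h, h'⟩ => ⟨h, h'⟩, fun ⟨h, h'⟩ => ⟨h, h'⟩⟩

theorem mem_plusIEigenspace_red_iff (H : X.KTReductionSetting ℐ ι EP)
    {z : MulAction.orbitRel.Quotient G P} {u v : X.Ered ι z} :
    (u, v) ∈ plusIEigenspace H.redMetric H.redComplex z ↔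
      ∃ s t : X.invKperp ι z, (∀ p : OrbitPoints z, (s.1 p, t.1 p) ∈ plusIEigenspace 𝒢 ℐ (ι p.1)) ∧
        X.redProj ι z s = u ∧ X.redProj ι z t = v := by
  rw [H.mem_plusIEigenspace_redComplex_iff]
  constructor
  · rintro ⟨hu, rfl⟩
    obtain ⟨s, hs, hsV, rfl⟩ := H.exists_plus_family hu
    refine ⟨s, -⟨_, H.isReducibleEnd_complexEnd.mem_invKperp hs⟩, fun p => ?_, rfl, ?_⟩
    · exact H.mem_plusIEigenspace_iff_complexEnd.2 ⟨hsV p, rfl⟩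
    · rw [H.redEnd_redProj _ hs, map_neg]
  · rintro ⟨s, t, hst, rfl, rfl⟩
    have hst' := fun p => H.mem_plusIEigenspace_iff_complexEnd.1 (hst p)
    have hs : s ∈ X.horizontalFamilies 𝒢 ι z := fun p =>
      mem_horizontal_of_mem_eigenspace (s.2.1 p) (hst' p).1
    refine ⟨(H.redProj_mem_eigenspace_iff hs).2 fun p => (hst' p).1, ?_⟩
    rw [H.redEnd_redProj _ hs, ← map_neg]
    exact congrArg _ (Subtype.ext (funext fun p => (hst' p).2))

/-- Lifts with values in `L` of a section of `L^red`. -/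
theorem exists_plusI_lift (H : X.KTReductionSetting ℐ ι EP) {a b : X.RedSections ι EP}
    (hab : ∀ z, (a.1 z, b.1 z) ∈ plusIEigenspace H.redMetric H.redComplex z) :
    ∃ s, X.IsInvariantLift ι EP s a.1 ∧ (∀ p, s p ∈ Vplus 𝒢 (ι p)) ∧
      X.IsInvariantLift ι EP (fun p => -H.complexEnd (ι p) (s p)) b.1 := by
  have hab' := fun z => H.mem_plusIEigenspace_redComplex_iff.1 (hab z)
  obtain ⟨s, hs, hsh⟩ := H.exists_horizontal_lift a
  have hsV : ∀ p, s p ∈ Vplus 𝒢 (ι p) := by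
    intro p
    obtain ⟨hm, he⟩ := hs.represents (Quotient.mk _ p)
    have h1 := (hab' (Quotient.mk _ p)).1
    rw [← he] at h1
    exact (H.redProj_mem_eigenspace_iff (s := ⟨_, hm⟩) fun q => hsh q.1).1 h1 ⟨p, rfl⟩
  refine ⟨s, hs, hsV, ?_⟩
  have h2 := H.isInvariantLift_redEnd H.isReducibleEnd_complexEnd hs hsh
  refine ⟨?_, fun z => ?_⟩
  · refine contMDiff_of_eventually_section H.contMDiff_ι fun p => ?_
    obtain ⟨c, hc⟩ := H.exists_extension h2.smooth p
    exact ⟨-c, hc.mono fun q hq => congrArg Neg.neg hq⟩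
  · obtain ⟨hm, he⟩ := h2.represents z
    refine ⟨Submodule.neg_mem _ hm, ?_⟩
    rw [(hab' z).2, ← he, ← map_neg]
    rfl

/-- Local extension of a section of `L` over `P`. -/
theorem exists_plusI_extension (H : X.KTReductionSetting ℐ ι EP) {s : ∀ p : P, E (ι p)}
    (hs : ContMDiff 𝓘(ℝ, EP) (𝓘(ℝ, EM).prod 𝓘(ℝ, F)) ∞ (fun p => TotalSpace.mk' F (ι p) (s p)))
    (hsV : ∀ p, s p ∈ Vplus 𝒢 (ι p)) (p : P) :
    ∃ A B : Cₛ^∞⟮𝓘(ℝ, EM); F, E⟯, (∀ x, (A x, B x) ∈ plusIEigenspace 𝒢 ℐ x) ∧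
      (∀ᶠ q in 𝓝 p, A (ι q) = s q) ∧ ∀ᶠ q in 𝓝 p, B (ι q) = -H.complexEnd (ι q) (s q) := by
  obtain ⟨a, ha⟩ := H.exists_extension hs p
  obtain ⟨A, hA⟩ := exists_section_plusProj H.metric a
  obtain ⟨B, hB⟩ := H.isReducibleEnd_complexEnd.smooth A
  have hAs : ∀ᶠ q in 𝓝 p, A (ι q) = s q := by
    filter_upwards [ha] with q hq
    rw [hA, hq, plusProj_of_mem _ (hsV q)]
  refine ⟨A, -B, fun x => H.mem_plusIEigenspace_iff_complexEnd.2 ⟨?_, ?_⟩, hAs, ?_⟩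
  · rw [hA]
    exact (plusProj (𝒢_𝒢 H.metric) x (a x)).2
  · exact congrArg Neg.neg (hB x)
  · filter_upwards [hAs] with q hq
    rw [← hq, ← hB]
    rfl

/-- Here `u = (u - v) + v` lies in `K^⊥ ∩ V₊` and is therefore horizontal. This upgrades congruence
modulo `K` to equality in the proof of integrability. -/
theorem eq_of_sub_mem_K (H : X.KTReductionSetting ℐ ι EP) {p : P} {u v : E (ι p)}
    (hu : u ∈ Vplus 𝒢 (ι p)) (hv : v ∈ X.horizontal 𝒢 (ι p)) (huv : u - v ∈ X.K (ι p)) :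
    u = v := by
  have h1 := Submodule.add_mem _ (H.K_le_Kperp p huv) hv.1
  rw [sub_add_cancel] at h1
  exact sub_eq_zero.1 (H.eq_zero_of_mem_K_of_mem_horizontal huv
    (Submodule.sub_mem _ (mem_horizontal_of_mem_eigenspace h1 hu) hv))

theorem isStrongKT (H : X.KTReductionSetting ℐ ι EP)
    {br : X.RedSections ι EP → X.RedSections ι EP → X.RedSections ι EP}
    (hbr : X.IsReducedBracket ι EP br) :
    IsStrongKT (X.reducedBundle ι EP br) H.redMetric H.redComplex where
  metric := H.isGeneralizedMetric_redMetric br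
  smooth e he := H.exists_redSection_redEnd H.isReducibleEnd_complexEnd e
  sq_eq_neg := H.redComplex_redComplex
  orthogonal := by
    rintro z ⟨u, hu⟩ ⟨v, hv⟩
    obtain ⟨s, hs, hsV, rfl⟩ := H.exists_plus_family hu
    obtain ⟨t, ht, htV, rfl⟩ := H.exists_plus_family hv
    rw [H.coe_redComplex, H.coe_redComplex]
    change X.redPairing ι z (H.redEnd _ z (X.redProj ι z s)) (H.redEnd _ z (X.redProj ι z t)) = _
    rw [H.redEnd_redProj _ hs, H.redEnd_redProj _ ht, redPairing_redProj]
    change C.pairing _ (H.complexEnd _ (s.1 (basePoint z))) (H.complexEnd _ (t.1 (basePoint z))) = _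
    rw [H.complexEnd_of_mem (hsV _), H.complexEnd_of_mem (htV _)]
    exact H.kt.orthogonal _ _ _
  integrable a₁ b₁ a₂ b₂ h₁ h₂ z := by
    obtain ⟨s₁, hs₁, hV₁, ht₁⟩ := H.exists_plusI_lift h₁
    obtain ⟨s₂, hs₂, hV₂, ht₂⟩ := H.exists_plusI_lift h₂
    obtain ⟨caa, hcaa, haa⟩ := H.exists_horizontal_lift (br a₁ a₂)
    obtain ⟨cbb, hcbb, hbb⟩ := H.exists_horizontal_lift (br b₁ b₂)
    obtain ⟨cab, hcab, hab⟩ := H.exists_horizontal_lift (br a₁ b₂)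
    obtain ⟨cba, hcba, hba⟩ := H.exists_horizontal_lift (br b₁ a₂)
    obtain ⟨maa, eaa⟩ := hcaa.represents z
    obtain ⟨mbb, ebb⟩ := hcbb.represents z
    obtain ⟨mab, eab⟩ := hcab.represents z
    obtain ⟨mba, eba⟩ := hcba.represents z
    -- The real and imaginary parts are represented by the corresponding combinations of horizontal
    -- lifts of the four reduced brackets. These have to be shown to lie in `L`.
    refine H.mem_plusIEigenspace_red_iff.2 ⟨⟨_, maa⟩ - ⟨_, mbb⟩, ⟨_, mab⟩ + ⟨_, mba⟩, ?_, ?_, ?_⟩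
    · rintro ⟨p, -⟩
      change (caa p - cbb p, cab p + cba p) ∈ plusIEigenspace 𝒢 ℐ (ι p)
      obtain ⟨A₁, B₁, hL₁, hA₁, hB₁⟩ := H.exists_plusI_extension hs₁.smooth hV₁ p
      obtain ⟨A₂, B₂, hL₂, hA₂, hB₂⟩ := H.exists_plusI_extension hs₂.smooth hV₂ p
      have hL : (C.bracket A₁ A₂ (ι p) - C.bracket B₁ B₂ (ι p),
          C.bracket A₁ B₂ (ι p) + C.bracket B₁ A₂ (ι p)) ∈ plusIEigenspace 𝒢 ℐ (ι p) :=
        H.kt.integrable A₁ B₁ A₂ B₂ hL₁ hL₂ (ι p)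
      have kaa := (hbr _ _ _ _ _ hs₁ hs₂ hcaa p A₁ A₂ hA₁ hA₂).1
      have kbb := (hbr _ _ _ _ _ ht₁ ht₂ hcbb p B₁ B₂ hB₁ hB₂).1
      have kab := (hbr _ _ _ _ _ hs₁ ht₂ hcab p A₁ B₂ hA₁ hB₂).1
      have kba := (hbr _ _ _ _ _ ht₁ hs₂ hcba p B₁ A₂ hB₁ hA₂).1
      -- Each single bracket is only known modulo `K`. The combination lies in `V₊` by integrability
      -- over `M`, which makes the agreement exact.
      have e1 := H.eq_of_sub_mem_K hL.1 (Submodule.sub_mem _ (haa p) (hbb p)) (by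
        have := Submodule.sub_mem _ kaa kbb
        rwa [sub_sub_sub_comm] at this)
      have e2 := H.eq_of_sub_mem_K hL.2.1 (Submodule.add_mem _ (hab p) (hba p)) (by
        have := Submodule.add_mem _ kab kba
        rwa [sub_add_sub_comm] at this)
      change C.bracket A₁ A₂ (ι p) - C.bracket B₁ B₂ (ι p) = _ at e1
      change C.bracket A₁ B₂ (ι p) + C.bracket B₁ A₂ (ι p) = _ at e2
      rwa [e1, e2] at hL
    · rw [map_sub, eaa, ebb]
      rfl
    · rw [map_add, eab, eba]
      rfl

theorem reduces (H : X.KTReductionSetting ℐ ι EP)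
    {br : X.RedSections ι EP → X.RedSections ι EP → X.RedSections ι EP}
    (hbr : X.IsReducedBracket ι EP br) : X.Reduces ι EP br 𝒢 ℐ :=
  ⟨H.redMetric, H.redComplex, H.isStrongKT hbr, fun _ _ => H.mem_eigenspace_redMetric_iff,
    fun _ _ => H.mem_eigenspace_redMetric_iff, fun _ _ _ => H.mem_plusIEigenspace_red_iff⟩

end KTReductionSetting

end ExtendedAction

end MainTheorem

end

theorem mainTheorem1
    {EM : Type*} [NormedAddCommGroup EM] [NormedSpace ℝ EM] [FiniteDimensional ℝ EM]
    {M : Type*} [TopologicalSpace M] [ChartedSpace EM M] [IsManifold 𝓘(ℝ, EM) ∞ M]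
    [T2Space M] [SigmaCompactSpace M]
    {F : Type*} [NormedAddCommGroup F] [NormedSpace ℝ F] [FiniteDimensional ℝ F]
    {E : M → Type*} [TopologicalSpace (TotalSpace F E)] [∀ x, AddCommGroup (E x)]
    [∀ x, Module ℝ (E x)] [∀ x, TopologicalSpace (E x)] [FiberBundle F E] [VectorBundle ℝ F E]
    [ContMDiffVectorBundle ∞ F E 𝓘(ℝ, EM)]
    {EG : Type*} [NormedAddCommGroup EG] [NormedSpace ℝ EG] [FiniteDimensional ℝ EG]
    {G : Type*} [TopologicalSpace G] [ChartedSpace EG G] [Group G] [LieGroup 𝓘(ℝ, EG) ∞ G]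
    [ConnectedSpace G]
    [MulAction G M] [ContMDiffSMul 𝓘(ℝ, EG) 𝓘(ℝ, EM) ∞ G M]
    {𝔞 : Type*} [AddCommGroup 𝔞] [Module ℝ 𝔞]
    {EP : Type*} [NormedAddCommGroup EP] [NormedSpace ℝ EP] [FiniteDimensional ℝ EP]
    {P : Type*} [TopologicalSpace P] [ChartedSpace EP P] [IsManifold 𝓘(ℝ, EP) ∞ P]
    [T2Space P] [SigmaCompactSpace P]
    -- `G` acts smoothly, freely and properly on `P`
    [MulAction G P] [ContMDiffSMul 𝓘(ℝ, EG) 𝓘(ℝ, EP) ∞ G P] [IsCancelSMul G P] [ProperSMul G P]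
    (C : CourantAlgebroid EM F E) (hC : C.IsExact)
    (𝒜 : CourantAlgebra 𝔞 (GroupLieAlgebra 𝓘(ℝ, EG) G)) (h𝒜 : 𝒜.IsExact)
    (X : ExtendedAction C 𝒜)
    (𝒢 : ∀ x, Module.End ℝ (E x)) (ℐ : ∀ x, Vplus 𝒢 x →ₗ[ℝ] Vplus 𝒢 x)
    (hKT : IsStrongKT C.toBracketedBundle 𝒢 ℐ) (hpres : X.Preserves 𝒢 ℐ)
    -- `P` is a leaf of `Δ_b`, included in `M` by the `G`-equivariant map `ι`
    (ι : P →[G] M) (hleaf : IsLeaf (EP := EP) X.bigDistribution ι)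
    -- `K` is isotropic over `P`
    (hiso : ∀ p, ∀ u ∈ X.K (ι p), ∀ v ∈ X.K (ι p), C.pairing (ι p) u v = 0) :
    (∃! br, X.IsReducedBracket ι EP br) ∧
    ∀ br, X.IsReducedBracket ι EP br →
      (X.Reduces ι EP br 𝒢 ℐ ↔
        ∀ p, ((X.Kperp (ι p)).submoduleOf (Vplus 𝒢 (ι p))).map (ℐ (ι p)) =
          (X.Kperp (ι p)).submoduleOf (Vplus 𝒢 (ι p))) := by
  have H : ExtendedAction.ReductionSetting X 𝒢 EP ι :=
    ⟨hC, h𝒜, hKT.metric, hpres.metric, hleaf, hiso⟩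
  refine ⟨H.existsUnique_reducedBracket, fun br hbr => ⟨fun hred p => ?_, fun h => ?_⟩⟩
  · have hmem := H.mem_Kperp_of_reduces hKT hred p
    refine le_antisymm ?_ fun v hv => ?_
    · rintro _ ⟨v, hv, rfl⟩
      exact hmem v hv
    -- Since `ℐ² = -1`, the preimage of `v` is `-ℐ v`, so invariance already gives equality.
    · refine ⟨-ℐ (ι p) v, Submodule.neg_mem _ (hmem v hv), ?_⟩
      rw [map_neg, hKT.sq_eq_neg, neg_neg]
  · have H' : X.KTReductionSetting ℐ ι EP :=
      ⟨H, hKT, hpres, fun p v hv => (h p).le ⟨v, hv, rfl⟩⟩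
    exact H'.reduces hbr
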